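/- Let $q>0$ be a real number with $q\neq 1$ and $[x]=\frac{q^x-q^{-x}}{q-q^{-1}}$. **The algebras.** Let $U=\mathcal U_q(\mathrm{su}_2)$ be the Hopf $*$-algebra with generators $E,F,K,K^{-1}$, relations $KK^{-1}=K^{-1}K=1$, $KE=qEK$, $FK=qKF$, $EF-FE=\frac{1}{q-q^{-1}}(K^2-K^{-2})$, involution $E^*=F$, $K^*=K$, comultiplication $\Delta(E)=E\otimes K+K^{-1}\otimes E$, $\Delta(F)=F\otimes K+K^{-1}\otimes F$, $\Delta(K)=K\otimes K$, counit $\varepsilon(E)=\varepsilon(F)=0$, $\varepsilon(K)=1$, and antipode $S(K)=K^{-1}$, $S(E)=-qE$, $S(F)=-q^{-1}F$. Let $\mathcal O(\mathrm{SU}_q(2))$ be the $*$-algebra generated by the entries of $\begin{pmatrix}a&b\\c&d\end{pmatrix}$ with relations $ab=q\,ba$, $ac=q\,ca$, $bd=q\,db$, $cd=q\,dc$, $bc=cb$, $ad=1+q\,bc$, $da=1+q^{-1}bc$ and involution $a^*=d$, $b^*=-qc$. Its counit $\varepsilon$ is the character with $\varepsilon(a)=\varepsilon(d)=1$, $\varepsilon(b)=\varepsilon(c)=0$.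 It is a left $U$-module $*$-algebra, i.e. $f\triangleright(xy)=(f_{(1)}\triangleright x)(f_{(2)}\triangleright y)$, $f\triangleright 1=\varepsilon(f)1$ and $(f\triangleright x)^*=S(f)^*\triangleright x^*$, with $E\triangleright a=b$, $E\triangleright c=d$, $E\triangleright b=E\triangleright d=0$, $F\triangleright b=a$, $F\triangleright d=c$, $F\triangleright a=F\triangleright c=0$, and $K\triangleright x=q^{-1/2}x$ for $x=a,c$, $K\triangleright x=q^{1/2}x$ for $x=b,d$. For $l\in\frac12\mathbb N_0$ and $j,k\in\{-l,-l+1,\dots,l\}$ let $t^l_{jk}$ be the matrix elements of the spin $l$ unitary corepresentation, given by $$t^l_{j,-l}=q^{-(l+j)(l-j)/2}\Big(\tfrac{[2l]!}{[l+j]!\,[l-j]!}\Big)^{1/2}a^{l-j}c^{l+j},\qquad E\triangleright t^l_{jk}=\alpha^l_k\,t^l_{j,k+1},\qquad \alpha^l_k=([l-k][l+k+1])^{1/2}.$$ The $t^l_{jk}$ form a linear basis of $\mathcal O(\mathrm{SU}_q(2))$, and the Haar state $h$ is the linear functional with $h(t^0_{00})=h(1)=1$ and $h(t^l_{jk})=0$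 for $l>0$. The standard Podleś sphere is the $*$-subalgebra and left $U$-submodule $\mathcal O(\mathrm S^2_q)=\{x\in\mathcal O(\mathrm{SU}_q(2)):\partial_{K^2}(x)=x\}$, where $\partial_{K^2}$ is the algebra automorphism with $a\mapsto qa$, $b\mapsto qb$, $c\mapsto q^{-1}c$, $d\mapsto q^{-1}d$ (so $\partial_{K^2}(t^l_{jk})=q^{-2j}t^l_{jk}$). The restrictions of $\varepsilon$ and $h$ to it are denoted by the same symbols. Put $\mathcal B=\mathcal O(\mathrm S^2_q)$ and $\theta(x)=K^{-2}\triangleright x$ for $x\in\mathcal B$. **Twisted cyclic cohomology.** $\mathrm{HC}^0_\theta(\mathcal B)$ is the space of linear functionals $\varphi:\mathcal B\to\mathbb C$ with $\varphi(\theta(x))=\varphi(x)$ and $\varphi(xy)=\varphi(\theta(y)x)$ for all $x,y\in\mathcal B$. **Equivariant $K_0$.** For a matrix $X$ over $\mathcal B$ put $X^\dagger=(\theta^{-1}(X))^*$. An invariant projection is a square matrix $P\in M_{n\times n}(\mathcal B)$ with $P^2=P=P^\dagger$, together with a $*$-representation $\rho^\circ$ on $\mathbb C^n$ of the opposite algebra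 of $U$, such that $\rho^\circ(S^{-1}(f_{(1)}))\,(S^{-2}(f_{(2)})\triangleright P)\,\rho^\circ(f_{(3)})=\varepsilon(f)P$ for all $f\in U$. Invariant projections $P$, $Q$ of sizes $n$, $m$, with representations $\rho_1^\circ$, $\rho_2^\circ$, are equivalent if there is $V\in M_{m\times n}(\mathcal B)$ with $V^\dagger V=P$, $VV^\dagger=Q$ and $\pi_2^\circ(f)V=V\pi_1^\circ(f)$ for all $f\in U$, where $\pi_i^\circ(f)(v\otimes x)=\rho_i^\circ(f_{(2)})v\otimes S^{-1}(f_{(1)})\triangleright x$. The group $K_0^{U}(\mathcal B)$ is the Grothendieck group of the semigroup of equivalence classes of invariant projections of any size, with $[P]+[Q]=[P\oplus Q]$ (and representation $\rho_1^\circ\oplus\rho_2^\circ$) and $[0]=0$. The pairing $\langle\cdot,\cdot\rangle:\mathrm{HC}^0_\theta(\mathcal B)\times K_0^{U}(\mathcal B)\to\mathbb C$ is $$\langle[\varphi],[P]\rangle=\varphi\Big(\sum_{i,j}\rho^\circ(K^{-2})_{ji}P_{ij}\Big).$$ **The projections $P_N$.** Let $\sigma_l$ be the spin $l$ matrix representation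 of $U$ on $\mathbb C^{2l+1}$ with basis $e_{-l},\dots,e_l$, given by $Ee_k=\alpha^l_ke_{k+1}$, $Fe_k=\alpha^l_{k-1}e_{k-1}$, $Ke_k=q^ke_k$, and put $\rho_l^\circ(f)=\sigma_l(K^{-1}S(f)K)$. For $N\in\mathbb Z$ let $l=|N|/2$, let $\mathbf t$ be the row vector $(t^l_{N/2,-l},t^l_{N/2,-l+1},\dots,t^l_{N/2,l})$, and let $$P_N=\rho_l^\circ(K^{-1})\,\mathbf t^*\,\mathbf t\,\rho_l^\circ(K).$$ **Proposition.** $\varepsilon$ and $h$ belong to $\mathrm{HC}^0_\theta(\mathcal O(\mathrm S^2_q))$ and form a basis of it, i.e. $\mathrm{HC}^0_\theta(\mathcal O(\mathrm S^2_q))=\mathbb C[\varepsilon]\oplus\mathbb C[h]$. For every $N\in\mathbb Z$, the matrix $P_N$ has entries in $\mathcal O(\mathrm S^2_q)$ and is an invariant projection with respect to $\rho_{|N|/2}^\circ$, and $$\langle[\varepsilon],[P_N]\rangle=q^{N},\qquad\langle[h],[P_N]\rangle=q^{-N}.$$ -/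

import Mathlib

open scoped TensorProduct ComplexConjugate
set_option linter.unusedSectionVars false
set_option linter.unusedSimpArgs false

noncomputable section

namespace QSphere

/-! ### Algebras given by generators and relations -/

section Presentation

variable {X : Type} {r : FreeAlgebra ℂ X → FreeAlgebra ℂ X → Prop}

/-- The image of a generator in the complex algebra with generators `X` and relations `r`. -/
def gen (r : FreeAlgebra ℂ X → FreeAlgebra ℂ X → Prop) (x : X) : RingQuot r :=
  RingQuot.mkAlgHom ℂ r (FreeAlgebra.ι ℂ x)

/-- The algebra map determined by the images of the generators. -/
def presLift {A : Type} [Ring A] [Algebra ℂ A] (g : X → A)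
    (h : ∀ ⦃x y⦄, r x y → FreeAlgebra.lift ℂ g x = FreeAlgebra.lift ℂ g y) :
    RingQuot r →ₐ[ℂ] A :=
  RingQuot.liftAlgHom ℂ ⟨FreeAlgebra.lift ℂ g, h⟩

theorem presLift_gen {A : Type} [Ring A] [Algebra ℂ A] (g : X → A)
    (h : ∀ ⦃x y⦄, r x y → FreeAlgebra.lift ℂ g x = FreeAlgebra.lift ℂ g y) (x : X) :
    presLift g h (gen r x) = g x := by
  simp [presLift, gen, RingQuot.liftAlgHom_mkAlgHom_apply]

theorem pres_induction {p : RingQuot r → Prop} (hc : ∀ c : ℂ, p (algebraMap ℂ _ c))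
    (hg : ∀ x, p (gen r x)) (ha : ∀ x y, p x → p y → p (x + y))
    (hm : ∀ x y, p x → p y → p (x * y)) (x : RingQuot r) : p x := by
  obtain ⟨y, rfl⟩ := RingQuot.mkAlgHom_surjective ℂ r x
  induction y using FreeAlgebra.induction with
  | grade0 c => simpa using hc c
  | grade1 x => exact hg x
  | mul a b h1 h2 => rw [map_mul]; exact hm _ _ h1 h2
  | add a b h1 h2 => rw [map_add]; exact ha _ _ h1 h2

end Presentation

/-- The opposite of a complex algebra with the conjugate scalar multiplication; an algebra map
`A → ConjOp A` is an antilinear antihomomorphism of `A`. -/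
def ConjOp (A : Type) : Type := Aᵐᵒᵖ

instance (A : Type) [Ring A] : Ring (ConjOp A) := inferInstanceAs (Ring Aᵐᵒᵖ)

instance (A : Type) [Ring A] [Algebra ℂ A] : Algebra ℂ (ConjOp A) :=
  RingHom.toAlgebra' ((algebraMap ℂ Aᵐᵒᵖ).comp (starRingEnd ℂ))
    (fun c x => Algebra.commutes (A := Aᵐᵒᵖ) (starRingEnd ℂ c) x)

/-- An element of `A` regarded as an element of `ConjOp A`. -/
def ConjOp.mk {A : Type} (x : A) : ConjOp A := MulOpposite.op x

/-- The element of `A` underlying an element of `ConjOp A`. -/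
def ConjOp.out {A : Type} (x : ConjOp A) : A := MulOpposite.unop x

section
variable {A : Type} [Ring A] [Algebra ℂ A]

@[simp] theorem ConjOp.out_mk (x : A) : (ConjOp.mk x).out = x := rfl
@[simp] theorem ConjOp.mk_out (x : ConjOp A) : ConjOp.mk x.out = x := rfl
theorem ConjOp.out_mul (x y : ConjOp A) : (x * y).out = y.out * x.out := rfl
theorem ConjOp.mk_mul (x y : A) : ConjOp.mk (x * y) = ConjOp.mk y * ConjOp.mk x := rfl
theorem ConjOp.mk_add (x y : A) : ConjOp.mk (x + y) = ConjOp.mk x + ConjOp.mk y := rfl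
theorem ConjOp.mk_sub (x y : A) : ConjOp.mk (x - y) = ConjOp.mk x - ConjOp.mk y := rfl
theorem ConjOp.out_sub (x y : ConjOp A) : (x - y).out = x.out - y.out := rfl
theorem ConjOp.out_add (x y : ConjOp A) : (x + y).out = x.out + y.out := rfl
theorem ConjOp.out_neg (x : ConjOp A) : (-x).out = -x.out := rfl
theorem ConjOp.out_one : (1 : ConjOp A).out = 1 := rfl
theorem ConjOp.mk_one : ConjOp.mk (1 : A) = 1 := rfl
theorem ConjOp.out_algebraMap (c : ℂ) :
    (algebraMap ℂ (ConjOp A) c).out = algebraMap ℂ A (conj c) := rfl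
theorem ConjOp.out_smul (c : ℂ) (x : ConjOp A) : (c • x).out = conj c • x.out := by
  rw [Algebra.smul_def, ConjOp.out_mul, ConjOp.out_algebraMap, ← Algebra.commutes,
    ← Algebra.smul_def]
theorem ConjOp.ext {x y : ConjOp A} (h : x.out = y.out) : x = y :=
  congrArg ConjOp.mk h

end

/-! ### The Hopf `*`-algebra `U_q(su₂)` -/

/-- Generators of `U_q(su₂)`; `Ki` stands for `K⁻¹`. -/
inductive UGen | E | F | K | Ki

/-- Defining relations of `U_q(su₂)`. -/
inductive URel (q : ℝ) : FreeAlgebra ℂ UGen → FreeAlgebra ℂ UGen → Prop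
  | KKi : URel q (FreeAlgebra.ι ℂ .K * FreeAlgebra.ι ℂ .Ki) 1
  | KiK : URel q (FreeAlgebra.ι ℂ .Ki * FreeAlgebra.ι ℂ .K) 1
  | KE : URel q (FreeAlgebra.ι ℂ .K * FreeAlgebra.ι ℂ .E)
      ((q : ℂ) • (FreeAlgebra.ι ℂ .E * FreeAlgebra.ι ℂ .K))
  | FK : URel q (FreeAlgebra.ι ℂ .F * FreeAlgebra.ι ℂ .K)
      ((q : ℂ) • (FreeAlgebra.ι ℂ .K * FreeAlgebra.ι ℂ .F))
  | EF : URel q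
      (FreeAlgebra.ι ℂ .E * FreeAlgebra.ι ℂ .F - FreeAlgebra.ι ℂ .F * FreeAlgebra.ι ℂ .E)
      ((1 / ((q : ℂ) - (q : ℂ)⁻¹)) •
        (FreeAlgebra.ι ℂ .K * FreeAlgebra.ι ℂ .K - FreeAlgebra.ι ℂ .Ki * FreeAlgebra.ι ℂ .Ki))

/-- The algebra `U_q(su₂)`. -/
def Uq (q : ℝ) : Type := RingQuot (URel q)

instance (q : ℝ) : Ring (Uq q) := inferInstanceAs (Ring (RingQuot (URel q)))
instance (q : ℝ) : Algebra ℂ (Uq q) := inferInstanceAs (Algebra ℂ (RingQuot (URel q)))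

namespace Uq

variable {q : ℝ}

/-- The generator `E`. -/
def E : Uq q := gen (URel q) .E
/-- The generator `F`. -/
def F : Uq q := gen (URel q) .F
/-- The generator `K`. -/
def K : Uq q := gen (URel q) .K
/-- The generator `K⁻¹`. -/
def Ki : Uq q := gen (URel q) .Ki

theorem K_mul_Ki : (K * Ki : Uq q) = 1 := by
  have := RingQuot.mkAlgHom_rel ℂ (URel.KKi (q := q))
  rw [map_mul, map_one] at this; exact this

theorem Ki_mul_K : (Ki * K : Uq q) = 1 := by
  have := RingQuot.mkAlgHom_rel ℂ (URel.KiK (q := q))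
  rw [map_mul, map_one] at this; exact this

theorem K_mul_E : (K * E : Uq q) = (q : ℂ) • (E * K) := by
  have := RingQuot.mkAlgHom_rel ℂ (URel.KE (q := q))
  rw [map_mul, map_smul, map_mul] at this; exact this

theorem F_mul_K : (F * K : Uq q) = (q : ℂ) • (K * F) := by
  have := RingQuot.mkAlgHom_rel ℂ (URel.FK (q := q))
  rw [map_mul, map_smul, map_mul] at this; exact this

theorem E_mul_F_sub : (E * F - F * E : Uq q) =
    (1 / ((q : ℂ) - (q : ℂ)⁻¹)) • (K * K - Ki * Ki) := by
  have := RingQuot.mkAlgHom_rel ℂ (URel.EF (q := q))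
  simp only [map_mul, map_smul, map_sub] at this; exact this

theorem E_mul_Ki : (E * Ki : Uq q) = (q : ℂ) • (Ki * E) := by
  calc (E * Ki : Uq q) = Ki * (K * E) * Ki := by
        rw [← mul_assoc Ki, Ki_mul_K, one_mul]
    _ = _ := by rw [K_mul_E, mul_smul_comm, smul_mul_assoc, mul_assoc, mul_assoc, K_mul_Ki, mul_one]

theorem Ki_mul_F : (Ki * F : Uq q) = (q : ℂ) • (F * Ki) := by
  calc (Ki * F : Uq q) = Ki * (F * K) * Ki := by
        rw [mul_assoc, mul_assoc F, K_mul_Ki, mul_one]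
    _ = _ := by rw [F_mul_K, mul_smul_comm, smul_mul_assoc, ← mul_assoc Ki, Ki_mul_K, one_mul]

@[elab_as_elim]
theorem induction {p : Uq q → Prop} (hc : ∀ c : ℂ, p (algebraMap ℂ _ c))
    (hE : p E) (hF : p F) (hK : p K) (hKi : p Ki) (ha : ∀ x y, p x → p y → p (x + y))
    (hm : ∀ x y, p x → p y → p (x * y)) (x : Uq q) : p x :=
  pres_induction hc (fun x => by cases x <;> assumption) ha hm x

/-- Images of the generators under a map out of `U_q(su₂)`. -/
def genMap {A : Type} (e f k k' : A) : UGen → A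
  | .E => e
  | .F => f
  | .K => k
  | .Ki => k'

section lift
variable {A : Type} [Ring A] [Algebra ℂ A] (e f k k' : A)
  (h1 : k * k' = 1) (h2 : k' * k = 1) (h3 : k * e = (q : ℂ) • (e * k))
  (h4 : f * k = (q : ℂ) • (k * f))
  (h5 : e * f - f * e = (1 / ((q : ℂ) - (q : ℂ)⁻¹)) • (k * k - k' * k'))

/-- The algebra map out of `U_q(su₂)` given by elements that satisfy the defining relations. -/
def lift : Uq q →ₐ[ℂ] A :=
  presLift (genMap e f k k') (by
    intro x y h
    cases h <;> simp only [map_mul, map_smul, map_sub, map_one, FreeAlgebra.lift_ι_apply, genMap]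
    exacts [h1, h2, h3, h4, h5])

@[simp] theorem lift_E : lift e f k k' h1 h2 h3 h4 h5 E = e := presLift_gen _ _ _
@[simp] theorem lift_F : lift e f k k' h1 h2 h3 h4 h5 F = f := presLift_gen _ _ _
@[simp] theorem lift_K : lift e f k k' h1 h2 h3 h4 h5 K = k := presLift_gen _ _ _
@[simp] theorem lift_Ki : lift e f k k' h1 h2 h3 h4 h5 Ki = k' := presLift_gen _ _ _
end lift

theorem algHom_ext {A : Type} [Ring A] [Algebra ℂ A] {f g : Uq q →ₐ[ℂ] A}
    (hE : f E = g E) (hF : f F = g F) (hK : f K = g K) (hKi : f Ki = g Ki) : f = g := by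
  ext x
  induction x using Uq.induction with
  | hc c => simp
  | hE => exact hE
  | hF => exact hF
  | hK => exact hK
  | hKi => exact hKi
  | ha x y h1 h2 => simp [h1, h2]
  | hm x y h1 h2 => simp [h1, h2]

/-- The counit. -/
def counitHom : Uq q →ₐ[ℂ] ℂ :=
  lift 0 0 1 1 (by simp) (by simp) (by simp) (by simp) (by simp)

/-- The comultiplication. -/
def comulHom : Uq q →ₐ[ℂ] Uq q ⊗[ℂ] Uq q :=
  lift (E ⊗ₜ K + Ki ⊗ₜ E) (F ⊗ₜ K + Ki ⊗ₜ F) (K ⊗ₜ K) (Ki ⊗ₜ Ki)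
    (by simp [K_mul_Ki, Algebra.TensorProduct.one_def])
    (by simp [Ki_mul_K, Algebra.TensorProduct.one_def])
    (by
      simp only [mul_add, add_mul, Algebra.TensorProduct.tmul_mul_tmul, K_mul_E, K_mul_Ki,
        Ki_mul_K, smul_add, TensorProduct.smul_tmul', TensorProduct.tmul_smul])
    (by
      simp only [mul_add, add_mul, Algebra.TensorProduct.tmul_mul_tmul, F_mul_K, K_mul_Ki,
        Ki_mul_K, smul_add, TensorProduct.smul_tmul', TensorProduct.tmul_smul])
    (by
      have hEF : (E * F : Uq q) = F * E + (1 / ((q : ℂ) - (q : ℂ)⁻¹)) • (K * K - Ki * Ki) := by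
        rw [← E_mul_F_sub]; abel
      simp only [mul_add, add_mul, Algebra.TensorProduct.tmul_mul_tmul, F_mul_K, K_mul_E,
        E_mul_Ki, Ki_mul_F, hEF, smul_add, smul_sub, TensorProduct.add_tmul, TensorProduct.tmul_add,
        TensorProduct.sub_tmul, TensorProduct.tmul_sub,
        TensorProduct.smul_tmul', TensorProduct.tmul_smul]
      abel)

instance : Bialgebra ℂ (Uq q) :=
  Bialgebra.ofAlgHom comulHom counitHom
    (by
      apply algHom_ext <;>
      simp [comulHom, TensorProduct.add_tmul, TensorProduct.tmul_add, add_assoc])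
    (by
      apply algHom_ext <;> simp [comulHom, counitHom])
    (by
      apply algHom_ext <;> simp [comulHom, counitHom])

theorem comul_eq (x : Uq q) : Coalgebra.comul (R := ℂ) x = comulHom x := rfl
theorem counit_eq (x : Uq q) : Coalgebra.counit (R := ℂ) x = counitHom x := rfl

section star

/-- The involution as an algebra map to the conjugate opposite algebra. -/
def starHom : Uq q →ₐ[ℂ] ConjOp (Uq q) :=
  lift (ConjOp.mk F) (ConjOp.mk E) (ConjOp.mk K) (ConjOp.mk Ki)
    (by rw [← ConjOp.mk_mul, Ki_mul_K, ConjOp.mk_one])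
    (by rw [← ConjOp.mk_mul, K_mul_Ki, ConjOp.mk_one])
    (by
      apply ConjOp.ext
      simp only [ConjOp.out_mul, ConjOp.out_smul, ConjOp.out_mk, F_mul_K, Complex.conj_ofReal])
    (by
      apply ConjOp.ext
      simp only [ConjOp.out_mul, ConjOp.out_smul, ConjOp.out_mk, K_mul_E, Complex.conj_ofReal])
    (by
      apply ConjOp.ext
      simp only [ConjOp.out_mul, ConjOp.out_smul, ConjOp.out_mk, ConjOp.out_sub, E_mul_F_sub,
        map_div₀, map_one, map_sub, map_inv₀, Complex.conj_ofReal])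

theorem starHom_starHom (x : Uq q) : (starHom (starHom x).out).out = x := by
  induction x using Uq.induction with
  | hc c => rw [AlgHom.commutes, ConjOp.out_algebraMap, AlgHom.commutes, ConjOp.out_algebraMap,
      Complex.conj_conj]
  | hE => simp [starHom]
  | hF => simp [starHom]
  | hK => simp [starHom]
  | hKi => simp [starHom]
  | ha x y h1 h2 => rw [map_add, ConjOp.out_add, map_add, ConjOp.out_add, h1, h2]
  | hm x y h1 h2 => rw [map_mul, ConjOp.out_mul, map_mul, ConjOp.out_mul, h1, h2]

/-- The involution of `U_q(su₂)`: `E* = F`, `K* = K`. -/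
instance : StarRing (Uq q) where
  star x := (starHom x).out
  star_involutive x := starHom_starHom x
  star_mul x y := by rw [map_mul, ConjOp.out_mul]
  star_add x y := by rw [map_add, ConjOp.out_add]

theorem star_def (x : Uq q) : star x = (starHom x).out := rfl

instance : StarModule ℂ (Uq q) where
  star_smul c x := by rw [star_def, map_smul, ConjOp.out_smul]; rfl

@[simp] theorem star_E : star (E : Uq q) = F := by simp [star_def, starHom]
@[simp] theorem star_F : star (F : Uq q) = E := by simp [star_def, starHom]
@[simp] theorem star_K : star (K : Uq q) = K := by simp [star_def, starHom]
@[simp] theorem star_Ki : star (Ki : Uq q) = Ki := by simp [star_def, starHom]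

end star

section antipode

variable [hq : Fact (0 < q)]

theorem q_ne : (q : ℂ) ≠ 0 := by exact_mod_cast hq.out.ne'

/-- The antipode as an algebra map to the opposite algebra. -/
def antipodeHom : Uq q →ₐ[ℂ] (Uq q)ᵐᵒᵖ :=
  lift (MulOpposite.op (-(q : ℂ) • E)) (MulOpposite.op (-(q : ℂ)⁻¹ • F))
    (MulOpposite.op Ki) (MulOpposite.op K)
    (by rw [← MulOpposite.op_mul, K_mul_Ki, MulOpposite.op_one])
    (by rw [← MulOpposite.op_mul, Ki_mul_K, MulOpposite.op_one])
    (by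
      rw [← MulOpposite.op_mul, ← MulOpposite.op_mul, ← MulOpposite.op_smul, smul_mul_assoc,
        E_mul_Ki, mul_smul_comm, smul_comm (q : ℂ)])
    (by
      rw [← MulOpposite.op_mul, ← MulOpposite.op_mul, ← MulOpposite.op_smul, mul_smul_comm,
        Ki_mul_F, smul_mul_assoc, smul_comm (q : ℂ)])
    (by
      have hq0 : (q : ℂ) ≠ 0 := q_ne
      have h1 : -(q : ℂ) * -(q : ℂ)⁻¹ = 1 := by field_simp
      have h2 : -(q : ℂ)⁻¹ * -(q : ℂ) = 1 := by field_simp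
      rw [← MulOpposite.op_mul, ← MulOpposite.op_mul, ← MulOpposite.op_mul,
        ← MulOpposite.op_mul, ← MulOpposite.op_sub, ← MulOpposite.op_sub, ← MulOpposite.op_smul]
      congr 1
      rw [smul_mul_smul_comm, smul_mul_smul_comm, h1, h2, one_smul, one_smul, ← neg_sub,
        E_mul_F_sub, ← smul_neg, neg_sub])

/-- The antipode. -/
def antipodeLin : Uq q →ₗ[ℂ] Uq q :=
  (MulOpposite.opLinearEquiv ℂ).symm.toLinearMap ∘ₗ antipodeHom.toLinearMap

theorem antipodeLin_mul (x y : Uq q) :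
    antipodeLin (x * y) = antipodeLin y * antipodeLin x := by
  simp [antipodeLin]

@[simp] theorem antipodeLin_algebraMap (c : ℂ) :
    antipodeLin (algebraMap ℂ (Uq q) c) = algebraMap ℂ (Uq q) c := by
  simp [antipodeLin]

@[simp] theorem antipodeLin_E : antipodeLin (E : Uq q) = -(q : ℂ) • E := by
  simp [antipodeLin, antipodeHom]
@[simp] theorem antipodeLin_F : antipodeLin (F : Uq q) = -(q : ℂ)⁻¹ • F := by
  simp [antipodeLin, antipodeHom]
@[simp] theorem antipodeLin_K : antipodeLin (K : Uq q) = Ki := by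
  simp [antipodeLin, antipodeHom]
@[simp] theorem antipodeLin_Ki : antipodeLin (Ki : Uq q) = K := by
  simp [antipodeLin, antipodeHom]

theorem antipode_left_mul (w : Uq q ⊗[ℂ] Uq q) (u v : Uq q) :
    LinearMap.mul' ℂ (Uq q) (antipodeLin.rTensor (Uq q) (w * u ⊗ₜ v)) =
      antipodeLin u * LinearMap.mul' ℂ (Uq q) (antipodeLin.rTensor (Uq q) w) * v := by
  induction w using TensorProduct.induction_on with
  | zero => simp
  | tmul a b => simp [antipodeLin_mul, mul_assoc]
  | add a b h1 h2 => rw [add_mul, map_add, map_add, h1, h2, map_add, map_add, mul_add, add_mul]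

theorem antipode_right_mul (w : Uq q ⊗[ℂ] Uq q) (u v : Uq q) :
    LinearMap.mul' ℂ (Uq q) (antipodeLin.lTensor (Uq q) (u ⊗ₜ v * w)) =
      u * LinearMap.mul' ℂ (Uq q) (antipodeLin.lTensor (Uq q) w) * antipodeLin v := by
  induction w using TensorProduct.induction_on with
  | zero => simp
  | tmul a b => simp [antipodeLin_mul, mul_assoc]
  | add a b h1 h2 => rw [mul_add, map_add, map_add, h1, h2, map_add, map_add, mul_add, add_mul]

theorem antipode_left (x : Uq q) :
    LinearMap.mul' ℂ (Uq q) (antipodeLin.rTensor (Uq q) (comulHom x)) =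
      algebraMap ℂ (Uq q) (counitHom x) := by
  induction x using Uq.induction with
  | hc c => simp [Algebra.TensorProduct.algebraMap_apply]
  | hE => simp [comulHom, counitHom, K_mul_E]
  | hF => simp [comulHom, counitHom, F_mul_K, smul_smul, inv_mul_cancel₀ (q_ne (q := q)),
      -Complex.coe_smul]
  | hK => simp [comulHom, counitHom, Ki_mul_K]
  | hKi => simp [comulHom, counitHom, K_mul_Ki]
  | ha x y h1 h2 => simp only [map_add, h1, h2]
  | hm x y h1 h2 =>
    have key : ∀ w : Uq q ⊗[ℂ] Uq q,
        LinearMap.mul' ℂ (Uq q) (antipodeLin.rTensor (Uq q) (comulHom x * w)) =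
          algebraMap ℂ (Uq q) (counitHom x) *
            LinearMap.mul' ℂ (Uq q) (antipodeLin.rTensor (Uq q) w) := by
      intro w
      induction w using TensorProduct.induction_on with
      | zero => simp
      | tmul a b =>
        rw [antipode_left_mul, h1, ← Algebra.commutes, mul_assoc]; simp
      | add a b h1 h2 => rw [mul_add, map_add, map_add, h1, h2, map_add, map_add, mul_add]
    rw [map_mul, key, h2, map_mul, map_mul]

theorem antipode_right (x : Uq q) :
    LinearMap.mul' ℂ (Uq q) (antipodeLin.lTensor (Uq q) (comulHom x)) =
      algebraMap ℂ (Uq q) (counitHom x) := by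
  induction x using Uq.induction with
  | hc c =>
    have h := antipodeLin_algebraMap (q := q) 1
    rw [map_one] at h
    simp [Algebra.TensorProduct.algebraMap_apply, h]
  | hE => simp [comulHom, counitHom, E_mul_Ki]
  | hF => simp [comulHom, counitHom, Ki_mul_F, smul_smul, inv_mul_cancel₀ (q_ne (q := q)),
      -Complex.coe_smul]
  | hK => simp [comulHom, counitHom, K_mul_Ki]
  | hKi => simp [comulHom, counitHom, Ki_mul_K]
  | ha x y h1 h2 => simp only [map_add, h1, h2]
  | hm x y h1 h2 =>
    have key : ∀ w : Uq q ⊗[ℂ] Uq q,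
        LinearMap.mul' ℂ (Uq q) (antipodeLin.lTensor (Uq q) (w * comulHom y)) =
          LinearMap.mul' ℂ (Uq q) (antipodeLin.lTensor (Uq q) w) *
            algebraMap ℂ (Uq q) (counitHom y) := by
      intro w
      induction w using TensorProduct.induction_on with
      | zero => simp
      | tmul a b =>
        rw [antipode_right_mul, h2, mul_assoc, Algebra.commutes, ← mul_assoc]; simp
      | add a b h1 h2 => rw [add_mul, map_add, map_add, h1, h2, map_add, map_add, add_mul]
    rw [map_mul, key, h1, map_mul, map_mul]

instance : HopfAlgebra ℂ (Uq q) where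
  antipode := antipodeLin
  mul_antipode_rTensor_comul := LinearMap.ext antipode_left
  mul_antipode_lTensor_comul := LinearMap.ext antipode_right

theorem antipode_eq (x : Uq q) : HopfAlgebra.antipode ℂ x = antipodeLin x := rfl

/-- The inverse of the antipode is `f ↦ S(f*)*`. -/
theorem star_antipode_star_antipode (x : Uq q) :
    star (antipodeLin (star (antipodeLin x))) = x := by
  induction x using Uq.induction with
  | hc c => simp [Algebra.algebraMap_eq_smul_one, ← antipode_eq]
  | hE => simp [star_smul, smul_smul, q_ne (q := q), -Complex.coe_smul]
  | hF => simp [star_smul, smul_smul, q_ne (q := q), -Complex.coe_smul]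
  | hK => simp
  | hKi => simp
  | ha x y h1 h2 => simp only [map_add, star_add, h1, h2]
  | hm x y h1 h2 => simp only [antipodeLin_mul, star_mul, h1, h2]

end antipode

end Uq

/-! ### Equivariant `K₀` and twisted cyclic cohomology in degree `0`

In this section `U` is a Hopf `*`-algebra and `B` a left `U`-module `*`-algebra, the action being
given by an algebra map `act : U → End(B)`. -/

section General

variable {U B : Type} [Ring U] [HopfAlgebra ℂ U] [StarRing U] [StarModule ℂ U]
  [Ring B] [Algebra ℂ B] [StarRing B]

/-- The inverse of the antipode of a Hopf `*`-algebra, `S⁻¹(f) = S(f*)*`. -/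
def invAntipode : U →ₗ[ℂ] U where
  toFun f := star (HopfAlgebra.antipode ℂ (star f))
  map_add' f g := by simp
  map_smul' c f := by simp [star_smul]

/-- The convolution `f ↦ L(f₍₁₎) M(f₍₂₎)`. -/
def conv {A : Type} [Ring A] [Algebra ℂ A] (L M : U →ₗ[ℂ] A) : U →ₗ[ℂ] A :=
  LinearMap.mul' ℂ A ∘ₗ TensorProduct.map L M ∘ₗ Coalgebra.comul

/-- A complex matrix regarded as a matrix over `B`. -/
def scalarMat {m n : ℕ} (B : Type) [Ring B] [Algebra ℂ B] :
    Matrix (Fin m) (Fin n) ℂ →ₗ[ℂ] Matrix (Fin m) (Fin n) B :=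
  (Algebra.linearMap ℂ B).mapMatrix

/-- The linear map `f ↦ ρ(f)` to matrices underlying a representation `ρ` of the opposite
algebra of `U`. -/
def repLin {n : ℕ} (ρ : U →ₐ[ℂ] (Matrix (Fin n) (Fin n) ℂ)ᵐᵒᵖ) :
    U →ₗ[ℂ] Matrix (Fin n) (Fin n) ℂ :=
  (MulOpposite.opLinearEquiv ℂ).symm.toLinearMap ∘ₗ ρ.toLinearMap

/-- The entrywise action of `U` on a matrix `X`, as a function of the element of `U`. -/
def actMat {m n : ℕ} (act : U →ₐ[ℂ] Module.End ℂ B) (X : Matrix (Fin m) (Fin n) B) :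
    U →ₗ[ℂ] Matrix (Fin m) (Fin n) B where
  toFun f := X.map (act f)
  map_add' f g := by ext; simp
  map_smul' c f := by ext; simp

/-- The adjoint action
`ad(f)(X) = ρ(S⁻¹(f₍₁₎)) (S⁻²(f₍₂₎) ▷ X) ρ(f₍₃₎)` on square matrices `X` over `B`. -/
def adR {n : ℕ} (act : U →ₐ[ℂ] Module.End ℂ B) (ρ : U →ₐ[ℂ] (Matrix (Fin n) (Fin n) ℂ)ᵐᵒᵖ)
    (X : Matrix (Fin n) (Fin n) B) : U →ₗ[ℂ] Matrix (Fin n) (Fin n) B :=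
  conv (scalarMat B ∘ₗ repLin ρ ∘ₗ invAntipode)
    (conv (actMat act X ∘ₗ invAntipode ∘ₗ invAntipode) (scalarMat B ∘ₗ repLin ρ))

/-- The entrywise action `b ↦ S⁻¹(f) ▷ b` on columns. -/
def colAct (n : ℕ) (act : U →ₐ[ℂ] Module.End ℂ B) : U →ₗ[ℂ] Module.End ℂ (Fin n → B) where
  toFun f := LinearMap.pi fun i => act (invAntipode f) ∘ₗ LinearMap.proj i
  map_add' f g := by ext; simp
  map_smul' c f := by ext; simp

/-- Multiplication of columns by the scalar matrix `ρ(f)`. -/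
def colRep {n : ℕ} (B : Type) [Ring B] [Algebra ℂ B]
    (ρ : U →ₐ[ℂ] (Matrix (Fin n) (Fin n) ℂ)ᵐᵒᵖ) : U →ₗ[ℂ] Module.End ℂ (Fin n → B) where
  toFun f := LinearMap.pi fun i => ∑ j, repLin ρ f i j • LinearMap.proj j
  map_add' f g := by ext; simp [Finset.sum_add_distrib, add_smul]
  map_smul' c f := by ext; simp [Finset.smul_sum, smul_smul]

/-- The representation `π(f)(v ⊗ b) = ρ(f₍₂₎) v ⊗ S⁻¹(f₍₁₎) ▷ b` of the opposite algebra of `U` on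
`ℂⁿ ⊗ B = Bⁿ`. -/
def colPi {n : ℕ} (act : U →ₐ[ℂ] Module.End ℂ B) (ρ : U →ₐ[ℂ] (Matrix (Fin n) (Fin n) ℂ)ᵐᵒᵖ) :
    U →ₗ[ℂ] Module.End ℂ (Fin n → B) :=
  conv (colAct n act) (colRep B ρ)

/-- `X† = σ(X)*`. -/
def dagger {m n : ℕ} (σ : B → B) (X : Matrix (Fin m) (Fin n) B) : Matrix (Fin n) (Fin m) B :=
  (X.map σ).conjTranspose

/-- `P` is an invariant projection with respect to the `*`-representation `ρ` of the opposite
algebra of `U`. -/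
structure IsInvProj (act : U →ₐ[ℂ] Module.End ℂ B) (σ : B → B) {n : ℕ}
    (ρ : U →ₐ[ℂ] (Matrix (Fin n) (Fin n) ℂ)ᵐᵒᵖ) (P : Matrix (Fin n) (Fin n) B) : Prop where
  rep_star : ∀ f, repLin ρ (star f) = (repLin ρ f).conjTranspose
  idem : P * P = P
  selfAdjoint : dagger σ P = P
  invariant : ∀ f, adR act ρ P f = Coalgebra.counit (R := ℂ) f • P

/-- Invariant projections of arbitrary size, together with the `*`-representation with respect to
which they are invariant. -/
structure InvProj (act : U →ₐ[ℂ] Module.End ℂ B) (σ : B → B) where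
  n : ℕ
  rep : U →ₐ[ℂ] (Matrix (Fin n) (Fin n) ℂ)ᵐᵒᵖ
  proj : Matrix (Fin n) (Fin n) B
  isInvProj : IsInvProj act σ rep proj

variable (act : U →ₐ[ℂ] Module.End ℂ B) (σ : B → B)

/-- Equivariant Murray-von Neumann equivalence of invariant projections. -/
def InvProj.Equivalent (P Q : InvProj act σ) : Prop :=
  ∃ V : Matrix (Fin Q.n) (Fin P.n) B, dagger σ V * V = P.proj ∧ V * dagger σ V = Q.proj ∧
    ∀ (f : U) (b : Fin P.n → B),
      colPi act Q.rep f (V.mulVec b) = V.mulVec (colPi act P.rep f b)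

/-- `R` is the orthogonal sum of `P` and `Q`, with block diagonal projection and
representation. -/
def InvProj.IsSum (P Q R : InvProj act σ) : Prop :=
  ∃ h : P.n + Q.n = R.n,
    R.proj = (Matrix.fromBlocks P.proj 0 0 Q.proj).reindex
      (finSumFinEquiv.trans (finCongr h)) (finSumFinEquiv.trans (finCongr h)) ∧
    ∀ f, repLin R.rep f = (Matrix.fromBlocks (repLin P.rep f) 0 0 (repLin Q.rep f)).reindex
      (finSumFinEquiv.trans (finCongr h)) (finSumFinEquiv.trans (finCongr h))

/-- The relations of the equivariant `K₀`-group: equivalent projections have the same class, the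
class of an orthogonal sum is the sum of the classes, and zero matrices have class `0`. -/
inductive K0Rel : FreeAbelianGroup (InvProj act σ) → Prop
  | equiv (P Q : InvProj act σ) (h : P.Equivalent act σ Q) :
      K0Rel (FreeAbelianGroup.of P - FreeAbelianGroup.of Q)
  | sum (P Q R : InvProj act σ) (h : InvProj.IsSum act σ P Q R) :
      K0Rel (FreeAbelianGroup.of R - (FreeAbelianGroup.of P + FreeAbelianGroup.of Q))
  | zero (P : InvProj act σ) (h : P.proj = 0) : K0Rel (FreeAbelianGroup.of P)

/-- The equivariant `K₀`-group: the Grothendieck group of the semigroup of equivalence classes of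
invariant projections. -/
abbrev K0 : Type :=
  FreeAbelianGroup (InvProj act σ) ⧸ AddSubgroup.closure {x | K0Rel act σ x}

/-- The class of an invariant projection in the equivariant `K₀`-group. -/
def K0.of (P : InvProj act σ) : K0 act σ := QuotientAddGroup.mk (FreeAbelianGroup.of P)

/-- Twisted cyclic cohomology in degree `0`: the twisted cyclic `0`-cochains are the linear
functionals `φ` with `φ(λ(a)) = φ(a)`, and the coboundary of `φ` is
`(a₀, a₁) ↦ φ(a₀ a₁) - φ(λ(a₁) a₀)`. There are no coboundaries in degree `0`. -/
def HC0 (l : B → B) : Submodule ℂ (Module.Dual ℂ B) where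
  carrier := {φ | (∀ a, φ (l a) = φ a) ∧ ∀ a₀ a₁, φ (a₀ * a₁) - φ (l a₁ * a₀) = 0}
  zero_mem' := by simp
  add_mem' := by
    rintro φ ψ ⟨h1, h2⟩ ⟨h3, h4⟩
    refine ⟨fun a => by simp [h1, h3], fun a b => ?_⟩
    have := congrArg₂ (· + ·) (h2 a b) (h4 a b)
    simp only [LinearMap.add_apply, add_zero] at this ⊢
    linear_combination this
  smul_mem' := by
    rintro c φ ⟨h1, h2⟩
    refine ⟨fun a => by simp [h1], fun a b => ?_⟩
    simp [← mul_sub, h2 a b]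

/-- The quantum trace `Tr(X) = ∑ ρ(k)ⱼᵢ Xᵢⱼ`, which is the Chern character in degree `0`. -/
def qTrace {n : ℕ} (k : U) (ρ : U →ₐ[ℂ] (Matrix (Fin n) (Fin n) ℂ)ᵐᵒᵖ)
    (X : Matrix (Fin n) (Fin n) B) : B :=
  ∑ i, ∑ j, repLin ρ k j i • X i j

theorem conv_groupLike {A : Type} [Ring A] [Algebra ℂ A] (L M : U →ₗ[ℂ] A) {k : U}
    (hk : IsGroupLikeElem ℂ k) : conv L M k = L k * M k := by
  simp [conv, hk.comul_eq_tmul_self]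

variable {act σ}

/-- The quantum trace is additive on orthogonal sums. -/
theorem qTrace_sum (k : U) {P Q R : InvProj act σ} (h : InvProj.IsSum act σ P Q R) :
    qTrace k R.rep R.proj = qTrace k P.rep P.proj + qTrace k Q.rep Q.proj := by
  obtain ⟨h, h1, h2⟩ := h
  let e := finSumFinEquiv.trans (finCongr h)
  unfold qTrace
  rw [h1, h2, ← e.sum_comp]
  simp_rw [← e.sum_comp (fun j => _ • _)]
  simp [e, Fintype.sum_sum_type, Matrix.reindex_apply]

/-- Twisted traces agree on the quantum traces of equivalent invariant projections. -/
theorem qTrace_equivalent {k : U} (hk : IsGroupLikeElem ℂ k)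
    (hk1 : act (invAntipode k) 1 = 1) (hk2 : k * invAntipode k = 1)
    {φ : Module.Dual ℂ B} (hφ : φ ∈ HC0 (act k)) {P Q : InvProj act σ}
    (h : P.Equivalent act σ Q) :
    φ (qTrace k P.rep P.proj) = φ (qTrace k Q.rep Q.proj) := by
  obtain ⟨V, h1, h2, h3⟩ := h
  have key : ∀ a i, ∑ j, repLin P.rep k j i • act k (V a j) =
      ∑ c, repLin Q.rep k a c • V c i := by
    intro a i
    have h4 := congrArg (act k) (congrFun (h3 k (Pi.single i 1)) a)
    have hkk : ∀ x, act k (act (invAntipode k) x) = x := by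
      intro x; rw [← Module.End.mul_apply, ← map_mul, hk2, map_one, Module.End.one_apply]
    have hs : ∀ j, act (invAntipode k) ((Pi.single i (1 : B) : Fin P.n → B) j) =
        (Pi.single i 1 : Fin P.n → B) j := by
      intro j
      by_cases hj : j = i
      · subst hj; simp [hk1]
      · simp [hj]
    simp only [colPi, conv_groupLike _ _ hk, Module.End.mul_apply, colAct, colRep,
      LinearMap.coe_mk, AddHom.coe_mk, LinearMap.pi_apply, LinearMap.comp_apply,
      LinearMap.proj_apply, hkk, Matrix.mulVec_single_one, Matrix.col_apply,
      LinearMap.sum_apply, LinearMap.smul_apply] at h4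
    rw [h4]
    simp only [Matrix.mulVec, dotProduct, map_sum, LinearMap.pi_apply, LinearMap.comp_apply,
      LinearMap.proj_apply, LinearMap.sum_apply, LinearMap.smul_apply, map_smul, hs]
    refine Finset.sum_congr rfl fun j _ => ?_
    rw [Finset.sum_eq_single i (fun c _ hc => by simp [hc]) (by simp)]
    simp
  have hφ' : ∀ x y, φ (x * y) = φ (act k y * x) := fun x y => sub_eq_zero.1 (hφ.2 x y)
  calc φ (qTrace k P.rep P.proj)
      = ∑ i, ∑ a, φ ((∑ j, repLin P.rep k j i • act k (V a j)) * dagger σ V i a) := by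
        simp only [qTrace, ← h1, Matrix.mul_apply, map_sum, map_smul, Finset.smul_sum,
          Finset.sum_mul, smul_mul_assoc]
        refine Finset.sum_congr rfl fun i _ => ?_
        rw [Finset.sum_comm]
        exact Finset.sum_congr rfl fun a _ => Finset.sum_congr rfl fun j _ => by rw [hφ']
    _ = ∑ i, ∑ a, φ ((∑ c, repLin Q.rep k a c • V c i) * dagger σ V i a) := by simp only [key]
    _ = φ (qTrace k Q.rep Q.proj) := by
        simp only [qTrace, ← h2, Matrix.mul_apply, map_sum, map_smul, Finset.smul_sum,
          Finset.sum_mul, smul_mul_assoc]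
        rw [Finset.sum_congr rfl fun i _ => Finset.sum_comm, Finset.sum_comm]
        exact Finset.sum_congr rfl fun c _ => Finset.sum_comm

/-- The pairing of a twisted cyclic `0`-cocycle `φ` with equivariant `K₀`, where the automorphism
is given by the group-like element `k`: `⟨[φ], [P]⟩ = φ(Tr(P))`. -/
def pairing (k : U) (hk : IsGroupLikeElem ℂ k)
    (hk1 : act (invAntipode k) 1 = 1) (hk2 : k * invAntipode k = 1) (φ : HC0 (act k)) :
    K0 act σ →+ ℂ :=
  QuotientAddGroup.lift _
    (FreeAbelianGroup.lift fun P : InvProj act σ => φ.1 (qTrace k P.rep P.proj)) (by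
      rw [AddSubgroup.closure_le]
      intro x hx
      cases hx with
      | equiv P Q h =>
        simp [qTrace_equivalent hk hk1 hk2 φ.2 h]
      | sum P Q R h => simp [qTrace_sum k h]
      | zero P h => simp [qTrace, h])

theorem pairing_of (k : U) (hk : IsGroupLikeElem ℂ k)
    (hk1 : act (invAntipode k) 1 = 1) (hk2 : k * invAntipode k = 1) (φ : HC0 (act k))
    (P : InvProj act σ) :
    pairing k hk hk1 hk2 φ (K0.of act σ P) = φ.1 (qTrace k P.rep P.proj) := by
  simp [pairing, K0.of]

end General

/-! ### The coordinate `*`-algebra of quantum `SU(2)` -/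

/-- Generators of `O(SU_q(2))`, the entries of the fundamental matrix `(a b; c d)`. -/
inductive OGen | a | b | c | d

/-- Defining relations of `O(SU_q(2))`. -/
inductive ORel (q : ℝ) : FreeAlgebra ℂ OGen → FreeAlgebra ℂ OGen → Prop
  | ab : ORel q (FreeAlgebra.ι ℂ .a * FreeAlgebra.ι ℂ .b)
      ((q : ℂ) • (FreeAlgebra.ι ℂ .b * FreeAlgebra.ι ℂ .a))
  | ac : ORel q (FreeAlgebra.ι ℂ .a * FreeAlgebra.ι ℂ .c)
      ((q : ℂ) • (FreeAlgebra.ι ℂ .c * FreeAlgebra.ι ℂ .a))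
  | bd : ORel q (FreeAlgebra.ι ℂ .b * FreeAlgebra.ι ℂ .d)
      ((q : ℂ) • (FreeAlgebra.ι ℂ .d * FreeAlgebra.ι ℂ .b))
  | cd : ORel q (FreeAlgebra.ι ℂ .c * FreeAlgebra.ι ℂ .d)
      ((q : ℂ) • (FreeAlgebra.ι ℂ .d * FreeAlgebra.ι ℂ .c))
  | bc : ORel q (FreeAlgebra.ι ℂ .b * FreeAlgebra.ι ℂ .c)
      (FreeAlgebra.ι ℂ .c * FreeAlgebra.ι ℂ .b)
  | ad : ORel q (FreeAlgebra.ι ℂ .a * FreeAlgebra.ι ℂ .d)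
      (1 + (q : ℂ) • (FreeAlgebra.ι ℂ .b * FreeAlgebra.ι ℂ .c))
  | da : ORel q (FreeAlgebra.ι ℂ .d * FreeAlgebra.ι ℂ .a)
      (1 + (q : ℂ)⁻¹ • (FreeAlgebra.ι ℂ .b * FreeAlgebra.ι ℂ .c))

/-- The coordinate algebra `O(SU_q(2))` of quantum `SU(2)`. -/
def OSU (q : ℝ) : Type := RingQuot (ORel q)

instance (q : ℝ) : Ring (OSU q) := inferInstanceAs (Ring (RingQuot (ORel q)))
instance (q : ℝ) : Algebra ℂ (OSU q) := inferInstanceAs (Algebra ℂ (RingQuot (ORel q)))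

/-- The complex number `q^{1/2}`. -/
def sqrtC (q : ℝ) : ℂ := (Real.sqrt q : ℝ)

theorem conj_sqrtC (q : ℝ) : conj (sqrtC q) = sqrtC q := Complex.conj_ofReal _

section
variable {q : ℝ} [hq : Fact (0 < q)]

theorem sqrtC_sq : sqrtC q * sqrtC q = (q : ℂ) := by
  unfold sqrtC
  exact_mod_cast Real.mul_self_sqrt hq.out.le

theorem sqrtC_ne : sqrtC q ≠ 0 := by
  unfold sqrtC
  exact_mod_cast (Real.sqrt_pos.2 hq.out).ne'
end

namespace OSU

variable {q : ℝ}

/-- The generator `a`. -/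
def a : OSU q := gen (ORel q) .a
/-- The generator `b`. -/
def b : OSU q := gen (ORel q) .b
/-- The generator `c`. -/
def c : OSU q := gen (ORel q) .c
/-- The generator `d`. -/
def d : OSU q := gen (ORel q) .d

theorem a_mul_b : (a * b : OSU q) = (q : ℂ) • (b * a) := by
  have := RingQuot.mkAlgHom_rel ℂ (ORel.ab (q := q))
  rw [map_mul, map_smul, map_mul] at this; exact this

theorem a_mul_c : (a * c : OSU q) = (q : ℂ) • (c * a) := by
  have := RingQuot.mkAlgHom_rel ℂ (ORel.ac (q := q))
  rw [map_mul, map_smul, map_mul] at this; exact this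

theorem b_mul_d : (b * d : OSU q) = (q : ℂ) • (d * b) := by
  have := RingQuot.mkAlgHom_rel ℂ (ORel.bd (q := q))
  rw [map_mul, map_smul, map_mul] at this; exact this

theorem c_mul_d : (c * d : OSU q) = (q : ℂ) • (d * c) := by
  have := RingQuot.mkAlgHom_rel ℂ (ORel.cd (q := q))
  rw [map_mul, map_smul, map_mul] at this; exact this

theorem b_mul_c : (b * c : OSU q) = c * b := by
  have := RingQuot.mkAlgHom_rel ℂ (ORel.bc (q := q))
  rw [map_mul, map_mul] at this; exact this

theorem a_mul_d : (a * d : OSU q) = 1 + (q : ℂ) • (b * c) := by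
  have := RingQuot.mkAlgHom_rel ℂ (ORel.ad (q := q))
  rw [map_add, map_one, map_mul, map_smul, map_mul] at this; exact this

theorem d_mul_a : (d * a : OSU q) = 1 + (q : ℂ)⁻¹ • (b * c) := by
  have := RingQuot.mkAlgHom_rel ℂ (ORel.da (q := q))
  rw [map_add, map_one, map_mul, map_smul, map_mul] at this; exact this

@[elab_as_elim]
theorem induction {p : OSU q → Prop} (hc : ∀ z : ℂ, p (algebraMap ℂ _ z))
    (h1 : p a) (h2 : p b) (h3 : p c) (h4 : p d) (ha : ∀ x y, p x → p y → p (x + y))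
    (hm : ∀ x y, p x → p y → p (x * y)) (x : OSU q) : p x :=
  pres_induction hc (fun x => by cases x <;> assumption) ha hm x

/-- Images of the generators under a map out of `O(SU_q(2))`. -/
def genMap {A : Type} (a' b' c' d' : A) : OGen → A
  | .a => a'
  | .b => b'
  | .c => c'
  | .d => d'

section lift
variable {A : Type} [Ring A] [Algebra ℂ A] (a' b' c' d' : A)
  (h1 : a' * b' = (q : ℂ) • (b' * a')) (h2 : a' * c' = (q : ℂ) • (c' * a'))
  (h3 : b' * d' = (q : ℂ) • (d' * b')) (h4 : c' * d' = (q : ℂ) • (d' * c'))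
  (h5 : b' * c' = c' * b') (h6 : a' * d' = 1 + (q : ℂ) • (b' * c'))
  (h7 : d' * a' = 1 + (q : ℂ)⁻¹ • (b' * c'))

/-- The algebra map out of `O(SU_q(2))` given by elements that satisfy the defining relations. -/
def lift : OSU q →ₐ[ℂ] A :=
  presLift (genMap a' b' c' d') (by
    intro x y h
    cases h <;> simp only [map_mul, map_smul, map_add, map_one, FreeAlgebra.lift_ι_apply, genMap]
    exacts [h1, h2, h3, h4, h5, h6, h7])

@[simp] theorem lift_a : lift a' b' c' d' h1 h2 h3 h4 h5 h6 h7 a = a' := presLift_gen _ _ _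
@[simp] theorem lift_b : lift a' b' c' d' h1 h2 h3 h4 h5 h6 h7 b = b' := presLift_gen _ _ _
@[simp] theorem lift_c : lift a' b' c' d' h1 h2 h3 h4 h5 h6 h7 c = c' := presLift_gen _ _ _
@[simp] theorem lift_d : lift a' b' c' d' h1 h2 h3 h4 h5 h6 h7 d = d' := presLift_gen _ _ _
end lift

/-- The counit of `O(SU_q(2))`. -/
def counit : OSU q →ₐ[ℂ] ℂ :=
  lift 1 0 0 1 (by simp) (by simp) (by simp) (by simp) (by simp) (by simp) (by simp)

variable [hq : Fact (0 < q)]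

/-- The involution as an algebra map to the conjugate opposite algebra. -/
def starHom : OSU q →ₐ[ℂ] ConjOp (OSU q) :=
  lift (ConjOp.mk d) (ConjOp.mk (-(q : ℂ) • c)) (ConjOp.mk (-(q : ℂ)⁻¹ • b)) (ConjOp.mk a)
    (by
      apply ConjOp.ext
      simp only [ConjOp.out_mul, ConjOp.out_smul, ConjOp.out_mk, smul_mul_assoc, mul_smul_comm,
        c_mul_d, Complex.conj_ofReal, smul_smul, neg_mul, mul_neg, mul_comm])
    (by
      apply ConjOp.ext
      simp only [ConjOp.out_mul, ConjOp.out_smul, ConjOp.out_mk, smul_mul_assoc, mul_smul_comm,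
        b_mul_d, Complex.conj_ofReal, smul_smul, neg_mul, mul_neg, mul_comm])
    (by
      apply ConjOp.ext
      simp only [ConjOp.out_mul, ConjOp.out_smul, ConjOp.out_mk, smul_mul_assoc, mul_smul_comm,
        a_mul_c, Complex.conj_ofReal, smul_smul, neg_mul, mul_neg, mul_comm])
    (by
      apply ConjOp.ext
      simp only [ConjOp.out_mul, ConjOp.out_smul, ConjOp.out_mk, smul_mul_assoc, mul_smul_comm,
        a_mul_b, Complex.conj_ofReal, smul_smul, neg_mul, mul_neg, mul_comm])
    (by
      apply ConjOp.ext
      simp only [ConjOp.out_mul, ConjOp.out_mk, smul_mul_smul_comm, b_mul_c, mul_comm])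
    (by
      apply ConjOp.ext
      have h : -(q : ℂ)⁻¹ * -(q : ℂ) = 1 := by
        rw [neg_mul_neg, inv_mul_cancel₀ Uq.q_ne]
      simp only [ConjOp.out_mul, ConjOp.out_smul, ConjOp.out_mk, ConjOp.out_add, ConjOp.out_one,
        smul_mul_smul_comm, h, one_smul, Complex.conj_ofReal, a_mul_d])
    (by
      apply ConjOp.ext
      have h : -(q : ℂ)⁻¹ * -(q : ℂ) = 1 := by
        rw [neg_mul_neg, inv_mul_cancel₀ Uq.q_ne]
      simp only [ConjOp.out_mul, ConjOp.out_smul, ConjOp.out_mk, ConjOp.out_add, ConjOp.out_one,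
        smul_mul_smul_comm, h, one_smul, map_inv₀, Complex.conj_ofReal, d_mul_a])

theorem starHom_starHom (x : OSU q) : (starHom (starHom x).out).out = x := by
  induction x using OSU.induction with
  | hc z => rw [AlgHom.commutes, ConjOp.out_algebraMap, AlgHom.commutes, ConjOp.out_algebraMap,
      Complex.conj_conj]
  | h1 => simp [starHom]
  | h2 => simp [starHom, ConjOp.out_neg, ConjOp.out_smul, smul_smul, Uq.q_ne (q := q), -Complex.coe_smul]
  | h3 => simp [starHom, ConjOp.out_neg, ConjOp.out_smul, smul_smul, Uq.q_ne (q := q), -Complex.coe_smul]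
  | h4 => simp [starHom]
  | ha x y h1 h2 => rw [map_add, ConjOp.out_add, map_add, ConjOp.out_add, h1, h2]
  | hm x y h1 h2 => rw [map_mul, ConjOp.out_mul, map_mul, ConjOp.out_mul, h1, h2]

/-- The involution of `O(SU_q(2))`: `a* = d`, `b* = -q c`, `c* = -q⁻¹ b`, `d* = a`. -/
instance : StarRing (OSU q) where
  star x := (starHom x).out
  star_involutive x := starHom_starHom x
  star_mul x y := by rw [map_mul, ConjOp.out_mul]
  star_add x y := by rw [map_add, ConjOp.out_add]

theorem star_def (x : OSU q) : star x = (starHom x).out := rfl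

instance : StarModule ℂ (OSU q) where
  star_smul z x := by rw [star_def, map_smul, ConjOp.out_smul]; rfl

@[simp] theorem star_a : star (a : OSU q) = d := by simp [star_def, starHom]
@[simp] theorem star_b : star (b : OSU q) = -(q : ℂ) • c := by simp [star_def, starHom]
@[simp] theorem star_c : star (c : OSU q) = -(q : ℂ)⁻¹ • b := by simp [star_def, starHom]
@[simp] theorem star_d : star (d : OSU q) = a := by simp [star_def, starHom]

/-! #### The left action of `U_q(su₂)` and the right action of `K²` -/

/-- For nonzero `u`, `v`, the algebra automorphism `a ↦ u v a`, `b ↦ u v⁻¹ b`, `c ↦ u⁻¹ v c`,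
`d ↦ u⁻¹ v⁻¹ d`. -/
def diagHom (u v : ℂ) (hu : u ≠ 0) (hv : v ≠ 0) : OSU q →ₐ[ℂ] OSU q :=
  lift ((u * v) • a) ((u * v⁻¹) • b) ((u⁻¹ * v) • c) ((u⁻¹ * v⁻¹) • d)
    (by rw [smul_mul_smul_comm, smul_mul_smul_comm, a_mul_b, smul_comm (q : ℂ), mul_comm (u * v)])
    (by rw [smul_mul_smul_comm, smul_mul_smul_comm, a_mul_c, smul_comm (q : ℂ), mul_comm (u * v)])
    (by rw [smul_mul_smul_comm, smul_mul_smul_comm, b_mul_d, smul_comm (q : ℂ), mul_comm (u * _)])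
    (by rw [smul_mul_smul_comm, smul_mul_smul_comm, c_mul_d, smul_comm (q : ℂ), mul_comm (_ * v)])
    (by rw [smul_mul_smul_comm, smul_mul_smul_comm, b_mul_c, mul_comm (_ * v)])
    (by
      have h1 : u * v * (u⁻¹ * v⁻¹) = 1 := by field_simp
      have h2 : u * v⁻¹ * (u⁻¹ * v) = 1 := by field_simp
      rw [smul_mul_smul_comm, smul_mul_smul_comm, h1, h2, one_smul, one_smul, a_mul_d])
    (by
      have h1 : u⁻¹ * v⁻¹ * (u * v) = 1 := by field_simp
      have h2 : u * v⁻¹ * (u⁻¹ * v) = 1 := by field_simp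
      rw [smul_mul_smul_comm, smul_mul_smul_comm, h1, h2, one_smul, one_smul, d_mul_a])

/-- `K ▷ ·`, an algebra automorphism. -/
def actK : OSU q →ₐ[ℂ] OSU q := diagHom 1 (sqrtC q)⁻¹ one_ne_zero (inv_ne_zero sqrtC_ne)

/-- `K⁻¹ ▷ ·`, an algebra automorphism. -/
def actKi : OSU q →ₐ[ℂ] OSU q := diagHom 1 (sqrtC q) one_ne_zero sqrtC_ne

/-- The right action `∂_{K²}` of `K²`, an algebra automorphism. -/
def dK2 : OSU q →ₐ[ℂ] OSU q := diagHom (q : ℂ) 1 Uq.q_ne one_ne_zero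

/-- The inverse of `∂_{K²}`. -/
def dK2i : OSU q →ₐ[ℂ] OSU q := diagHom (q : ℂ)⁻¹ 1 (inv_ne_zero Uq.q_ne) one_ne_zero

@[simp] theorem actK_a : actK (a : OSU q) = (sqrtC q)⁻¹ • a := by simp [actK, diagHom]
@[simp] theorem actK_b : actK (b : OSU q) = sqrtC q • b := by simp [actK, diagHom]
@[simp] theorem actK_c : actK (c : OSU q) = (sqrtC q)⁻¹ • c := by simp [actK, diagHom]
@[simp] theorem actK_d : actK (d : OSU q) = sqrtC q • d := by simp [actK, diagHom]
@[simp] theorem actKi_a : actKi (a : OSU q) = sqrtC q • a := by simp [actKi, diagHom]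
@[simp] theorem actKi_b : actKi (b : OSU q) = (sqrtC q)⁻¹ • b := by simp [actKi, diagHom]
@[simp] theorem actKi_c : actKi (c : OSU q) = sqrtC q • c := by simp [actKi, diagHom]
@[simp] theorem actKi_d : actKi (d : OSU q) = (sqrtC q)⁻¹ • d := by simp [actKi, diagHom]
@[simp] theorem dK2_a : dK2 (a : OSU q) = (q : ℂ) • a := by simp [dK2, diagHom]
@[simp] theorem dK2_b : dK2 (b : OSU q) = (q : ℂ) • b := by simp [dK2, diagHom]
@[simp] theorem dK2_c : dK2 (c : OSU q) = (q : ℂ)⁻¹ • c := by simp [dK2, diagHom]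
@[simp] theorem dK2_d : dK2 (d : OSU q) = (q : ℂ)⁻¹ • d := by simp [dK2, diagHom]
@[simp] theorem dK2i_a : dK2i (a : OSU q) = (q : ℂ)⁻¹ • a := by simp [dK2i, diagHom]
@[simp] theorem dK2i_b : dK2i (b : OSU q) = (q : ℂ)⁻¹ • b := by simp [dK2i, diagHom]
@[simp] theorem dK2i_c : dK2i (c : OSU q) = (q : ℂ) • c := by simp [dK2i, diagHom]
@[simp] theorem dK2i_d : dK2i (d : OSU q) = (q : ℂ) • d := by simp [dK2i, diagHom]

/-- Upper triangular `2 × 2` matrices over `O(SU_q(2))`. -/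
def tri (x y z : OSU q) : Matrix (Fin 2) (Fin 2) (OSU q) := !![x, y; 0, z]

theorem tri_mul (x y z x' y' z' : OSU q) :
    tri x y z * tri x' y' z' = tri (x * x') (x * y' + y * z') (z * z') := by
  simp [tri]

theorem tri_smul (r : ℂ) (x y z : OSU q) : r • tri x y z = tri (r • x) (r • y) (r • z) := by
  simp [tri]

theorem tri_add (x y z x' y' z' : OSU q) :
    tri x y z + tri x' y' z' = tri (x + x') (y + y') (z + z') := by
  simp [tri]

theorem tri_one : (1 : Matrix (Fin 2) (Fin 2) (OSU q)) = tri 1 0 1 := by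
  ext i j; fin_cases i <;> fin_cases j <;> simp [tri]

theorem tri_ext {x y z x' y' z' : OSU q} (h1 : x = x') (h2 : y = y') (h3 : z = z') :
    tri x y z = tri x' y' z' := by rw [h1, h2, h3]

/-- The algebra map `x ↦ (K⁻¹ ▷ x, E ▷ x; 0, K ▷ x)`, where `E ▷ a = b`, `E ▷ c = d`,
`E ▷ b = E ▷ d = 0`. That it is multiplicative expresses
`E ▷ (x y) = (E ▷ x) (K ▷ y) + (K⁻¹ ▷ x) (E ▷ y)`. -/
def matE : OSU q →ₐ[ℂ] Matrix (Fin 2) (Fin 2) (OSU q) :=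
  lift (tri (sqrtC q • a) b ((sqrtC q)⁻¹ • a)) (tri ((sqrtC q)⁻¹ • b) 0 (sqrtC q • b))
    (tri (sqrtC q • c) d ((sqrtC q)⁻¹ • c)) (tri ((sqrtC q)⁻¹ • d) 0 (sqrtC q • d))
    (by
      have hs := sqrtC_ne (q := q)
      simp only [tri_mul, tri_smul, tri_add, tri_one]
      apply tri_ext <;>
      simp only [smul_mul_assoc, mul_smul_comm, a_mul_b, a_mul_c, b_mul_d, c_mul_d, b_mul_c,
        a_mul_d, d_mul_a, ← sqrtC_sq (q := q), mul_zero, zero_mul, add_zero, zero_add] <;>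
      match_scalars <;> field_simp) (by
      have hs := sqrtC_ne (q := q)
      simp only [tri_mul, tri_smul, tri_add, tri_one]
      apply tri_ext <;>
      simp only [smul_mul_assoc, mul_smul_comm, a_mul_b, a_mul_c, b_mul_d, c_mul_d, b_mul_c,
        a_mul_d, d_mul_a, ← sqrtC_sq (q := q), mul_zero, zero_mul, add_zero, zero_add] <;>
      match_scalars <;> field_simp) (by
      have hs := sqrtC_ne (q := q)
      simp only [tri_mul, tri_smul, tri_add, tri_one]
      apply tri_ext <;>
      simp only [smul_mul_assoc, mul_smul_comm, a_mul_b, a_mul_c, b_mul_d, c_mul_d, b_mul_c,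
        a_mul_d, d_mul_a, ← sqrtC_sq (q := q), mul_zero, zero_mul, add_zero, zero_add] <;>
      match_scalars <;> field_simp) (by
      have hs := sqrtC_ne (q := q)
      simp only [tri_mul, tri_smul, tri_add, tri_one]
      apply tri_ext <;>
      simp only [smul_mul_assoc, mul_smul_comm, a_mul_b, a_mul_c, b_mul_d, c_mul_d, b_mul_c,
        a_mul_d, d_mul_a, ← sqrtC_sq (q := q), mul_zero, zero_mul, add_zero, zero_add] <;>
      match_scalars <;> field_simp) (by
      have hs := sqrtC_ne (q := q)
      simp only [tri_mul, tri_smul, tri_add, tri_one]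
      apply tri_ext <;>
      simp only [smul_mul_assoc, mul_smul_comm, a_mul_b, a_mul_c, b_mul_d, c_mul_d, b_mul_c,
        a_mul_d, d_mul_a, ← sqrtC_sq (q := q), mul_zero, zero_mul, add_zero, zero_add] <;>
      match_scalars <;> field_simp) (by
      have hs := sqrtC_ne (q := q)
      simp only [tri_mul, tri_smul, tri_add, tri_one]
      apply tri_ext <;>
      simp only [smul_mul_assoc, mul_smul_comm, a_mul_b, a_mul_c, b_mul_d, c_mul_d, b_mul_c,
        a_mul_d, d_mul_a, ← sqrtC_sq (q := q), mul_zero, zero_mul, add_zero, zero_add] <;>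
      match_scalars <;> field_simp) (by
      have hs := sqrtC_ne (q := q)
      simp only [tri_mul, tri_smul, tri_add, tri_one]
      apply tri_ext <;>
      simp only [smul_mul_assoc, mul_smul_comm, a_mul_b, a_mul_c, b_mul_d, c_mul_d, b_mul_c,
        a_mul_d, d_mul_a, ← sqrtC_sq (q := q), mul_zero, zero_mul, add_zero, zero_add] <;>
      match_scalars <;> field_simp)

/-- The algebra map `x ↦ (K⁻¹ ▷ x, F ▷ x; 0, K ▷ x)`, where `F ▷ b = a`, `F ▷ d = c`,
`F ▷ a = F ▷ c = 0`. -/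
def matF : OSU q →ₐ[ℂ] Matrix (Fin 2) (Fin 2) (OSU q) :=
  lift (tri (sqrtC q • a) 0 ((sqrtC q)⁻¹ • a)) (tri ((sqrtC q)⁻¹ • b) a (sqrtC q • b))
    (tri (sqrtC q • c) 0 ((sqrtC q)⁻¹ • c)) (tri ((sqrtC q)⁻¹ • d) c (sqrtC q • d))
    (by
      have hs := sqrtC_ne (q := q)
      simp only [tri_mul, tri_smul, tri_add, tri_one]
      apply tri_ext <;>
      simp only [smul_mul_assoc, mul_smul_comm, a_mul_b, a_mul_c, b_mul_d, c_mul_d, b_mul_c,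
        a_mul_d, d_mul_a, ← sqrtC_sq (q := q), mul_zero, zero_mul, add_zero, zero_add] <;>
      match_scalars <;> field_simp) (by
      have hs := sqrtC_ne (q := q)
      simp only [tri_mul, tri_smul, tri_add, tri_one]
      apply tri_ext <;>
      simp only [smul_mul_assoc, mul_smul_comm, a_mul_b, a_mul_c, b_mul_d, c_mul_d, b_mul_c,
        a_mul_d, d_mul_a, ← sqrtC_sq (q := q), mul_zero, zero_mul, add_zero, zero_add] <;>
      match_scalars <;> field_simp) (by
      have hs := sqrtC_ne (q := q)
      simp only [tri_mul, tri_smul, tri_add, tri_one]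
      apply tri_ext <;>
      simp only [smul_mul_assoc, mul_smul_comm, a_mul_b, a_mul_c, b_mul_d, c_mul_d, b_mul_c,
        a_mul_d, d_mul_a, ← sqrtC_sq (q := q), mul_zero, zero_mul, add_zero, zero_add] <;>
      match_scalars <;> field_simp) (by
      have hs := sqrtC_ne (q := q)
      simp only [tri_mul, tri_smul, tri_add, tri_one]
      apply tri_ext <;>
      simp only [smul_mul_assoc, mul_smul_comm, a_mul_b, a_mul_c, b_mul_d, c_mul_d, b_mul_c,
        a_mul_d, d_mul_a, ← sqrtC_sq (q := q), mul_zero, zero_mul, add_zero, zero_add] <;>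
      match_scalars <;> field_simp) (by
      have hs := sqrtC_ne (q := q)
      simp only [tri_mul, tri_smul, tri_add, tri_one]
      apply tri_ext <;>
      simp only [smul_mul_assoc, mul_smul_comm, a_mul_b, a_mul_c, b_mul_d, c_mul_d, b_mul_c,
        a_mul_d, d_mul_a, ← sqrtC_sq (q := q), mul_zero, zero_mul, add_zero, zero_add] <;>
      match_scalars <;> field_simp) (by
      have hs := sqrtC_ne (q := q)
      simp only [tri_mul, tri_smul, tri_add, tri_one]
      apply tri_ext <;>
      simp only [smul_mul_assoc, mul_smul_comm, a_mul_b, a_mul_c, b_mul_d, c_mul_d, b_mul_c,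
        a_mul_d, d_mul_a, ← sqrtC_sq (q := q), mul_zero, zero_mul, add_zero, zero_add] <;>
      match_scalars <;> field_simp) (by
      have hs := sqrtC_ne (q := q)
      simp only [tri_mul, tri_smul, tri_add, tri_one]
      apply tri_ext <;>
      simp only [smul_mul_assoc, mul_smul_comm, a_mul_b, a_mul_c, b_mul_d, c_mul_d, b_mul_c,
        a_mul_d, d_mul_a, ← sqrtC_sq (q := q), mul_zero, zero_mul, add_zero, zero_add] <;>
      match_scalars <;> field_simp)

end OSU

namespace OSU
variable {q : ℝ} [hq : Fact (0 < q)]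

theorem matE_apply (x : OSU q) : matE x = tri (actKi x) (matE x 0 1) (actK x) := by
  induction x using OSU.induction with
  | hc z =>
    rw [AlgHom.commutes, AlgHom.commutes, AlgHom.commutes, Algebra.algebraMap_eq_smul_one,
      Algebra.algebraMap_eq_smul_one, tri_one, tri_smul]
    simp [tri]
  | h1 => simp [matE, tri]
  | h2 => simp [matE, tri]
  | h3 => simp [matE, tri]
  | h4 => simp [matE, tri]
  | ha x y h1 h2 =>
    rw [map_add, map_add, map_add, h1, h2, tri_add]; simp [tri]
  | hm x y h1 h2 =>
    rw [map_mul, map_mul, map_mul, h1, h2, tri_mul]; simp [tri]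

theorem matF_apply (x : OSU q) : matF x = tri (actKi x) (matF x 0 1) (actK x) := by
  induction x using OSU.induction with
  | hc z =>
    rw [AlgHom.commutes, AlgHom.commutes, AlgHom.commutes, Algebra.algebraMap_eq_smul_one,
      Algebra.algebraMap_eq_smul_one, tri_one, tri_smul]
    simp [tri]
  | h1 => simp [matF, tri]
  | h2 => simp [matF, tri]
  | h3 => simp [matF, tri]
  | h4 => simp [matF, tri]
  | ha x y h1 h2 =>
    rw [map_add, map_add, map_add, h1, h2, tri_add]; simp [tri]
  | hm x y h1 h2 =>
    rw [map_mul, map_mul, map_mul, h1, h2, tri_mul]; simp [tri]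

/-- `E ▷ ·`. -/
def actE : OSU q →ₗ[ℂ] OSU q where
  toFun x := matE x 0 1
  map_add' x y := by simp
  map_smul' z x := by simp

/-- `F ▷ ·`. -/
def actF : OSU q →ₗ[ℂ] OSU q where
  toFun x := matF x 0 1
  map_add' x y := by simp
  map_smul' z x := by simp

theorem actE_mul (x y : OSU q) : actE (x * y) = actE x * actK y + actKi x * actE y := by
  change matE (x * y) 0 1 = matE x 0 1 * actK y + actKi x * matE y 0 1
  rw [map_mul, matE_apply x, matE_apply y, tri_mul]
  simp [tri, add_comm]

theorem actF_mul (x y : OSU q) : actF (x * y) = actF x * actK y + actKi x * actF y := by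
  change matF (x * y) 0 1 = matF x 0 1 * actK y + actKi x * matF y 0 1
  rw [map_mul, matF_apply x, matF_apply y, tri_mul]
  simp [tri, add_comm]

@[simp] theorem actE_a : actE (a : OSU q) = b := by simp [actE, matE, tri]
@[simp] theorem actE_b : actE (b : OSU q) = 0 := by simp [actE, matE, tri]
@[simp] theorem actE_c : actE (c : OSU q) = d := by simp [actE, matE, tri]
@[simp] theorem actE_d : actE (d : OSU q) = 0 := by simp [actE, matE, tri]
@[simp] theorem actF_a : actF (a : OSU q) = 0 := by simp [actF, matF, tri]
@[simp] theorem actF_b : actF (b : OSU q) = a := by simp [actF, matF, tri]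
@[simp] theorem actF_c : actF (c : OSU q) = 0 := by simp [actF, matF, tri]
@[simp] theorem actF_d : actF (d : OSU q) = c := by simp [actF, matF, tri]
@[simp] theorem actE_algebraMap (z : ℂ) : actE (algebraMap ℂ (OSU q) z) = 0 := by
  change matE (algebraMap ℂ (OSU q) z) 0 1 = 0
  rw [AlgHom.commutes]; simp [Matrix.algebraMap_matrix_apply]
@[simp] theorem actF_algebraMap (z : ℂ) : actF (algebraMap ℂ (OSU q) z) = 0 := by
  change matF (algebraMap ℂ (OSU q) z) 0 1 = 0
  rw [AlgHom.commutes]; simp [Matrix.algebraMap_matrix_apply]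

theorem actK_actKi (x : OSU q) : actK (actKi x) = x := by
  induction x using OSU.induction with
  | ha x y h1 h2 => rw [map_add, map_add, h1, h2]
  | hm x y h1 h2 => rw [map_mul, map_mul, h1, h2]
  | _ => simp [smul_smul, sqrtC_ne]

theorem actKi_actK (x : OSU q) : actKi (actK x) = x := by
  induction x using OSU.induction with
  | ha x y h1 h2 => rw [map_add, map_add, h1, h2]
  | hm x y h1 h2 => rw [map_mul, map_mul, h1, h2]
  | _ => simp [smul_smul, sqrtC_ne]

theorem actK_actE (x : OSU q) : actK (actE x) = (q : ℂ) • actE (actK x) := by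
  have hs := sqrtC_ne (q := q)
  induction x using OSU.induction with
  | ha x y h1 h2 => simp only [map_add, h1, h2, smul_add]
  | hm x y h1 h2 =>
    simp only [map_mul, actE_mul, map_add, h1, h2, actK_actKi, actKi_actK, smul_add,
      smul_mul_assoc, mul_smul_comm]
  | _ => simp [smul_smul, ← sqrtC_sq, -Complex.coe_smul, hs]

theorem actF_actK (x : OSU q) : actF (actK x) = (q : ℂ) • actK (actF x) := by
  have hs := sqrtC_ne (q := q)
  induction x using OSU.induction with
  | ha x y h1 h2 => simp only [map_add, h1, h2, smul_add]
  | hm x y h1 h2 =>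
    simp only [map_mul, actF_mul, map_add, h1, h2, actK_actKi, actKi_actK, smul_add,
      smul_mul_assoc, mul_smul_comm]
  | _ => simp [smul_smul, ← sqrtC_sq, -Complex.coe_smul, hs]

theorem actE_actKi (x : OSU q) : actE (actKi x) = (q : ℂ) • actKi (actE x) := by
  have := congrArg actKi (actK_actE (actKi x))
  rw [actKi_actK, actK_actKi, map_smul] at this
  exact this

theorem actKi_actF (x : OSU q) : actKi (actF x) = (q : ℂ) • actF (actKi x) := by
  have := congrArg actKi (actF_actK (actKi x))
  rw [map_smul, actKi_actK, actK_actKi] at this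
  exact this

variable [hq1 : Fact (q ≠ 1)]

theorem q_sub_inv_ne : (q : ℂ) - (q : ℂ)⁻¹ ≠ 0 := by
  have h0 : 0 < q := hq.out
  have h : q - q⁻¹ ≠ 0 := by
    intro h
    have h2 : (q - 1) * (q + 1) = 0 := by field_simp at h; linarith
    rcases mul_eq_zero.1 h2 with h3 | h3
    · exact hq1.out (by linarith)
    · linarith
  exact_mod_cast h

theorem actE_actF_sub (x : OSU q) : actE (actF x) - actF (actE x) =
    (1 / ((q : ℂ) - (q : ℂ)⁻¹)) • (actK (actK x) - actKi (actKi x)) := by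
  have hs := sqrtC_ne (q := q)
  have hne := q_sub_inv_ne (q := q)
  set r := (1 / ((q : ℂ) - (q : ℂ)⁻¹)) with hr
  have hr1 : r * ((q : ℂ) - (q : ℂ)⁻¹) = 1 := by rw [hr, one_div, inv_mul_cancel₀ hne]
  induction x using OSU.induction with
  | ha x y h1 h2 =>
    have h3 := congrArg₂ (· + ·) h1 h2
    simp only [map_add, ← smul_add] at h3 ⊢
    rw [show actK (actK x) + actK (actK y) - (actKi (actKi x) + actKi (actKi y)) =
      actK (actK x) - actKi (actKi x) + (actK (actK y) - actKi (actKi y)) by abel, ← h3]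
    abel
  | hm x y h1 h2 =>
    have h1' : actE (actF x) = actF (actE x) + r • (actK (actK x) - actKi (actKi x)) := by
      rw [← h1]; abel
    have h2' : actE (actF y) = actF (actE y) + r • (actK (actK y) - actKi (actKi y)) := by
      rw [← h2]; abel
    simp only [map_mul, actF_mul, actE_mul, map_add, h1', h2', actK_actE, actF_actK, actE_actKi,
      actKi_actF, smul_mul_assoc, mul_smul_comm, add_mul, mul_add, smul_sub, sub_mul, mul_sub]
    abel
  | hc z => simp
  | h1 =>
    simp only [actF_a, actE_a, map_zero, actF_b, actK_a, actKi_a, map_smul, smul_smul, ← sub_smul]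
    rw [show r * ((sqrtC q)⁻¹ * (sqrtC q)⁻¹ - sqrtC q * sqrtC q) = -1 by
      rw [← mul_inv, sqrtC_sq]; linear_combination -hr1]
    simp
  | h2 =>
    simp only [actE_a, actE_b, map_zero, actF_b, actK_b, actKi_b, map_smul, smul_smul, ← sub_smul]
    rw [show r * (sqrtC q * sqrtC q - (sqrtC q)⁻¹ * (sqrtC q)⁻¹) = 1 by
      rw [← mul_inv, sqrtC_sq]; linear_combination hr1]
    simp
  | h3 =>
    simp only [actF_c, actE_c, map_zero, actF_d, actK_c, actKi_c, map_smul, smul_smul, ← sub_smul]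
    rw [show r * ((sqrtC q)⁻¹ * (sqrtC q)⁻¹ - sqrtC q * sqrtC q) = -1 by
      rw [← mul_inv, sqrtC_sq]; linear_combination -hr1]
    simp
  | h4 =>
    simp only [actE_c, actE_d, map_zero, actF_d, actK_d, actKi_d, map_smul, smul_smul, ← sub_smul]
    rw [show r * (sqrtC q * sqrtC q - (sqrtC q)⁻¹ * (sqrtC q)⁻¹) = 1 by
      rw [← mul_inv, sqrtC_sq]; linear_combination hr1]
    simp

/-- The left action of `U_q(su₂)` on `O(SU_q(2))`. -/
def act : Uq q →ₐ[ℂ] Module.End ℂ (OSU q) :=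
  Uq.lift actE actF actK.toLinearMap actKi.toLinearMap
    (LinearMap.ext actK_actKi) (LinearMap.ext actKi_actK) (LinearMap.ext actK_actE)
    (LinearMap.ext actF_actK) (LinearMap.ext actE_actF_sub)

@[simp] theorem act_E (x : OSU q) : act Uq.E x = actE x := by simp [act]
@[simp] theorem act_F (x : OSU q) : act Uq.F x = actF x := by simp [act]
@[simp] theorem act_K (x : OSU q) : act Uq.K x = actK x := by simp [act]
@[simp] theorem act_Ki (x : OSU q) : act Uq.Ki x = actKi x := by simp [act]

/-- `f ▷ (x y) = (f₍₁₎ ▷ x) (f₍₂₎ ▷ y)`. -/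
theorem act_mul (f : Uq q) (x y : OSU q) :
    act f (x * y) = LinearMap.mul' ℂ (OSU q)
      (TensorProduct.map (act.toLinearMap.flip x) (act.toLinearMap.flip y)
        (Coalgebra.comul (R := ℂ) f)) := by
  rw [Uq.comul_eq]
  induction f using Uq.induction generalizing x y with
  | hc z =>
    simp [Algebra.TensorProduct.algebraMap_apply, Module.algebraMap_end_apply]
  | hE => simp [Uq.comulHom, actE_mul]
  | hF => simp [Uq.comulHom, actF_mul]
  | hK => simp [Uq.comulHom]
  | hKi => simp [Uq.comulHom]
  | ha f g h1 h2 => simp only [map_add, LinearMap.add_apply, h1, h2]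
  | hm f g h1 h2 =>
    rw [map_mul act f g, Module.End.mul_apply, h2, map_mul Uq.comulHom]
    generalize Uq.comulHom g = w
    induction w using TensorProduct.induction_on with
    | zero => simp
    | add u v h3 h4 => simp only [map_add, mul_add, h3, h4]
    | tmul u v =>
      simp only [TensorProduct.map_tmul, LinearMap.mul'_apply, LinearMap.flip_apply,
        AlgHom.toLinearMap_apply, h1]
      generalize Uq.comulHom f = w'
      induction w' using TensorProduct.induction_on with
      | zero => simp
      | add u v h3 h4 => simp only [map_add, add_mul, h3, h4]
      | tmul u' v' => simp

theorem act_one (f : Uq q) : act f (1 : OSU q) = Coalgebra.counit (R := ℂ) f • 1 := by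
  rw [Uq.counit_eq]
  induction f using Uq.induction with
  | hc z => simp [Module.algebraMap_end_apply]
  | hE => rw [← map_one (algebraMap ℂ (OSU q))]; simp [Uq.counitHom, -map_one]
  | hF => rw [← map_one (algebraMap ℂ (OSU q))]; simp [Uq.counitHom, -map_one]
  | hK => simp [Uq.counitHom]
  | hKi => simp [Uq.counitHom]
  | ha f g h1 h2 => simp only [map_add, LinearMap.add_apply, h1, h2, add_smul]
  | hm f g h1 h2 =>
    rw [map_mul, Module.End.mul_apply, h2, map_smul, h1, map_mul, smul_smul, mul_comm]

theorem star_actK (x : OSU q) : star (actK x) = actKi (star x) := by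
  induction x using OSU.induction with
  | ha x y h1 h2 => simp only [map_add, star_add, h1, h2]
  | hm x y h1 h2 => simp only [map_mul, star_mul, h1, h2]
  | hc z => simp [Algebra.algebraMap_eq_smul_one]
  | _ => simp [star_smul, conj_sqrtC, smul_smul, -Complex.coe_smul, mul_comm]

theorem star_actKi (x : OSU q) : star (actKi x) = actK (star x) := by
  rw [← actK_actKi (star (actKi x)), ← star_actK, actK_actKi]

theorem star_actE (x : OSU q) : star (actE x) = -(q : ℂ) • actF (star x) := by
  have h0 := Uq.q_ne (q := q)
  have hs := sqrtC_ne (q := q)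
  induction x using OSU.induction with
  | ha x y h1 h2 => simp only [map_add, star_add, h1, h2, smul_add]
  | hm x y h1 h2 =>
    simp only [actE_mul, actF_mul, star_mul, star_add, h1, h2, star_actK, star_actKi,
      smul_mul_assoc, mul_smul_comm, smul_add]
    rw [add_comm]
  | hc z => rw [actE_algebraMap, ← algebraMap_star_comm, actF_algebraMap]; simp
  | _ => simp [star_smul, conj_sqrtC, smul_smul, -Complex.coe_smul, h0]

theorem star_actF (x : OSU q) : star (actF x) = -(q : ℂ)⁻¹ • actE (star x) := by
  have h0 := Uq.q_ne (q := q)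
  have h1 := congrArg star (star_actE (star x))
  rw [star_star, star_star, star_smul] at h1
  rw [h1, smul_smul]
  simp [h0]

/-- `(f ▷ x)* = S(f)* ▷ x*`. -/
theorem act_star (f : Uq q) (x : OSU q) :
    star (act f x) = act (star (HopfAlgebra.antipode ℂ f)) (star x) := by
  rw [Uq.antipode_eq]
  induction f using Uq.induction generalizing x with
  | hc z =>
    rw [Uq.antipodeLin_algebraMap, ← algebraMap_star_comm]
    simp [Module.algebraMap_end_apply, star_smul]
  | hE => simp [star_smul, star_actE, -Complex.coe_smul]
  | hF => simp [star_smul, star_actF, -Complex.coe_smul]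
  | hK => simp [star_actK]
  | hKi => simp [star_actKi]
  | ha f g h1 h2 => simp only [map_add, LinearMap.add_apply, h1, h2, star_add]
  | hm f g h1 h2 =>
    simp only [map_mul, Module.End.mul_apply, h1, h2, Uq.antipodeLin_mul, star_mul]

theorem dK2_act (f : Uq q) (x : OSU q) : dK2 (act f x) = act f (dK2 x) := by
  have hK : ∀ x : OSU q, dK2 (actK x) = actK (dK2 x) := by
    intro x
    induction x using OSU.induction with
    | ha x y h1 h2 => simp only [map_add, h1, h2]
    | hm x y h1 h2 => simp only [map_mul, h1, h2]
    | hc z => simp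
    | _ => simp [smul_smul, mul_comm, -Complex.coe_smul]
  have hKi : ∀ x : OSU q, dK2 (actKi x) = actKi (dK2 x) := by
    intro x
    rw [← actKi_actK (dK2 (actKi x)), ← hK, actK_actKi]
  induction f using Uq.induction generalizing x with
  | hc z => simp [Module.algebraMap_end_apply]
  | hE =>
    simp only [act_E]
    induction x using OSU.induction with
    | ha x y h1 h2 => simp only [map_add, h1, h2]
    | hm x y h1 h2 => simp only [map_mul, map_add, actE_mul, h1, h2, hK, hKi]
    | hc z => simp
    | _ => simp [-Complex.coe_smul]
  | hF =>
    simp only [act_F]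
    induction x using OSU.induction with
    | ha x y h1 h2 => simp only [map_add, h1, h2]
    | hm x y h1 h2 => simp only [map_mul, map_add, actF_mul, h1, h2, hK, hKi]
    | hc z => simp
    | _ => simp [-Complex.coe_smul]
  | hK => simp [hK]
  | hKi => simp [hKi]
  | ha f g h1 h2 => simp only [map_add, LinearMap.add_apply, h1, h2]
  | hm f g h1 h2 => simp only [map_mul, Module.End.mul_apply, h1, h2]

theorem dK2_star (x : OSU q) : dK2 (star x) = star (dK2i x) := by
  induction x using OSU.induction with
  | ha x y h1 h2 => simp only [map_add, star_add, h1, h2]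
  | hm x y h1 h2 => simp only [map_mul, star_mul, h1, h2]
  | hc z => simp [Algebra.algebraMap_eq_smul_one]
  | _ => simp [star_smul, smul_smul, mul_comm, -Complex.coe_smul]

theorem dK2i_dK2 (x : OSU q) : dK2i (dK2 x) = x := by
  have h0 := Uq.q_ne (q := q)
  induction x using OSU.induction with
  | ha x y h1 h2 => rw [map_add, map_add, h1, h2]
  | hm x y h1 h2 => rw [map_mul, map_mul, h1, h2]
  | _ => simp [smul_smul, h0, -Complex.coe_smul]

end OSU

/-- The `q`-number `[n] = (qⁿ - q⁻ⁿ) / (q - q⁻¹)`. -/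
def qNum (q : ℝ) (n : ℕ) : ℝ := (q ^ n - (q ^ n)⁻¹) / (q - q⁻¹)

/-- The `q`-factorial `[1] [2] ⋯ [n]`. -/
def qFact (q : ℝ) (n : ℕ) : ℝ := ∏ i ∈ Finset.range n, qNum q (i + 1)

section
variable {q : ℝ} [hq : Fact (0 < q)] [hq1 : Fact (q ≠ 1)]

theorem q_sub_inv_ne' : q - q⁻¹ ≠ 0 := by
  have := OSU.q_sub_inv_ne (q := q)
  exact_mod_cast this

theorem qNum_pos {n : ℕ} (hn : n ≠ 0) : 0 < qNum q n := by
  have h0 : 0 < q := hq.out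
  unfold qNum
  rcases lt_or_gt_of_ne hq1.out with h | h
  · have h1 : q ^ n < 1 := pow_lt_one₀ h0.le h hn
    have h2 : 1 < (q ^ n)⁻¹ := (one_lt_inv₀ (by positivity)).2 h1
    have h3 : 1 < q⁻¹ := (one_lt_inv₀ h0).2 h
    exact div_pos_of_neg_of_neg (by linarith) (by linarith)
  · have h1 : 1 < q ^ n := one_lt_pow₀ h hn
    have h2 : (q ^ n)⁻¹ < 1 := inv_lt_one_of_one_lt₀ h1
    have h3 : q⁻¹ < 1 := inv_lt_one_of_one_lt₀ h
    exact div_pos (by linarith) (by linarith)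

theorem qNum_nonneg (n : ℕ) : 0 ≤ qNum q n := by
  rcases eq_or_ne n 0 with rfl | h
  · simp [qNum]
  · exact (qNum_pos h).le

theorem qNum_eq (n : ℕ) : (qNum q n : ℂ) =
    ((sqrtC q ^ n) ^ 2 - ((sqrtC q ^ n) ^ 2)⁻¹) / (sqrtC q ^ 2 - (sqrtC q ^ 2)⁻¹) := by
  rw [← pow_mul, mul_comm, pow_mul, sq, sqrtC_sq]
  simp [qNum]

end

/-! ### The Haar state -/

namespace Haar

/-- The vector space with basis indexed by `ℤ × ℕ × ℕ`. The vector with index `(i, j, k)` stands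
for the element `aⁱ bʲ cᵏ` of `O(SU_q(2))` if `0 ≤ i` and for `d⁻ⁱ bʲ cᵏ` if `i < 0`. -/
abbrev V : Type := (ℤ × ℕ × ℕ) →₀ ℂ

/-- The basis vectors. -/
def e (i : ℤ) (j k : ℕ) : V := Finsupp.single (i, j, k) 1

/-- The linear map determined by its values on the basis. -/
def ofBasis {W : Type} [AddCommGroup W] [Module ℂ W] (g : ℤ → ℕ → ℕ → W) : V →ₗ[ℂ] W :=
  Finsupp.linearCombination ℂ fun p => g p.1 p.2.1 p.2.2

@[simp] theorem ofBasis_e {W : Type} [AddCommGroup W] [Module ℂ W] (g : ℤ → ℕ → ℕ → W)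
    (i : ℤ) (j k : ℕ) : ofBasis g (e i j k) = g i j k := by
  simp [ofBasis, e]

theorem ext_e {W : Type} [AddCommGroup W] [Module ℂ W] {f g : V →ₗ[ℂ] W}
    (h : ∀ i j k, f (e i j k) = g (e i j k)) : f = g := by
  apply Finsupp.lhom_ext
  rintro ⟨i, j, k⟩ z
  have : (Finsupp.single (i, j, k) z : V) = z • e i j k := by simp [e]
  rw [this, map_smul, map_smul, h]

variable (q : ℝ)

/-- `a dᵐ bʲ cᵏ = dᵐ⁻¹ bʲ cᵏ + q²ᵐ⁻¹ dᵐ⁻¹ bʲ⁺¹ cᵏ⁺¹`. -/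
def coeffA (i : ℤ) : ℂ := if i < 0 then (q : ℂ) ^ (-2 * i - 1) else 0

/-- `d aᵐ bʲ cᵏ = aᵐ⁻¹ bʲ cᵏ + q¹⁻²ᵐ aᵐ⁻¹ bʲ⁺¹ cᵏ⁺¹`. -/
def coeffD (i : ℤ) : ℂ := if 0 < i then (q : ℂ) ^ (1 - 2 * i) else 0

/-- Left multiplication by `a`. -/
def opA : Module.End ℂ V :=
  ofBasis fun i j k => e (i + 1) j k + coeffA q i • e (i + 1) (j + 1) (k + 1)
/-- Left multiplication by `b`. -/
def opB : Module.End ℂ V := ofBasis fun i j k => (q : ℂ) ^ (-i) • e i (j + 1) k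
/-- Left multiplication by `c`. -/
def opC : Module.End ℂ V := ofBasis fun i j k => (q : ℂ) ^ (-i) • e i j (k + 1)
/-- Left multiplication by `d`. -/
def opD : Module.End ℂ V :=
  ofBasis fun i j k => e (i - 1) j k + coeffD q i • e (i - 1) (j + 1) (k + 1)

@[simp] theorem opA_e (i : ℤ) (j k : ℕ) :
    opA q (e i j k) = e (i + 1) j k + coeffA q i • e (i + 1) (j + 1) (k + 1) := by simp [opA]
@[simp] theorem opB_e (i : ℤ) (j k : ℕ) :
    opB q (e i j k) = (q : ℂ) ^ (-i) • e i (j + 1) k := by simp [opB]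
@[simp] theorem opC_e (i : ℤ) (j k : ℕ) :
    opC q (e i j k) = (q : ℂ) ^ (-i) • e i j (k + 1) := by simp [opC]
@[simp] theorem opD_e (i : ℤ) (j k : ℕ) :
    opD q (e i j k) = e (i - 1) j k + coeffD q i • e (i - 1) (j + 1) (k + 1) := by simp [opD]

theorem coeff_mul (i : ℤ) : coeffA q (i - 1) * coeffD q i = 0 := by
  unfold coeffA coeffD
  split_ifs <;> first | omega | simp

theorem coeff_mul' (i : ℤ) : coeffA q i * coeffD q (i + 1) = 0 := by
  have := coeff_mul q (i + 1)
  rwa [add_sub_cancel_right] at this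

variable {q}
variable [hq : Fact (0 < q)]

theorem coeff_add (i : ℤ) : coeffA q (i - 1) + coeffD q i = (q : ℂ) * (q : ℂ) ^ (-i) * (q : ℂ) ^ (-i) := by
  have h0 := Uq.q_ne (q := q)
  unfold coeffA coeffD
  have h : (q : ℂ) * (q : ℂ) ^ (-i) * (q : ℂ) ^ (-i) = (q : ℂ) ^ (1 - 2 * i) := by
    rw [← zpow_one_add₀ h0, ← zpow_add₀ h0]; congr 1; ring
  rw [h]
  split_ifs with h1 h2 h2
  · omega
  · rw [add_zero]; congr 1; ring
  · simp
  · omega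

theorem coeff_add' (i : ℤ) :
    coeffA q i + coeffD q (i + 1) = (q : ℂ)⁻¹ * (q : ℂ) ^ (-i) * (q : ℂ) ^ (-i) := by
  have h0 := Uq.q_ne (q := q)
  have := coeff_add (q := q) (i + 1)
  rw [add_sub_cancel_right] at this
  rw [this, neg_add, zpow_add₀ h0, zpow_neg_one]
  field_simp

/-- The left regular representation of `O(SU_q(2))` in the basis of ordered monomials. -/
def rep : OSU q →ₐ[ℂ] Module.End ℂ V :=
  OSU.lift (opA q) (opB q) (opC q) (opD q)
    (by
      have h0 := Uq.q_ne (q := q)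
      apply ext_e; intro i j k
      simp only [Module.End.mul_apply, LinearMap.smul_apply, opA_e, opB_e, map_smul, map_add,
        smul_add, smul_smul, neg_add, zpow_add₀ h0, zpow_neg_one]
      match_scalars <;> field_simp)
    (by
      have h0 := Uq.q_ne (q := q)
      apply ext_e; intro i j k
      simp only [Module.End.mul_apply, LinearMap.smul_apply, opA_e, opC_e, map_smul, map_add,
        smul_add, smul_smul, neg_add, zpow_add₀ h0, zpow_neg_one]
      match_scalars <;> field_simp)
    (by
      have h0 := Uq.q_ne (q := q)
      apply ext_e; intro i j k
      simp only [Module.End.mul_apply, LinearMap.smul_apply, opD_e, opB_e, map_smul, map_add,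
        smul_add, smul_smul, neg_sub, zpow_sub₀ h0, zpow_neg, zpow_one]
      match_scalars <;> field_simp)
    (by
      have h0 := Uq.q_ne (q := q)
      apply ext_e; intro i j k
      simp only [Module.End.mul_apply, LinearMap.smul_apply, opD_e, opC_e, map_smul, map_add,
        smul_add, smul_smul, neg_sub, zpow_sub₀ h0, zpow_neg, zpow_one]
      match_scalars <;> field_simp)
    (by
      apply ext_e; intro i j k
      simp only [Module.End.mul_apply, opB_e, opC_e, map_smul])
    (by
      apply ext_e; intro i j k
      simp only [Module.End.mul_apply, LinearMap.smul_apply, LinearMap.add_apply,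
        Module.End.one_apply, opA_e, opB_e, opC_e, opD_e, map_smul, map_add,
        smul_add, smul_smul, sub_add_cancel, ← coeff_add, mul_comm (coeffD q i), coeff_mul]
      simp only [← mul_assoc, ← coeff_add, zero_smul, add_smul]
      abel)
    (by
      apply ext_e; intro i j k
      simp only [Module.End.mul_apply, LinearMap.smul_apply, LinearMap.add_apply,
        Module.End.one_apply, opA_e, opB_e, opC_e, opD_e, map_smul, map_add,
        smul_add, smul_smul, add_sub_cancel_right, coeff_mul']
      simp only [← mul_assoc, ← coeff_add', zero_smul, add_smul]
      abel)

/-- The functional with `(bc)ᵏ ↦ (-1)ᵏ / [k + 1]` that vanishes on the other monomials. -/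
def functional (q : ℝ) : V →ₗ[ℂ] ℂ :=
  ofBasis fun i j k => if i = 0 ∧ j = k then (-1) ^ k / (qNum q (k + 1) : ℂ) else 0

end Haar

/-- The Haar state of `O(SU_q(2))`: `h(aⁱ bʲ cᵏ) = h(dⁱ bʲ cᵏ) = 0` unless `i = 0` and `j = k`, and
`h((bc)ᵏ) = (-1)ᵏ / [k + 1]`. -/
def haar (q : ℝ) [Fact (0 < q)] : OSU q →ₗ[ℂ] ℂ :=
  Haar.functional q ∘ₗ LinearMap.applyₗ (Haar.e 0 0 0) ∘ₗ Haar.rep.toLinearMap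

namespace Haar

variable {q : ℝ} [hq : Fact (0 < q)]

@[simp] theorem rep_a : rep (OSU.a : OSU q) = opA q := by simp [rep]
@[simp] theorem rep_b : rep (OSU.b : OSU q) = opB q := by simp [rep]
@[simp] theorem rep_c : rep (OSU.c : OSU q) = opC q := by simp [rep]
@[simp] theorem rep_d : rep (OSU.d : OSU q) = opD q := by simp [rep]

theorem haar_apply (x : OSU q) : haar q x = functional q (rep x (e 0 0 0)) := rfl

theorem opC_pow (r : ℕ) : (opC q ^ r) (e 0 0 0) = e 0 0 r := by
  induction r with
  | zero => simp
  | succ r ih => rw [pow_succ', Module.End.mul_apply, ih]; simp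

theorem opA_pow (m r : ℕ) : (opA q ^ m) (e 0 0 r) = e m 0 r := by
  induction m with
  | zero => simp
  | succ m ih =>
    rw [pow_succ', Module.End.mul_apply, ih, opA_e, coeffA, if_neg (by omega)]; simp

theorem haar_monomial {m r : ℕ} (h : m + r ≠ 0) : haar q (OSU.a ^ m * OSU.c ^ r) = 0 := by
  rw [haar_apply, map_mul, map_pow, map_pow, rep_a, rep_c, Module.End.mul_apply, opC_pow, opA_pow]
  simp only [functional, ofBasis_e]
  rw [if_neg (by omega)]

variable [hq1 : Fact (q ≠ 1)]

theorem haar_one : haar q 1 = 1 := by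
  have : qNum q 1 ≠ 0 := (qNum_pos one_ne_zero).ne'
  have h : qNum q 1 = 1 := by simp [qNum, q_sub_inv_ne']
  rw [haar_apply, map_one, Module.End.one_apply, functional, ofBasis_e]
  simp [h]

/-- The action of `K` in the basis of ordered monomials. -/
def opK (q : ℝ) : Module.End ℂ V :=
  ofBasis fun i j k => ((sqrtC q ^ i)⁻¹ * sqrtC q ^ j * (sqrtC q ^ k)⁻¹) • e i j k

/-- The action of `E` in the basis of ordered monomials. -/
def opE (q : ℝ) : Module.End ℂ V :=
  ofBasis fun i j k =>
    (sqrtC q ^ i * sqrtC q ^ j * sqrtC q ^ k * (sqrtC q)⁻¹ * qNum q k) • e (i - 1) j (k - 1) +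
    (if 0 < i then sqrtC q ^ j * sqrtC q * sqrtC q ^ k * (sqrtC q ^ i)⁻¹ *
      qNum q (i.toNat + k) else 0) • e (i - 1) (j + 1) k

theorem functional_opE (v : V) : functional q (opE q v) = 0 := by
  have hs := sqrtC_ne (q := q)
  suffices h : functional q ∘ₗ opE q = 0 from LinearMap.congr_fun h v
  apply ext_e
  intro i j k
  simp only [LinearMap.comp_apply, opE, ofBasis_e, map_add, map_smul, functional,
    LinearMap.zero_apply, smul_eq_mul]
  by_cases hi : i = 1
  · subst hi
    rcases k with _ | k
    · simp [qNum]
    · by_cases hj : j = k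
      · subst hj
        have h1 : (qNum q (j + 1) : ℂ) ≠ 0 := by exact_mod_cast (qNum_pos (by omega)).ne'
        have h2 : (qNum q (1 + (j + 1)) : ℂ) ≠ 0 := by exact_mod_cast (qNum_pos (by omega)).ne'
        have h3 : j + 1 + 1 = 1 + (j + 1) := by omega
        simp [h3]
        field_simp
        ring
      · simp [hj]
  · have : i - 1 ≠ 0 := by omega
    simp [this]

end Haar

namespace Haar
variable {q : ℝ} [hq : Fact (0 < q)] [hq1 : Fact (q ≠ 1)]

theorem q_eq : (q : ℂ) = sqrtC q ^ 2 := by rw [sq, sqrtC_sq]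

theorem s_ne : sqrtC q ^ 2 - (sqrtC q ^ 2)⁻¹ ≠ 0 := by
  have := OSU.q_sub_inv_ne (q := q)
  rwa [q_eq] at this

@[simp] theorem opK_e (i : ℤ) (j k : ℕ) : opK q (e i j k) =
    ((sqrtC q ^ i)⁻¹ * sqrtC q ^ j * (sqrtC q ^ k)⁻¹) • e i j k := by simp [opK]

/-- The `q`-number `[n]` as a function of `q^{n/2}`. -/
def qFun (q : ℝ) (x : ℂ) : ℂ := (x ^ 2 - (x ^ 2)⁻¹) / (sqrtC q ^ 2 - (sqrtC q ^ 2)⁻¹)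

theorem opE_e (i : ℤ) (j k : ℕ) : opE q (e i j k) =
    (sqrtC q ^ i * sqrtC q ^ j * sqrtC q ^ k * (sqrtC q)⁻¹ * qFun q (sqrtC q ^ k)) •
      e (i - 1) j (k - 1) +
    (if 0 < i then sqrtC q ^ j * sqrtC q * sqrtC q ^ k * (sqrtC q ^ i)⁻¹ *
      qFun q (sqrtC q ^ i * sqrtC q ^ k) else 0) • e (i - 1) (j + 1) k := by
  rw [opE, ofBasis_e]
  congr 2
  · rw [qNum_eq, qFun]
  · split_ifs with h
    · have h1 : sqrtC q ^ i = sqrtC q ^ i.toNat := by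
        rw [← zpow_natCast, Int.toNat_of_nonneg h.le]
      rw [qNum_eq, qFun, h1, pow_add]
    · rfl

theorem zpow_q (i : ℤ) : (q : ℂ) ^ i = (sqrtC q ^ i) ^ 2 := by
  rw [q_eq, ← zpow_natCast, ← zpow_natCast, ← zpow_mul, ← zpow_mul, mul_comm]

theorem coeffA_eq (i : ℤ) :
    coeffA q i = if i < 0 then ((sqrtC q ^ i) ^ 4)⁻¹ * (sqrtC q ^ 2)⁻¹ else 0 := by
  have hs := sqrtC_ne (q := q)
  unfold coeffA
  split_ifs
  · rw [zpow_q, zpow_sub₀ hs, show -2 * i = -i + -i by ring, zpow_add₀ hs, zpow_neg, zpow_one]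
    field_simp
  · rfl

theorem coeffD_eq (i : ℤ) :
    coeffD q i = if 0 < i then ((sqrtC q ^ i) ^ 4)⁻¹ * sqrtC q ^ 2 else 0 := by
  have hs := sqrtC_ne (q := q)
  unfold coeffD
  split_ifs
  · rw [zpow_q, show 1 - 2 * i = 1 + -i + -i by ring, zpow_add₀ hs, zpow_add₀ hs, zpow_neg,
      zpow_one]
    field_simp
  · rfl

theorem opK_rep (x : OSU q) : opK q ∘ₗ rep x = rep (OSU.actK x) ∘ₗ opK q := by
  have hs := sqrtC_ne (q := q)
  induction x using OSU.induction with
  | hc z => apply LinearMap.ext; intro v; simp [Module.algebraMap_end_apply]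
  | ha x y h1 h2 => simp only [map_add, LinearMap.comp_add, LinearMap.add_comp, h1, h2]
  | hm x y h1 h2 =>
    simp only [map_mul, Module.End.mul_eq_comp]
    rw [← LinearMap.comp_assoc, h1, LinearMap.comp_assoc, h2, LinearMap.comp_assoc]
  | h1 =>
    apply ext_e; intro i j k
    simp only [LinearMap.comp_apply, rep_a, OSU.actK_a, map_smul, LinearMap.smul_apply, opA_e, map_add, opK_e,
      smul_add, smul_smul, zpow_add₀ hs, zpow_one, pow_succ]
    match_scalars <;> field_simp
  | h2 =>
    apply ext_e; intro i j k
    simp only [LinearMap.comp_apply, rep_b, OSU.actK_b, map_smul, LinearMap.smul_apply, opB_e, map_add, opK_e,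
      smul_add, smul_smul, pow_succ]
    match_scalars
    field_simp
  | h3 =>
    apply ext_e; intro i j k
    simp only [LinearMap.comp_apply, rep_c, OSU.actK_c, map_smul, LinearMap.smul_apply, opC_e, map_add, opK_e,
      smul_add, smul_smul, pow_succ]
    match_scalars
    field_simp
  | h4 =>
    apply ext_e; intro i j k
    simp only [LinearMap.comp_apply, rep_d, OSU.actK_d, map_smul, LinearMap.smul_apply, opD_e, map_add, opK_e,
      smul_add, smul_smul, zpow_sub₀ hs, zpow_one, pow_succ]
    match_scalars <;> field_simp

theorem opE_rep (x : OSU q) :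
    opE q ∘ₗ rep x = rep (OSU.actE x) ∘ₗ opK q + rep (OSU.actKi x) ∘ₗ opE q := by
  have hs := sqrtC_ne (q := q)
  have hs4 : sqrtC q ^ 4 - 1 ≠ 0 := by
    intro h
    apply s_ne (q := q)
    field_simp
    linear_combination h
  induction x using OSU.induction with
  | hc z => apply LinearMap.ext; intro v; simp [Module.algebraMap_end_apply]
  | ha x y h1 h2 =>
    simp only [map_add, LinearMap.comp_add, LinearMap.add_comp, h1, h2]; abel
  | hm x y h1 h2 =>
    simp only [map_mul, Module.End.mul_eq_comp, OSU.actE_mul, map_add, LinearMap.add_comp]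
    rw [← LinearMap.comp_assoc, h1, LinearMap.add_comp, LinearMap.comp_assoc, opK_rep,
      LinearMap.comp_assoc, h2, LinearMap.comp_add]
    simp only [LinearMap.comp_assoc, add_assoc]
  | h1 =>
    apply ext_e; intro i j k
    simp only [LinearMap.comp_apply, LinearMap.add_apply, LinearMap.smul_apply, OSU.actE_a,
      OSU.actKi_a, rep_a, rep_b, rep_c, rep_d, map_smul, map_zero, LinearMap.zero_apply, map_add,
      opA_e, opB_e, opC_e, opD_e, opE_e, opK_e, smul_add, smul_smul, zpow_neg, zpow_q,
      coeffA_eq, coeffD_eq, sub_add_cancel, add_sub_cancel_right]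
    have hcase : i < 0 ∨ i = 0 ∨ i = 1 ∨ 1 < i := by omega
    rcases hcase with h | h | h | h
    all_goals first
      | subst h
      | skip
    all_goals rcases k with _ | k
    all_goals simp (disch := omega) only [if_pos, if_neg, pow_succ, pow_zero, zpow_add₀ hs,
      zpow_sub₀ hs, zpow_one, zpow_zero, Nat.add_sub_cancel, qFun, zero_add, zero_smul, smul_zero,
      mul_zero, add_zero, zero_sub, sub_self, inv_one, zero_div, mul_one, one_mul]
    all_goals match_scalars
    all_goals field_simp
    all_goals ring
  | h2 =>
    apply ext_e; intro i j k
    simp only [LinearMap.comp_apply, LinearMap.add_apply, LinearMap.smul_apply, OSU.actE_b,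
      OSU.actKi_b, rep_a, rep_b, rep_c, rep_d, map_smul, map_zero, LinearMap.zero_apply, map_add,
      opA_e, opB_e, opC_e, opD_e, opE_e, opK_e, smul_add, smul_smul, zpow_neg, zpow_q,
      coeffA_eq, coeffD_eq, sub_add_cancel, add_sub_cancel_right]
    have hcase : i < 0 ∨ i = 0 ∨ i = 1 ∨ 1 < i := by omega
    rcases hcase with h | h | h | h
    all_goals first
      | subst h
      | skip
    all_goals rcases k with _ | k
    all_goals simp (disch := omega) only [if_pos, if_neg, pow_succ, pow_zero, zpow_add₀ hs,
      zpow_sub₀ hs, zpow_one, zpow_zero, Nat.add_sub_cancel, qFun, zero_add, zero_smul, smul_zero,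
      mul_zero, add_zero, zero_sub, sub_self, inv_one, zero_div, mul_one, one_mul]
    all_goals match_scalars
    all_goals field_simp
    all_goals ring
  | h3 =>
    apply ext_e; intro i j k
    simp only [LinearMap.comp_apply, LinearMap.add_apply, LinearMap.smul_apply, OSU.actE_c,
      OSU.actKi_c, rep_a, rep_b, rep_c, rep_d, map_smul, map_zero, LinearMap.zero_apply, map_add,
      opA_e, opB_e, opC_e, opD_e, opE_e, opK_e, smul_add, smul_smul, zpow_neg, zpow_q,
      coeffA_eq, coeffD_eq, sub_add_cancel, add_sub_cancel_right]
    have hcase : i < 0 ∨ i = 0 ∨ i = 1 ∨ 1 < i := by omega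
    rcases hcase with h | h | h | h
    all_goals first
      | subst h
      | skip
    all_goals rcases k with _ | k
    all_goals simp (disch := omega) only [if_pos, if_neg, pow_succ, pow_zero, zpow_add₀ hs,
      zpow_sub₀ hs, zpow_one, zpow_zero, Nat.add_sub_cancel, qFun, zero_add, zero_smul, smul_zero,
      mul_zero, add_zero, zero_sub, sub_self, inv_one, zero_div, mul_one, one_mul]
    all_goals match_scalars
    all_goals field_simp
    all_goals ring
  | h4 =>
    apply ext_e; intro i j k
    simp only [LinearMap.comp_apply, LinearMap.add_apply, LinearMap.smul_apply, OSU.actE_d,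
      OSU.actKi_d, rep_a, rep_b, rep_c, rep_d, map_smul, map_zero, LinearMap.zero_apply, map_add,
      opA_e, opB_e, opC_e, opD_e, opE_e, opK_e, smul_add, smul_smul, zpow_neg, zpow_q,
      coeffA_eq, coeffD_eq, sub_add_cancel, add_sub_cancel_right]
    have hcase : i < 0 ∨ i = 0 ∨ i = 1 ∨ 1 < i := by omega
    rcases hcase with h | h | h | h
    all_goals first
      | subst h
      | skip
    all_goals rcases k with _ | k
    all_goals simp (disch := omega) only [if_pos, if_neg, pow_succ, pow_zero, zpow_add₀ hs,
      zpow_sub₀ hs, zpow_one, zpow_zero, Nat.add_sub_cancel, qFun, zero_add, zero_smul, smul_zero,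
      mul_zero, add_zero, zero_sub, sub_self, inv_one, zero_div, mul_one, one_mul]
    all_goals match_scalars
    all_goals field_simp
    all_goals ring

/-- The Haar state is invariant under the action of `E`. -/
theorem haar_actE (x : OSU q) : haar q (OSU.actE x) = 0 := by
  have h := LinearMap.congr_fun (opE_rep x) (e 0 0 0)
  have h1 : opE q (e 0 0 0) = 0 := by simp [opE_e, qFun]
  simp only [LinearMap.comp_apply, LinearMap.add_apply, opK_e, h1, map_zero, add_zero] at h
  rw [haar_apply]
  simp at h
  rw [← h, functional_opE]

end Haar

section
variable (q : ℝ) [hq : Fact (0 < q)] [hq1 : Fact (q ≠ 1)]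

/-! ### Matrix elements, the spin representations and the Podleś sphere

Half-integers `l` and `j, k ∈ {-l, …, l}` are encoded by the natural numbers `m = 2 l`, `l + j` and
`l + k`. -/

/-- The number `α^l_k = ([l - k] [l + k + 1])^{1/2}`, encoded by `m = 2 l` and `i = l + k`. -/
def alpha (m i : ℕ) : ℝ := Real.sqrt (qNum q (m - i) * qNum q (i + 1))

/-- The matrix element `t^l_{jk}` of the spin `l` unitary corepresentation, encoded by `m = 2 l`,
`r = l + j ≤ m` and `l + k ≤ m`. One has
`t^l_{j,-l} = q^{-(l+j)(l-j)/2} ([2l]! / ([l+j]! [l-j]!))^{1/2} a^{l-j} c^{l+j}`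
and `E ▷ t^l_{jk} = α^l_k t^l_{j,k+1}`. -/
def tmat (m r : ℕ) : ℕ → OSU q
  | 0 => ((sqrtC q ^ (r * (m - r)))⁻¹ *
      (Real.sqrt (qFact q m / (qFact q r * qFact q (m - r))) : ℝ)) •
        (OSU.a ^ (m - r) * OSU.c ^ r)
  | k + 1 => ((alpha q m k : ℂ)⁻¹) • OSU.act Uq.E (tmat m r k)

/-- The Haar state vanishes on the matrix elements of the nontrivial irreducible unitary
corepresentations. -/
theorem haar_tmat {m r : ℕ} (hm : m ≠ 0) (hr : r ≤ m) (k : ℕ) : haar q (tmat q m r k) = 0 := by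
  cases k with
  | zero => rw [tmat, map_smul, Haar.haar_monomial (by omega), smul_zero]
  | succ k => rw [tmat, map_smul, OSU.act_E, Haar.haar_actE, smul_zero]

theorem dK2_tmat {m r : ℕ} (hr : r ≤ m) (k : ℕ) :
    OSU.dK2 (tmat q m r k) = ((q : ℂ) ^ ((m : ℤ) - 2 * r)) • tmat q m r k := by
  have h0 := Uq.q_ne (q := q)
  induction k with
  | zero =>
    have h : (q : ℂ) ^ ((m : ℤ) - 2 * r) = (q : ℂ) ^ (m - r) * ((q : ℂ) ^ r)⁻¹ := by
      rw [← zpow_natCast, ← zpow_natCast, ← zpow_neg, ← zpow_add₀ h0]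
      congr 1
      push_cast [hr]
      ring
    rw [tmat, map_smul, map_mul, map_pow, map_pow, OSU.dK2_a, OSU.dK2_c, smul_pow, smul_pow,
      smul_mul_smul_comm, smul_comm, h, inv_pow]
  | succ k ih => rw [tmat, map_smul, OSU.dK2_act, ih, map_smul, smul_comm]

/-- The matrix of `E` in the spin `l` representation, `m = 2 l`. -/
def sigmaE (m : ℕ) : Matrix (Fin (m + 1)) (Fin (m + 1)) ℂ :=
  fun i k => if (i : ℕ) = k + 1 then (alpha q m k : ℂ) else 0

/-- The matrix of `F` in the spin `l` representation. -/
def sigmaF (m : ℕ) : Matrix (Fin (m + 1)) (Fin (m + 1)) ℂ :=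
  fun i k => if (i : ℕ) + 1 = k then (alpha q m i : ℂ) else 0

/-- The matrix of `K` in the spin `l` representation. -/
def sigmaK (m : ℕ) : Matrix (Fin (m + 1)) (Fin (m + 1)) ℂ :=
  Matrix.diagonal fun k => sqrtC q ^ (2 * (k : ℤ) - m)

/-- The matrix of `K⁻¹` in the spin `l` representation. -/
def sigmaKi (m : ℕ) : Matrix (Fin (m + 1)) (Fin (m + 1)) ℂ :=
  Matrix.diagonal fun k => sqrtC q ^ (-(2 * (k : ℤ) - m))

theorem alpha_sq (m i : ℕ) :
    (alpha q m i : ℂ) * (alpha q m i : ℂ) = (qNum q (m - i) : ℂ) * (qNum q (i + 1) : ℂ) := by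
  rw [← Complex.ofReal_mul, alpha, Real.mul_self_sqrt (mul_nonneg (qNum_nonneg _) (qNum_nonneg _)),
    Complex.ofReal_mul]

theorem sigmaE_mul_sigmaF (m : ℕ) : sigmaE q m * sigmaF q m =
    Matrix.diagonal fun k : Fin (m + 1) => (qNum q (m + 1 - k) : ℂ) * (qNum q k : ℂ) := by
  ext i k
  rw [Matrix.mul_apply, Matrix.diagonal_apply]
  simp only [sigmaE, sigmaF]
  rcases Nat.eq_zero_or_pos (i : ℕ) with hi | hi
  · have h0 : (qNum q (i : ℕ) : ℂ) = 0 := by rw [hi]; simp [qNum]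
    rw [h0, mul_zero, ite_self]
    refine Finset.sum_eq_zero fun j _ => ?_
    rw [if_neg (by omega), zero_mul]
  · rw [Finset.sum_eq_single (⟨i - 1, by omega⟩ : Fin (m + 1))]
    · by_cases h : i = k
      · subst h
        rw [if_pos (by simp; omega), if_pos (by simp; omega), if_pos rfl]
        simp only
        rw [alpha_sq, show m - (i - 1 : ℕ) = m + 1 - i by omega,
          show (i : ℕ) - 1 + 1 = i by omega]
      · have h' : (i : ℕ) ≠ k := fun hh => h (Fin.ext hh)
        rw [if_neg h, if_neg (c := (i : ℕ) - 1 + 1 = k) (by omega), mul_zero]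
    · intro j _ hj
      have h' : (j : ℕ) ≠ i - 1 := fun hh => hj (Fin.ext hh)
      rw [if_neg (by omega), zero_mul]
    · simp

theorem sigmaF_mul_sigmaE (m : ℕ) : sigmaF q m * sigmaE q m =
    Matrix.diagonal fun k : Fin (m + 1) => (qNum q (m - k) : ℂ) * (qNum q (k + 1) : ℂ) := by
  ext i k
  rw [Matrix.mul_apply, Matrix.diagonal_apply]
  simp only [sigmaE, sigmaF]
  have hlt := i.isLt
  rcases (show (i : ℕ) = m ∨ (i : ℕ) < m by omega) with hi | hi
  · have h0 : (qNum q (m - (i : ℕ)) : ℂ) = 0 := by rw [hi]; simp [qNum]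
    rw [h0, zero_mul, ite_self]
    refine Finset.sum_eq_zero fun j _ => ?_
    rw [if_neg (by omega), zero_mul]
  · rw [Finset.sum_eq_single (⟨i + 1, by omega⟩ : Fin (m + 1))]
    · by_cases h : i = k
      · subst h
        rw [if_pos rfl, if_pos rfl, alpha_sq]
      · have h' : (i : ℕ) ≠ k := fun hh => h (Fin.ext hh)
        rw [if_neg h, if_neg (c := (i : ℕ) + 1 = k + 1) (by omega), mul_zero]
    · intro j _ hj
      have h' : (j : ℕ) ≠ i + 1 := fun hh => hj (Fin.ext hh)
      rw [if_neg (by omega), zero_mul]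
    · simp

theorem qNum_identity (n k : ℕ) :
    (qNum q (n + 1) : ℂ) * (qNum q k : ℂ) - (qNum q n : ℂ) * (qNum q (k + 1) : ℂ) =
      1 / ((q : ℂ) - (q : ℂ)⁻¹) *
        (((q : ℂ) ^ k * ((q : ℂ) ^ n)⁻¹) - ((q : ℂ) ^ n * ((q : ℂ) ^ k)⁻¹)) := by
  have h0 := Uq.q_ne (q := q)
  have h1 := OSU.q_sub_inv_ne (q := q)
  have hk : (q : ℂ) ^ k ≠ 0 := pow_ne_zero _ h0
  have hn : (q : ℂ) ^ n ≠ 0 := pow_ne_zero _ h0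
  have e : ∀ j : ℕ, (qNum q j : ℂ) = ((q : ℂ) ^ j - ((q : ℂ) ^ j)⁻¹) * ((q : ℂ) - (q : ℂ)⁻¹)⁻¹ := by
    intro j; simp [qNum, div_eq_mul_inv]
  rw [e, e, e, e, one_div]
  have hD : ((q : ℂ) - (q : ℂ)⁻¹) * ((q : ℂ) - (q : ℂ)⁻¹)⁻¹ = 1 := mul_inv_cancel₀ h1
  rw [pow_succ, pow_succ, mul_inv, mul_inv]
  generalize ((q : ℂ) - (q : ℂ)⁻¹)⁻¹ = D at hD ⊢
  have hkk : (q : ℂ) ^ k * ((q : ℂ) ^ k)⁻¹ = 1 := mul_inv_cancel₀ hk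
  have hnn : (q : ℂ) ^ n * ((q : ℂ) ^ n)⁻¹ = 1 := mul_inv_cancel₀ hn
  generalize (q : ℂ) ^ k = x at *
  generalize (q : ℂ) ^ n = y at *
  generalize x⁻¹ = x' at *
  generalize y⁻¹ = y' at *
  linear_combination (x * y' - y * x') * D * hD

/-- The matrix representation `σ_l` of `U_q(su₂)`, `m = 2 l`. -/
def sigma (m : ℕ) : Uq q →ₐ[ℂ] Matrix (Fin (m + 1)) (Fin (m + 1)) ℂ :=
  Uq.lift (sigmaE q m) (sigmaF q m) (sigmaK q m) (sigmaKi q m)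
    (by
      have hs := sqrtC_ne (q := q)
      rw [sigmaK, sigmaKi, Matrix.diagonal_mul_diagonal, ← Matrix.diagonal_one]
      congr 1; funext k; rw [← zpow_add₀ hs, add_neg_cancel, zpow_zero])
    (by
      have hs := sqrtC_ne (q := q)
      rw [sigmaK, sigmaKi, Matrix.diagonal_mul_diagonal, ← Matrix.diagonal_one]
      congr 1; funext k; rw [← zpow_add₀ hs, neg_add_cancel, zpow_zero])
    (by
      have hs := sqrtC_ne (q := q)
      ext i k
      rw [sigmaK, Matrix.diagonal_mul, Matrix.smul_apply, Matrix.mul_diagonal]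
      simp only [sigmaE]
      split_ifs with h
      · rw [h, ← sqrtC_sq (q := q), smul_eq_mul]
        push_cast
        rw [show 2 * ((k : ℤ) + 1) - m = 1 + 1 + (2 * k - m) by ring, zpow_add₀ hs, zpow_add₀ hs,
          zpow_one]
        ring
      · simp)
    (by
      have hs := sqrtC_ne (q := q)
      ext i k
      rw [sigmaK, Matrix.mul_diagonal, Matrix.smul_apply, Matrix.diagonal_mul]
      simp only [sigmaF]
      split_ifs with h
      · rw [← h, ← sqrtC_sq (q := q), smul_eq_mul]
        push_cast
        rw [show 2 * ((i : ℤ) + 1) - m = 1 + 1 + (2 * i - m) by ring, zpow_add₀ hs, zpow_add₀ hs,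
          zpow_one]
        ring
      · simp)
    (by
      have hs := sqrtC_ne (q := q)
      rw [sigmaE_mul_sigmaF, sigmaF_mul_sigmaE, sigmaK, sigmaKi, Matrix.diagonal_mul_diagonal,
        Matrix.diagonal_mul_diagonal, Matrix.diagonal_sub, Matrix.diagonal_sub,
        ← Matrix.diagonal_smul]
      congr 1
      funext k
      obtain ⟨n, hn⟩ : ∃ n : ℕ, m = n + k := ⟨m - k, by omega⟩
      have hq : ∀ j : ℕ, (q : ℂ) ^ j = sqrtC q ^ (2 * (j : ℤ)) := by
        intro j
        rw [← sqrtC_sq (q := q), ← sq, ← pow_mul, ← zpow_natCast]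
        push_cast; rfl
      rw [show m + 1 - (k : ℕ) = n + 1 by omega, show m - (k : ℕ) = n by omega, qNum_identity,
        Pi.smul_apply, smul_eq_mul]
      congr 1
      rw [hq k, hq n, ← zpow_neg, ← zpow_neg, ← zpow_add₀ hs, ← zpow_add₀ hs, ← zpow_add₀ hs,
        ← zpow_add₀ hs]
      have hn' : (m : ℤ) = n + (k : ℕ) := by exact_mod_cast hn
      congr 2 <;> linarith)

/-- The `*`-representation `ρ_l(f) = σ_l(K⁻¹ S(f) K)` of the opposite algebra, `m = 2 l`. -/
def rho (m : ℕ) : Uq q →ₐ[ℂ] (Matrix (Fin (m + 1)) (Fin (m + 1)) ℂ)ᵐᵒᵖ :=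
  AlgHom.ofLinearMap
    ((MulOpposite.opLinearEquiv ℂ).toLinearMap ∘ₗ (sigma q m).toLinearMap ∘ₗ
      LinearMap.mulLeftRight ℂ (Uq.Ki, Uq.K) ∘ₗ HopfAlgebra.antipode ℂ)
    (by simp [Uq.Ki_mul_K, ← map_mul])
    (by
      intro x y
      simp only [LinearMap.comp_apply, HopfAlgebra.antipode_mul_antidistrib, LinearMap.mulLeftRight_apply,
        LinearEquiv.coe_coe, MulOpposite.coe_opLinearEquiv, AlgHom.toLinearMap_apply, ← map_mul,
        ← MulOpposite.op_mul]
      congr 2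
      simp only [mul_assoc]
      rw [← mul_assoc Uq.K Uq.Ki, Uq.K_mul_Ki, one_mul])

theorem repLin_rho (m : ℕ) (f : Uq q) :
    repLin (rho q m) f = sigma q m (Uq.Ki * HopfAlgebra.antipode ℂ f * Uq.K) := rfl

/-- The coordinate algebra of the standard Podleś sphere: the `*`-subalgebra of
`∂_{K²}`-invariant elements of `O(SU_q(2))`. -/
def podles : StarSubalgebra ℂ (OSU q) where
  carrier := {x | OSU.dK2 x = x}
  mul_mem' {x y} hx hy := by
    change OSU.dK2 (x * y) = x * y
    rw [map_mul, show OSU.dK2 x = x from hx, show OSU.dK2 y = y from hy]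
  add_mem' {x y} hx hy := by
    change OSU.dK2 (x + y) = x + y
    rw [map_add, show OSU.dK2 x = x from hx, show OSU.dK2 y = y from hy]
  algebraMap_mem' z := by simp
  star_mem' {x} hx := by
    have hx : OSU.dK2 x = x := hx
    change OSU.dK2 (star x) = star x
    have h2 : OSU.dK2i x = x := by
      have := OSU.dK2i_dK2 x
      rwa [hx] at this
    rw [OSU.dK2_star, h2]

theorem mem_podles {x : OSU q} : x ∈ podles q ↔ OSU.dK2 x = x := Iff.rfl

/-- The left action of `U_q(su₂)` on the Podleś sphere, the restriction of the action on
`O(SU_q(2))`. -/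
def actS : Uq q →ₐ[ℂ] Module.End ℂ (podles q) :=
  AlgHom.ofLinearMap
    { toFun := fun f => (OSU.act f).restrict (p := (podles q).toSubalgebra.toSubmodule)
        (q := (podles q).toSubalgebra.toSubmodule) (fun x hx => by
          change OSU.dK2 _ = _
          rw [OSU.dK2_act, (mem_podles q).1 hx])
      map_add' := fun f g => by ext x; simp
      map_smul' := fun z f => by ext x; simp }
    (by
      ext x
      change OSU.act 1 (x : OSU q) = x
      simp)
    (by
      intro f g
      ext x
      change OSU.act (f * g) (x : OSU q) = OSU.act f (OSU.act g x)
      simp)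

theorem actS_coe (f : Uq q) (x : podles q) : (actS q f x : OSU q) = OSU.act f x := rfl

/-- The modular automorphism `θ(x) = K⁻² ▷ x` of the Podleś sphere. -/
def theta : podles q → podles q := actS q (Uq.Ki * Uq.Ki)

/-- The inverse `θ⁻¹(x) = K² ▷ x` of the modular automorphism. -/
def thetaInv : podles q → podles q := actS q (Uq.K * Uq.K)

/-- The restriction of the counit of `O(SU_q(2))` to the Podleś sphere. -/
def epsS : Module.Dual ℂ (podles q) :=
  OSU.counit.toLinearMap ∘ₗ (podles q).toSubalgebra.val.toLinearMap

/-- The restriction of the Haar state of `O(SU_q(2))` to the Podleś sphere. -/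
def haarS : Module.Dual ℂ (podles q) := haar q ∘ₗ (podles q).toSubalgebra.val.toLinearMap

/-- The row index `l + N / 2` with `l = |N| / 2`. -/
def rowIdx (N : ℤ) : ℕ := if 0 ≤ N then N.natAbs else 0

/-- The entry `(t^l_{N/2,i})* t^l_{N/2,j}` with `l = |N| / 2`. -/
def tEntry (N : ℤ) (i j : Fin (N.natAbs + 1)) : podles q :=
  ⟨star (tmat q N.natAbs (rowIdx N) i) * tmat q N.natAbs (rowIdx N) j, by
    have h0 := Uq.q_ne (q := q)
    have hr : rowIdx N ≤ N.natAbs := by unfold rowIdx; split_ifs <;> omega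
    have h1 : ∀ x : OSU q, ∀ z : ℂ, z ≠ 0 → OSU.dK2 x = z • x → OSU.dK2i x = z⁻¹ • x := by
      intro x z hz hx
      have h := congrArg OSU.dK2i hx
      rw [OSU.dK2i_dK2, map_smul] at h
      nth_rewrite 2 [h]
      rw [smul_smul, inv_mul_cancel₀ hz, one_smul]
    have hz : (q : ℂ) ^ ((N.natAbs : ℤ) - 2 * rowIdx N) ≠ 0 := zpow_ne_zero _ h0
    have hc : star ((q : ℂ) ^ ((N.natAbs : ℤ) - 2 * rowIdx N)) =
        (q : ℂ) ^ ((N.natAbs : ℤ) - 2 * rowIdx N) := by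
      simp
    rw [mem_podles, map_mul, OSU.dK2_star, h1 _ _ hz (dK2_tmat q hr i), dK2_tmat q hr j,
      star_smul, star_inv₀, hc, smul_mul_smul_comm, inv_mul_cancel₀ hz, one_smul]⟩

/-- The projection `P_N = ρ_l(K⁻¹) t* t ρ_l(K)`, where `l = |N| / 2` and `t` is the row vector of
the matrix elements `t^l_{N/2,k}`. -/
def projN (N : ℤ) : Matrix (Fin (N.natAbs + 1)) (Fin (N.natAbs + 1)) (podles q) :=
  scalarMat (podles q) (repLin (rho q N.natAbs) Uq.Ki) * Matrix.of (tEntry q N) *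
    scalarMat (podles q) (repLin (rho q N.natAbs) Uq.K)

theorem isGroupLike_Ki_sq : IsGroupLikeElem ℂ (Uq.Ki * Uq.Ki : Uq q) where
  counit_eq_one := by rw [Uq.counit_eq]; simp [Uq.counitHom]
  comul_eq_tmul_self := by rw [Uq.comul_eq]; simp [Uq.comulHom]

theorem invAntipode_Ki_sq : invAntipode (Uq.Ki * Uq.Ki : Uq q) = Uq.K * Uq.K := by
  simp [invAntipode, Uq.antipode_eq, Uq.antipodeLin_mul]

/-- The equivariant `K₀`-group of the Podleś sphere with respect to `θ⁻¹`. -/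
abbrev K0S : Type := K0 (actS q) (thetaInv q)

/-- The pairing of `HC⁰_θ` with the equivariant `K₀`-group of the Podleś sphere; here
`θ = K⁻² ▷ ·`. -/
def pairingS (φ : HC0 (theta q)) : K0S q →+ ℂ :=
  pairing (Uq.Ki * Uq.Ki) (isGroupLike_Ki_sq q)
    (by
      rw [invAntipode_Ki_sq]
      apply Subtype.ext
      rw [actS_coe]
      simp)
    (by
      rw [invAntipode_Ki_sq, mul_assoc, ← mul_assoc Uq.Ki Uq.K, Uq.Ki_mul_K, one_mul,
        Uq.Ki_mul_K])
    φ

end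

end QSphere

end

noncomputable section

namespace QSphere

/-! ### Commutation up to scalars -/

section QComm
variable {A : Type} [Ring A] [Algebra ℂ A] {x y : A} {r : ℂ}

/-! Twisted traces. The ordered monomials `aⁱ bʲ cᵏ` (with `d⁻ⁱ` in place of `aⁱ` for `i < 0`) form
a basis of `O(SU_q(2))`: `Haar.rep` is left multiplication written in this basis, so letting it act
on the vector of `1` inverts `OSU.ofV`. Both `∂_{K²}` and `K⁻² ▷ ·` are diagonal in this basis, with
eigenvalues `q^(i+j-k)` and `q^(i-j+k)`. No nonzero integral power of `q` equals `1`, so the sphere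
is spanned by the monomials with `i + j = k`, and a `θ`-invariant functional vanishes on those with
`i ≠ 0`. Only the values at `(bc)ᵏ` remain. The trace identity for the pair `a bᵏ cᵏ⁺¹`, `d b` is a
recurrence between consecutive values (`HC0_recurrence`), so a twisted trace is determined by its
values at `1` and `bc` (`HC0_ext`). The pairs of values are `(1, 0)` for `ε` and `(1, -1/[2])` for
`h`, hence the two functionals form a basis.

The counit is a twisted trace because it is a character that `θ` preserves on the sphere. For the
Haar state, `OSU.haar_mul` establishes the modular property on all of `O(SU_q(2))` with the
automorphism `x ↦ K⁻² ▷ ∂_{K²}(x)`, which restricts to `θ` on the sphere.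

Projections. Only the two extremal rows of matrix elements occur: the one starting with `c^|N|` for
`N ≥ 0` and the one starting with `a^|N|` for `N < 0`. The rows `(a, b)` and `(c, d)` of the
fundamental matrix satisfy the same relations (`IsDoublet`), so both signs are treated at once: the
entries of the row `t` are multiples of `x^(m-k) yᵏ`, they transform under the spin representation,
and `t t* = 1` by induction on `m` with the `q`-Pascal identity. Therefore `t* t` is idempotent, and
conjugation by `K` makes it self-adjoint for the twisted involution. The adjoint action is an
algebra map (`adHom`), so its invariance is a check on generators.

Pairings. The quantum trace of `P_N` is `∑ q^(2i-|N|) tᵢ* tᵢ`. The counit kills all summands but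
one, which leaves `q^N`. Under the Haar state the modular property turns `tᵢ* tᵢ` into a multiple of
`tᵢ tᵢ*`; the power of `q` that depends on `i` cancels, `q^(-N)` is left, and `t t* = 1` finishes.
-/

theorem qcomm_pow_right (h : x * y = r • (y * x)) (n : ℕ) : x * y ^ n = r ^ n • (y ^ n * x) := by
  induction n with
  | zero => simp
  | succ n ih =>
    rw [pow_succ, ← mul_assoc, ih, smul_mul_assoc, mul_assoc, h, mul_smul_comm, smul_smul,
      ← mul_assoc, pow_succ r]

theorem qcomm_pow_left (h : x * y = r • (y * x)) (n : ℕ) : x ^ n * y = r ^ n • (y * x ^ n) := by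
  induction n with
  | zero => simp
  | succ n ih =>
    rw [pow_succ, mul_assoc, h, mul_smul_comm, ← mul_assoc, ih, smul_mul_assoc, smul_smul,
      mul_assoc, pow_succ r, mul_comm r]

theorem qcomm_symm (hr : r ≠ 0) (h : x * y = r • (y * x)) : y * x = r⁻¹ • (x * y) := by
  rw [h, smul_smul, inv_mul_cancel₀ hr, one_smul]

end QComm

/-! ### The basis of ordered monomials -/

namespace OSU
variable {q : ℝ} [hq : Fact (0 < q)]

theorem b_mul_a : (b * a : OSU q) = (q : ℂ)⁻¹ • (a * b) := qcomm_symm Uq.q_ne a_mul_b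
theorem c_mul_a : (c * a : OSU q) = (q : ℂ)⁻¹ • (a * c) := qcomm_symm Uq.q_ne a_mul_c

/-- The element `aⁱ` for `0 ≤ i` and `d⁻ⁱ` for `i < 0`. -/
def diagPow (q : ℝ) (i : ℤ) : OSU q := a ^ i.toNat * d ^ (-i).toNat

/-- The ordered monomial `aⁱ bʲ cᵏ` for `0 ≤ i` and `d⁻ⁱ bʲ cᵏ` for `i < 0`. -/
def mono (q : ℝ) (i : ℤ) (j k : ℕ) : OSU q := diagPow q i * (b ^ j * c ^ k)

theorem diagPow_natCast (n : ℕ) : diagPow q n = a ^ n := by simp [diagPow]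
theorem diagPow_neg_natCast (n : ℕ) : diagPow q (-n) = d ^ n := by simp [diagPow]

/-- The negative case is stated with `n + 1`, so that zero belongs to the first case only and a
factor `d` can always be split off in the second. -/
theorem diagPow_cases {p : ℤ → Prop} (h1 : ∀ n : ℕ, p n) (h2 : ∀ n : ℕ, p (-(n + 1 : ℕ)))
    (i : ℤ) : p i := by
  cases i with
  | ofNat n => exact h1 n
  | negSucc n => exact h2 n

theorem b_mul_diagPow (i : ℤ) : b * diagPow q i = (q : ℂ) ^ (-i) • (diagPow q i * b) := by
  induction i using diagPow_cases with
  | h1 n => rw [diagPow_natCast, qcomm_pow_right b_mul_a, zpow_neg, zpow_natCast, inv_pow]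
  | h2 n => rw [diagPow_neg_natCast, qcomm_pow_right b_mul_d, neg_neg, zpow_natCast]

theorem c_mul_diagPow (i : ℤ) : c * diagPow q i = (q : ℂ) ^ (-i) • (diagPow q i * c) := by
  induction i using diagPow_cases with
  | h1 n => rw [diagPow_natCast, qcomm_pow_right c_mul_a, zpow_neg, zpow_natCast, inv_pow]
  | h2 n => rw [diagPow_neg_natCast, qcomm_pow_right c_mul_d, neg_neg, zpow_natCast]

theorem bc_mul_diagPow (i : ℤ) :
    b * c * diagPow q i = (q : ℂ) ^ (-2 * i) • (diagPow q i * (b * c)) := by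
  rw [mul_assoc, c_mul_diagPow, mul_smul_comm, ← mul_assoc, b_mul_diagPow, smul_mul_assoc,
    smul_smul, ← zpow_add₀ Uq.q_ne, mul_assoc]
  congr 2; ring

theorem b_mul_mono (i : ℤ) (j k : ℕ) :
    b * mono q i j k = (q : ℂ) ^ (-i) • mono q i (j + 1) k := by
  rw [mono, ← mul_assoc, b_mul_diagPow, smul_mul_assoc, mono, pow_succ']
  simp only [mul_assoc]

theorem c_mul_mono (i : ℤ) (j k : ℕ) :
    c * mono q i j k = (q : ℂ) ^ (-i) • mono q i j (k + 1) := by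
  have h : Commute (c : OSU q) (b ^ j) := (show Commute (c : OSU q) b from b_mul_c.symm).pow_right j
  rw [mono, ← mul_assoc, c_mul_diagPow, smul_mul_assoc, mono, pow_succ', mul_assoc,
    ← mul_assoc c, h.eq, mul_assoc]

theorem bc_mul_bc (j k : ℕ) :
    (b * c * (b ^ j * c ^ k) : OSU q) = b ^ (j + 1) * c ^ (k + 1) := by
  have h : Commute (c : OSU q) (b ^ j) := (show Commute (c : OSU q) b from b_mul_c.symm).pow_right j
  rw [pow_succ', pow_succ', mul_assoc, ← mul_assoc c, h.eq]
  simp only [mul_assoc]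

/-- For `i < 0` the factor `a` meets a `d`, and `a d = 1 + q b c`; moving `b c` past the remaining
`dⁿ` costs `q^(2n)`. The coefficient agrees with the one in `Haar.opA`, which is what makes
`Haar.rep` the left regular representation. -/
theorem a_mul_mono (i : ℤ) (j k : ℕ) : a * mono q i j k =
    mono q (i + 1) j k + Haar.coeffA q i • mono q (i + 1) (j + 1) (k + 1) := by
  induction i using diagPow_cases with
  | h1 n =>
    rw [Haar.coeffA, if_neg (by omega), zero_smul, add_zero, mono, mono, ← mul_assoc,
      ← Nat.cast_succ, diagPow_natCast, diagPow_natCast, pow_succ']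
  | h2 n =>
    have h0 := Uq.q_ne (q := q)
    have e : (-((n + 1 : ℕ) : ℤ)) + 1 = -(n : ℤ) := by push_cast; ring
    rw [Haar.coeffA, if_pos (by omega), e]
    simp only [mono]
    rw [diagPow_neg_natCast, pow_succ', mul_assoc, ← mul_assoc a, a_mul_d,
      ← diagPow_neg_natCast, add_mul, one_mul, smul_mul_assoc, ← mul_assoc (b * c),
      bc_mul_diagPow, smul_mul_assoc, mul_assoc, bc_mul_bc, smul_smul, ← zpow_one_add₀ h0]
    congr 3; push_cast; ring

theorem d_mul_mono (i : ℤ) (j k : ℕ) : d * mono q i j k =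
    mono q (i - 1) j k + Haar.coeffD q i • mono q (i - 1) (j + 1) (k + 1) := by
  have h0 := Uq.q_ne (q := q)
  -- After the reflection `i = -i'`, the case split separates `i ≤ 0` from `i > 0`, which is where
  -- `d a` produces a correction.
  obtain ⟨i, rfl⟩ : ∃ i', i = -i' := ⟨-i, by simp⟩
  induction i using diagPow_cases with
  | h1 n =>
    rw [Haar.coeffD, if_neg (by omega), zero_smul, add_zero, mono, mono, ← mul_assoc,
      ← neg_add', ← Nat.cast_succ, diagPow_neg_natCast, diagPow_neg_natCast, pow_succ']
  | h2 n =>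
    have e : ((n + 1 : ℕ) : ℤ) - 1 = (n : ℤ) := by push_cast; ring
    rw [Haar.coeffD, if_pos (by omega), neg_neg, e]
    simp only [mono]
    rw [diagPow_natCast, pow_succ', mul_assoc, ← mul_assoc d, d_mul_a,
      ← diagPow_natCast, add_mul, one_mul, smul_mul_assoc, ← mul_assoc (b * c),
      bc_mul_diagPow, smul_mul_assoc, mul_assoc, bc_mul_bc, smul_smul, ← zpow_neg_one,
      ← zpow_add₀ h0]
    congr 3; push_cast; ring

theorem mono_mul_b (i : ℤ) (j k : ℕ) : mono q i j k * b = mono q i (j + 1) k := by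
  have h : Commute (c ^ k : OSU q) b := (show Commute (c : OSU q) b from b_mul_c.symm).pow_left k
  rw [mono, mono, mul_assoc, mul_assoc, h.eq, ← mul_assoc (b ^ j), pow_succ]

theorem mono_mul_c (i : ℤ) (j k : ℕ) : mono q i j k * c = mono q i j (k + 1) := by
  rw [mono, mono, mul_assoc, mul_assoc, pow_succ]

theorem bc_mul_a (j k : ℕ) :
    (b ^ j * c ^ k * a : OSU q) = ((q : ℂ) ^ (j + k))⁻¹ • (a * (b ^ j * c ^ k)) := by
  rw [mul_assoc, qcomm_pow_left c_mul_a, mul_smul_comm, ← mul_assoc, qcomm_pow_left b_mul_a,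
    smul_mul_assoc, smul_smul, mul_assoc, ← pow_add, add_comm, inv_pow]

theorem bc_mul_d (j k : ℕ) :
    (b ^ j * c ^ k * d : OSU q) = (q : ℂ) ^ (j + k) • (d * (b ^ j * c ^ k)) := by
  rw [mul_assoc, qcomm_pow_left c_mul_d, mul_smul_comm, ← mul_assoc, qcomm_pow_left b_mul_d,
    smul_mul_assoc, smul_smul, mul_assoc, ← pow_add, add_comm]

/-- Moving `a` to the left past `bʲ cᵏ` costs `q⁻¹` for each factor. For `i < 0` it then meets the
last `d`, and `d a = 1 + q⁻¹ b c` already stands next to `bʲ cᵏ`; hence the correction has the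
constant coefficient `q⁻¹`, unlike in left multiplication. The difference between the two sides is
what the modular property measures. -/
theorem mono_mul_a (i : ℤ) (j k : ℕ) : mono q i j k * a = ((q : ℂ) ^ (j + k))⁻¹ •
    (mono q (i + 1) j k + (if i < 0 then (q : ℂ)⁻¹ else 0) • mono q (i + 1) (j + 1) (k + 1)) := by
  rw [mono, mul_assoc, bc_mul_a, mul_smul_comm]
  congr 1
  induction i using diagPow_cases with
  | h1 n =>
    rw [if_neg (by omega), zero_smul, add_zero, mono, ← mul_assoc,
      ← Nat.cast_succ, diagPow_natCast, diagPow_natCast, pow_succ]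
  | h2 n =>
    have e : (-((n + 1 : ℕ) : ℤ)) + 1 = -(n : ℤ) := by push_cast; ring
    rw [if_pos (by omega), e]
    simp only [mono]
    rw [diagPow_neg_natCast, pow_succ, mul_assoc, ← mul_assoc d, d_mul_a,
      ← diagPow_neg_natCast, add_mul, one_mul, smul_mul_assoc, bc_mul_bc, mul_add, mul_smul_comm]

theorem mono_mul_d (i : ℤ) (j k : ℕ) : mono q i j k * d = (q : ℂ) ^ (j + k) •
    (mono q (i - 1) j k + (if 0 < i then (q : ℂ) else 0) • mono q (i - 1) (j + 1) (k + 1)) := by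
  rw [mono, mul_assoc, bc_mul_d, mul_smul_comm]
  congr 1
  obtain ⟨i, rfl⟩ : ∃ i', i = -i' := ⟨-i, by simp⟩
  induction i using diagPow_cases with
  | h1 n =>
    rw [if_neg (by omega), zero_smul, add_zero, mono, ← mul_assoc,
      ← neg_add', ← Nat.cast_succ, diagPow_neg_natCast, diagPow_neg_natCast, pow_succ]
  | h2 n =>
    have e : ((n + 1 : ℕ) : ℤ) - 1 = (n : ℤ) := by push_cast; ring
    rw [if_pos (by omega), neg_neg, e]
    simp only [mono]
    rw [diagPow_natCast, pow_succ, mul_assoc, ← mul_assoc a, a_mul_d,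
      ← diagPow_natCast, add_mul, one_mul, smul_mul_assoc, bc_mul_bc, mul_add, mul_smul_comm]

/-- The linear map that sends basis vectors to ordered monomials. -/
def ofV (q : ℝ) : Haar.V →ₗ[ℂ] OSU q := Haar.ofBasis (mono q)

@[simp] theorem ofV_e (i : ℤ) (j k : ℕ) : ofV q (Haar.e i j k) = mono q i j k :=
  Haar.ofBasis_e _ _ _ _

/-- `OSU.ofV` intertwines `Haar.rep` with left multiplication. Applied to the vector of `1`, this
gives that the ordered monomials span. -/
theorem ofV_rep (x : OSU q) (v : Haar.V) : ofV q (Haar.rep x v) = x * ofV q v := by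
  induction x using OSU.induction generalizing v with
  | hc z => simp [Module.algebraMap_end_apply, Algebra.smul_def]
  | ha x y h1 h2 => simp only [map_add, LinearMap.add_apply, h1, h2, add_mul]
  | hm x y h1 h2 => simp only [map_mul, Module.End.mul_apply, h1, h2, mul_assoc]
  | h1 =>
    suffices h : ofV q ∘ₗ Haar.rep a = LinearMap.mulLeft ℂ a ∘ₗ ofV q from LinearMap.congr_fun h v
    apply Haar.ext_e; intro i j k; simp [a_mul_mono]
  | h2 =>
    suffices h : ofV q ∘ₗ Haar.rep b = LinearMap.mulLeft ℂ b ∘ₗ ofV q from LinearMap.congr_fun h v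
    apply Haar.ext_e; intro i j k; simp [b_mul_mono]
  | h3 =>
    suffices h : ofV q ∘ₗ Haar.rep c = LinearMap.mulLeft ℂ c ∘ₗ ofV q from LinearMap.congr_fun h v
    apply Haar.ext_e; intro i j k; simp [c_mul_mono]
  | h4 =>
    suffices h : ofV q ∘ₗ Haar.rep d = LinearMap.mulLeft ℂ d ∘ₗ ofV q from LinearMap.congr_fun h v
    apply Haar.ext_e; intro i j k; simp [d_mul_mono]

theorem ofV_rep_one (x : OSU q) : ofV q (Haar.rep x (Haar.e 0 0 0)) = x := by
  rw [ofV_rep]; simp [mono, diagPow]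

/-- The linear independence of the ordered monomials: the vector of `1` is sent to distinct basis
vectors. The factors act from the right, first `c`, then `b`, then `a` or `d`, and in this order
none of the correction terms of `opA` and `opD` appears. -/
theorem rep_mono (i : ℤ) (j k : ℕ) : Haar.rep (mono q i j k) (Haar.e 0 0 0) = Haar.e i j k := by
  have hc : ∀ k, (Haar.opC q ^ k) (Haar.e 0 0 0) = Haar.e 0 0 k := Haar.opC_pow
  have hb : ∀ j k, (Haar.opB q ^ j) (Haar.e 0 0 k) = Haar.e 0 j k := by
    intro j k
    induction j with
    | zero => simp
    | succ j ih => rw [pow_succ', Module.End.mul_apply, ih]; simp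
  rw [mono, map_mul, map_mul, Module.End.mul_apply, Module.End.mul_apply, map_pow, map_pow,
    Haar.rep_b, Haar.rep_c, hc, hb]
  induction i using diagPow_cases with
  | h1 n =>
    rw [diagPow_natCast, map_pow, Haar.rep_a]
    induction n with
    | zero => simp
    | succ n ih =>
      rw [pow_succ', Module.End.mul_apply, ih, Haar.opA_e, Haar.coeffA, if_neg (by omega)]
      simp
  | h2 n =>
    rw [diagPow_neg_natCast]
    generalize n + 1 = n
    rw [map_pow, Haar.rep_d]
    induction n with
    | zero => simp
    | succ n ih =>
      rw [pow_succ', Module.End.mul_apply, ih, Haar.opD_e, Haar.coeffD, if_neg (by omega)]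
      simp [← sub_eq_neg_add]

/-- Together with `ofV_rep_one`, this makes `OSU.ofV` a linear isomorphism with inverse `x ↦
Haar.rep x (Haar.e 0 0 0)`, which reads off the coordinates of `x`. -/
theorem rep_ofV (v : Haar.V) : Haar.rep (ofV q v) (Haar.e 0 0 0) = v := by
  suffices h : LinearMap.applyₗ (Haar.e 0 0 0) ∘ₗ Haar.rep.toLinearMap ∘ₗ ofV q = LinearMap.id from
    LinearMap.congr_fun h v
  apply Haar.ext_e; intro i j k; simp [rep_mono]

theorem linearMap_ext {W : Type} [AddCommGroup W] [Module ℂ W] {f g : OSU q →ₗ[ℂ] W}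
    (h : ∀ i j k, f (mono q i j k) = g (mono q i j k)) : f = g := by
  ext x
  have : f ∘ₗ ofV q = g ∘ₗ ofV q := Haar.ext_e fun i j k => by simpa using h i j k
  rw [← ofV_rep_one x]
  exact LinearMap.congr_fun this _

theorem haar_mono (i : ℤ) (j k : ℕ) : haar q (mono q i j k) =
    if i = 0 ∧ j = k then (-1) ^ k / (qNum q (k + 1) : ℂ) else 0 := by
  rw [Haar.haar_apply, rep_mono, Haar.functional, Haar.ofBasis_e]

end OSU

/-! ### The modular property of the Haar state -/

namespace OSU
variable {q : ℝ} [hq : Fact (0 < q)]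

/-- The modular automorphism `x ↦ K⁻² ▷ ∂_{K²}(x)` of the Haar state. -/
def modular (q : ℝ) [Fact (0 < q)] : OSU q →ₐ[ℂ] OSU q := (actKi.comp actKi).comp dK2

theorem modular_apply (x : OSU q) : modular q x = actKi (actKi (dK2 x)) := rfl

@[simp] theorem modular_a : modular q a = ((q : ℂ) ^ 2) • a := by
  rw [modular_apply, dK2_a, map_smul, actKi_a, map_smul, map_smul, actKi_a, smul_smul, smul_smul,
    mul_assoc, sqrtC_sq, sq]
@[simp] theorem modular_b : modular q b = b := by
  rw [modular_apply, dK2_b, map_smul, actKi_b, map_smul, map_smul, actKi_b, smul_smul, smul_smul,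
    mul_assoc, ← mul_inv, sqrtC_sq, mul_inv_cancel₀ Uq.q_ne, one_smul]
@[simp] theorem modular_c : modular q c = c := by
  rw [modular_apply, dK2_c, map_smul, actKi_c, map_smul, map_smul, actKi_c, smul_smul, smul_smul,
    mul_assoc, sqrtC_sq, inv_mul_cancel₀ Uq.q_ne, one_smul]
@[simp] theorem modular_d : modular q d = ((q : ℂ) ^ 2)⁻¹ • d := by
  rw [modular_apply, dK2_d, map_smul, actKi_d, map_smul, map_smul, actKi_d, smul_smul, smul_smul,
    mul_assoc, ← mul_inv, sqrtC_sq, sq, mul_inv]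

variable [hq1 : Fact (q ≠ 1)]

theorem qNum_succ (n : ℕ) : (qNum q (n + 1) : ℂ) = (q : ℂ)⁻¹ * qNum q n + (q : ℂ) ^ n := by
  have h0 := Uq.q_ne (q := q)
  have h1 := OSU.q_sub_inv_ne (q := q)
  have e : ∀ j : ℕ, (qNum q j : ℂ) = ((q : ℂ) ^ j - ((q : ℂ) ^ j)⁻¹) / ((q : ℂ) - (q : ℂ)⁻¹) := by
    intro j; simp [qNum]
  rw [e, e, div_eq_iff h1, add_mul, mul_div_assoc', div_mul_cancel₀ _ h1]
  field_simp
  ring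

theorem qNum_succ' (n : ℕ) : (qNum q (n + 1) : ℂ) = (q : ℂ) * qNum q n + ((q : ℂ) ^ n)⁻¹ := by
  have h0 := Uq.q_ne (q := q)
  have h1 := OSU.q_sub_inv_ne (q := q)
  have e : ∀ j : ℕ, (qNum q j : ℂ) = ((q : ℂ) ^ j - ((q : ℂ) ^ j)⁻¹) / ((q : ℂ) - (q : ℂ)⁻¹) := by
    intro j; simp [qNum]
  rw [e, e, div_eq_iff h1, add_mul, mul_div_assoc', div_mul_cancel₀ _ h1]
  field_simp
  ring

theorem qNum_ne {n : ℕ} (hn : n ≠ 0) : (qNum q n : ℂ) ≠ 0 := by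
  exact_mod_cast (qNum_pos hn).ne'

/-- The left side is the value of `h` at `(bc)ʲ (1 + q⁻¹ bc) = (bc)ʲ d a`; in `moment_add` it is the
value at `(bc)ʲ a d`. The two values differ by the factor `q^(2(j+1))`, which accounts for the
scaling of `a` and `d` by the modular automorphism. -/
theorem moment_add_inv (j : ℕ) :
    (-1 : ℂ) ^ j / qNum q (j + 1) + (q : ℂ)⁻¹ * ((-1) ^ (j + 1) / qNum q (j + 1 + 1)) =
      (-1) ^ j * (q : ℂ) ^ (j + 1) / (qNum q (j + 1) * qNum q (j + 1 + 1)) := by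
  have h0 := Uq.q_ne (q := q)
  have h1 := qNum_ne (q := q) (n := j + 1) (by omega)
  have h2 := qNum_ne (q := q) (n := j + 1 + 1) (by omega)
  have e1 := qNum_succ (q := q) (j + 1)
  rw [pow_succ (-1 : ℂ), ← sub_eq_zero]
  field_simp
  field_simp at e1
  linear_combination (-1) ^ j * e1

theorem moment_add (j : ℕ) :
    (-1 : ℂ) ^ j / qNum q (j + 1) + (q : ℂ) * ((-1) ^ (j + 1) / qNum q (j + 1 + 1)) =
      (-1) ^ j * ((q : ℂ) ^ (j + 1))⁻¹ / (qNum q (j + 1) * qNum q (j + 1 + 1)) := by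
  have h0 := Uq.q_ne (q := q)
  have h1 := qNum_ne (q := q) (n := j + 1) (by omega)
  have h2 := qNum_ne (q := q) (n := j + 1 + 1) (by omega)
  have e1 := qNum_succ' (q := q) (j + 1)
  rw [pow_succ (-1 : ℂ), ← sub_eq_zero]
  field_simp
  field_simp at e1
  linear_combination (-1) ^ j * e1

theorem haar_mul_a (x : OSU q) : haar q (x * a) = haar q (modular q a * x) := by
  have h0 := Uq.q_ne (q := q)
  suffices h : haar q ∘ₗ LinearMap.mulRight ℂ a = haar q ∘ₗ LinearMap.mulLeft ℂ (modular q a) from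
    LinearMap.congr_fun h x
  apply linearMap_ext
  intro i j k
  simp only [LinearMap.comp_apply, LinearMap.mulRight_apply, LinearMap.mulLeft_apply, modular_a,
    smul_mul_assoc, a_mul_mono, mono_mul_a, map_smul, map_add, haar_mono, smul_eq_mul]
  -- Multiplication by `a` raises `i` by one and preserves `j - k`, and `h` sees only monomials with
  -- `i = 0` and `j = k`. All other cases read `0 = 0`.
  by_cases h : i = -1 ∧ j = k
  · obtain ⟨rfl, rfl⟩ := h
    simp [Haar.coeffA]
    rw [moment_add_inv, moment_add, pow_add, pow_succ]
    field_simp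
  · have h' : ¬ (i + 1 = 0 ∧ j = k) := by omega
    have h'' : ¬ (i + 1 = 0 ∧ j + 1 = k + 1) := by omega
    simp only [if_neg h', if_neg h'', mul_zero, add_zero]

theorem haar_mul_d (x : OSU q) : haar q (x * d) = haar q (modular q d * x) := by
  have h0 := Uq.q_ne (q := q)
  suffices h : haar q ∘ₗ LinearMap.mulRight ℂ d = haar q ∘ₗ LinearMap.mulLeft ℂ (modular q d) from
    LinearMap.congr_fun h x
  apply linearMap_ext
  intro i j k
  simp only [LinearMap.comp_apply, LinearMap.mulRight_apply, LinearMap.mulLeft_apply, modular_d,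
    smul_mul_assoc, d_mul_mono, mono_mul_d, map_smul, map_add, haar_mono, smul_eq_mul]
  by_cases h : i = 1 ∧ j = k
  · obtain ⟨rfl, rfl⟩ := h
    have e5 : Haar.coeffD q 1 = (q : ℂ)⁻¹ := by simp [Haar.coeffD]
    simp [e5]
    rw [moment_add_inv, moment_add, pow_add, pow_succ]
    field_simp
  · have h' : ¬ (i - 1 = 0 ∧ j = k) := by omega
    have h'' : ¬ (i - 1 = 0 ∧ j + 1 = k + 1) := by omega
    simp only [if_neg h', if_neg h'', mul_zero, add_zero]

/-- Left and right multiplication of a monomial by `b` differ by the factor `q^(-i)`, which is `1`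
on the monomials that `h` can see. -/
theorem haar_mul_b (x : OSU q) : haar q (x * b) = haar q (modular q b * x) := by
  suffices h : haar q ∘ₗ LinearMap.mulRight ℂ b = haar q ∘ₗ LinearMap.mulLeft ℂ (modular q b) from
    LinearMap.congr_fun h x
  apply linearMap_ext
  intro i j k
  simp only [LinearMap.comp_apply, LinearMap.mulRight_apply, LinearMap.mulLeft_apply, modular_b,
    b_mul_mono, mono_mul_b, map_smul, haar_mono, smul_eq_mul]
  by_cases h : i = 0
  · subst h; simp
  · simp [h]

theorem haar_mul_c (x : OSU q) : haar q (x * c) = haar q (modular q c * x) := by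
  suffices h : haar q ∘ₗ LinearMap.mulRight ℂ c = haar q ∘ₗ LinearMap.mulLeft ℂ (modular q c) from
    LinearMap.congr_fun h x
  apply linearMap_ext
  intro i j k
  simp only [LinearMap.comp_apply, LinearMap.mulRight_apply, LinearMap.mulLeft_apply, modular_c,
    c_mul_mono, mono_mul_c, map_smul, haar_mono, smul_eq_mul]
  by_cases h : i = 0
  · subst h; simp
  · simp [h]

/-- The Haar state is a twisted trace with respect to its modular automorphism. -/
theorem haar_mul (x y : OSU q) : haar q (x * y) = haar q (modular q y * x) := by
  induction y using OSU.induction generalizing x with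
  | hc z => rw [AlgHom.commutes, Algebra.commutes]
  | ha y z h1 h2 => rw [mul_add, map_add, h1, h2, map_add, add_mul, map_add]
  | hm y z h1 h2 => rw [← mul_assoc, h2, ← mul_assoc (modular q z), h1, map_mul (modular q),
      mul_assoc]
  | h1 => exact haar_mul_a x
  | h2 => exact haar_mul_b x
  | h3 => exact haar_mul_c x
  | h4 => exact haar_mul_d x

end OSU

/-! ### Twisted traces on the Podleś sphere -/

section
variable {q : ℝ} [hq : Fact (0 < q)]

/-- A positive real number other than `1` is not a root of unity. This separates the eigenspaces of
`∂_{K²}` and of `θ`, and it makes the recurrence for twisted traces solvable. -/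
theorem zpow_ne_one [hq1 : Fact (q ≠ 1)] {i : ℤ} (hi : i ≠ 0) : (q : ℂ) ^ i ≠ 1 := by
  intro h
  have h' : q ^ i = 1 := by exact_mod_cast h
  exact hi ((zpow_eq_one_iff_right₀ hq.out.le hq1.out).1 h')

namespace OSU

theorem map_mono (f : OSU q →ₐ[ℂ] OSU q) {r s t : ℂ} (ha : f a = r • a) (hb : f b = s • b)
    (hc : f c = t • c) (hd : f d = r⁻¹ • d) (i : ℤ) (j k : ℕ) :
    f (mono q i j k) = (r ^ i * s ^ j * t ^ k) • mono q i j k := by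
  have h : f (diagPow q i) = r ^ i • diagPow q i := by
    induction i using diagPow_cases with
    | h1 n => rw [diagPow_natCast, map_pow, ha, smul_pow, zpow_natCast]
    | h2 n => rw [diagPow_neg_natCast, map_pow, hd, smul_pow, zpow_neg, zpow_natCast, inv_pow]
  rw [mono, map_mul, map_mul, map_pow, map_pow, h, hb, hc, smul_pow, smul_pow,
    smul_mul_smul_comm, smul_mul_smul_comm, mul_assoc]

theorem dK2_mono (i : ℤ) (j k : ℕ) : dK2 (mono q i j k) =
    (q : ℂ) ^ (i + j - k) • mono q i j k := by
  have h0 := Uq.q_ne (q := q)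
  rw [map_mono dK2 dK2_a dK2_b dK2_c dK2_d, zpow_sub₀ h0, zpow_add₀ h0, zpow_natCast,
    zpow_natCast, inv_pow, div_eq_mul_inv]

theorem actKi_actKi_mono (i : ℤ) (j k : ℕ) : actKi (actKi (mono q i j k)) =
    (q : ℂ) ^ (i - j + k) • mono q i j k := by
  have h0 := Uq.q_ne (q := q)
  have h := map_mono ((actKi (q := q)).comp actKi) (r := (q : ℂ)) (s := (q : ℂ)⁻¹) (t := (q : ℂ))
    (by rw [AlgHom.comp_apply, actKi_a, map_smul, actKi_a, smul_smul, sqrtC_sq (q := q)])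
    (by rw [AlgHom.comp_apply, actKi_b, map_smul, actKi_b, smul_smul, ← mul_inv, sqrtC_sq (q := q)])
    (by rw [AlgHom.comp_apply, actKi_c, map_smul, actKi_c, smul_smul, sqrtC_sq (q := q)])
    (by rw [AlgHom.comp_apply, actKi_d, map_smul, actKi_d, smul_smul, ← mul_inv, sqrtC_sq (q := q)]) i j k
  rw [AlgHom.comp_apply] at h
  rw [h, zpow_add₀ h0, zpow_sub₀ h0, zpow_natCast, zpow_natCast, inv_pow, div_eq_mul_inv]

/-- On `a` and `d` the scalings by `K⁻² ▷ ·` and by the inverse of `∂_{K²}` cancel, and `b`, `c` are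
killed by the counit. Consequently `ε ∘ θ = ε` wherever `∂_{K²}` is trivial. -/
theorem counit_actKi_actKi (x : OSU q) : counit (actKi (actKi (dK2i x))) = counit x := by
  have h0 := Uq.q_ne (q := q)
  induction x using OSU.induction with
  | hc z => simp
  | ha x y h1 h2 => simp only [map_add, h1, h2]
  | hm x y h1 h2 => simp only [map_mul, h1, h2]
  | h1 =>
    rw [dK2i_a, map_smul, actKi_a, map_smul, map_smul, map_smul, actKi_a, map_smul, map_smul, smul_smul, smul_smul, mul_assoc,
      sqrtC_sq, inv_mul_cancel₀ h0, one_smul]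
  | h2 => simp [counit, -Complex.coe_smul]
  | h3 => simp [counit, -Complex.coe_smul]
  | h4 =>
    rw [dK2i_d, map_smul, actKi_d, map_smul, map_smul, map_smul, actKi_d, map_smul, map_smul, smul_smul, smul_smul, mul_assoc,
      ← mul_inv, sqrtC_sq, mul_inv_cancel₀ h0, one_smul]

end OSU

variable [hq1 : Fact (q ≠ 1)]

theorem theta_coe (x : podles q) : (theta q x : OSU q) = OSU.actKi (OSU.actKi x) := by
  rw [theta, actS_coe, map_mul, Module.End.mul_apply, OSU.act_Ki, OSU.act_Ki]

/-- The invariance under `l` is the twisted trace identity with first factor `1`. -/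
theorem mem_HC0_of_mul {B : Type} [Ring B] [Algebra ℂ B] {l : B → B} {φ : Module.Dual ℂ B}
    (h : ∀ x y, φ (x * y) = φ (l y * x)) : φ ∈ HC0 l :=
  ⟨fun x => by rw [← one_mul x, h, one_mul, mul_one], fun x y => sub_eq_zero.2 (h x y)⟩

/-- On the sphere `∂_{K²}` is the identity, so the modular automorphism of `h` restricts to `θ`. -/
theorem haarS_mem : haarS q ∈ HC0 (theta q) := by
  apply mem_HC0_of_mul
  intro x y
  change haar q ((x * y : podles q) : OSU q) = haar q ((theta q y * x : podles q) : OSU q)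
  rw [MulMemClass.coe_mul, MulMemClass.coe_mul, OSU.haar_mul, OSU.modular_apply,
    (mem_podles q).1 y.2, theta_coe]

theorem epsS_apply (x : podles q) : epsS q x = OSU.counit (x : OSU q) := rfl

theorem haarS_apply (x : podles q) : haarS q x = haar q (x : OSU q) := rfl

/-- The counit is a character with values in a commutative algebra, so only its invariance under `θ`
is at stake. -/
theorem epsS_mem : epsS q ∈ HC0 (theta q) := by
  apply mem_HC0_of_mul
  intro x y
  have h : OSU.dK2i (y : OSU q) = y := by
    have := OSU.dK2i_dK2 (y : OSU q)
    rwa [(mem_podles q).1 y.2] at this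
  rw [epsS_apply, epsS_apply, MulMemClass.coe_mul, MulMemClass.coe_mul, map_mul, map_mul,
    theta_coe, mul_comm]
  congr 1
  rw [← OSU.counit_actKi_actKi, h]

/-! ### The monomial basis of the Podleś sphere -/

/-- The ordered monomial with index `(i, j, k)` if it belongs to the Podleś sphere, and `0`
otherwise. -/
def monoS (q : ℝ) [Fact (0 < q)] [Fact (q ≠ 1)] (i : ℤ) (j k : ℕ) : podles q :=
  if h : i + j = k then ⟨OSU.mono q i j k, by
    rw [mem_podles, OSU.dK2_mono, h, sub_self, zpow_zero, one_smul]⟩ else 0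

theorem monoS_coe {i : ℤ} {j k : ℕ} (h : i + j = k) :
    (monoS q i j k : OSU q) = OSU.mono q i j k := by
  rw [monoS, dif_pos h]

/-- The coordinates of a fixed point of a diagonal operator vanish wherever the eigenvalue is not
`1`; the eigenvalue here is `q^(i+j-k)`. -/
theorem rep_podles_apply {x : OSU q} (hx : x ∈ podles q) {i : ℤ} {j k : ℕ} (h : i + j ≠ k) :
    Haar.rep x (Haar.e 0 0 0) (i, j, k) = 0 := by
  -- `D` is `∂_{K²}` transported to coordinates; `hD2` says so.
  let D : Haar.V →ₗ[ℂ] Haar.V := Haar.ofBasis fun i j k => (q : ℂ) ^ (i + j - k) • Haar.e i j k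
  have hD : ∀ v : Haar.V, D v (i, j, k) = (q : ℂ) ^ (i + j - k) * v (i, j, k) := by
    intro v
    suffices h : Finsupp.lapply (i, j, k) ∘ₗ D = (q : ℂ) ^ (i + j - k) • Finsupp.lapply (i, j, k)
      from LinearMap.congr_fun h v
    apply Haar.ext_e
    intro i' j' k'
    simp only [LinearMap.comp_apply, D, Haar.ofBasis_e, map_smul, LinearMap.smul_apply,
      Finsupp.lapply_apply, smul_eq_mul]
    rw [Haar.e, Finsupp.single_apply]
    split_ifs with h1
    · cases h1; rfl
    · rw [mul_zero, mul_zero]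
  have hD2 : ∀ v, OSU.dK2 (OSU.ofV q v) = OSU.ofV q (D v) := by
    intro v
    suffices h : (OSU.dK2 (q := q)).toLinearMap ∘ₗ OSU.ofV q = OSU.ofV q ∘ₗ D from LinearMap.congr_fun h v
    apply Haar.ext_e
    intro i j k
    simp [D, OSU.dK2_mono]
  set v := Haar.rep x (Haar.e 0 0 0) with hv
  have h1 : D v = v := by
    rw [← OSU.rep_ofV (q := q) (D v), ← hD2, OSU.ofV_rep_one, (mem_podles q).1 hx]
  have h2 := hD v
  rw [h1] at h2
  have h3 : (q : ℂ) ^ (i + j - k) ≠ 1 := zpow_ne_one (by omega)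
  by_contra h4
  exact h3 (mul_right_cancel₀ h4 (by rw [one_mul, ← h2]))

theorem podles_linearMap_ext {W : Type} [AddCommGroup W] [Module ℂ W] {f g : podles q →ₗ[ℂ] W}
    (h : ∀ (i : ℤ) (j k : ℕ), i + j = k → f (monoS q i j k) = g (monoS q i j k)) : f = g := by
  ext x
  have hx : x = Haar.ofBasis (monoS q) (Haar.rep (x : OSU q) (Haar.e 0 0 0)) := by
    apply Subtype.ext
    change _ = (podles q).toSubalgebra.val.toLinearMap _
    nth_rewrite 1 [← OSU.ofV_rep_one (x : OSU q)]
    simp only [OSU.ofV, Haar.ofBasis, Finsupp.linearCombination_apply, map_finsuppSum, map_smul]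
    refine Finsupp.sum_congr fun p hp => ?_
    -- On the support of the coordinates the index condition holds, so the default value `0` of
    -- `monoS` is never used.
    have h1 : p.1 + (p.2.1 : ℤ) = (p.2.2 : ℕ) := by
      by_contra h1
      exact (Finsupp.mem_support_iff.1 hp) (rep_podles_apply x.2 h1)
    exact congrArg _ (monoS_coe h1).symm
  rw [hx]
  suffices h : f ∘ₗ Haar.ofBasis (monoS q) = g ∘ₗ Haar.ofBasis (monoS q) from
    LinearMap.congr_fun h _
  apply Haar.ext_e
  intro i j k
  rw [LinearMap.comp_apply, LinearMap.comp_apply, Haar.ofBasis_e]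
  by_cases h1 : i + (j : ℤ) = (k : ℤ)
  · exact h i j k h1
  · rw [monoS, dif_neg h1, map_zero, map_zero]

/-! ### The recurrence for twisted traces -/

theorem theta_monoS {i : ℤ} {j k : ℕ} (h : i + j = k) :
    theta q (monoS q i j k) = (q : ℂ) ^ (2 * i) • monoS q i j k := by
  apply Subtype.ext
  rw [theta_coe]
  change _ = (q : ℂ) ^ (2 * i) • (monoS q i j k : OSU q)
  rw [monoS_coe h, OSU.actKi_actKi_mono]
  congr 2
  -- Here `k = i + j`, so `i - j + k = 2 i`.
  omega

/-- An invariant functional vanishes on eigenvectors whose eigenvalue, here `q^(2i)`, is not `1`. -/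
theorem HC0_apply_monoS {φ : Module.Dual ℂ (podles q)} (hφ : φ ∈ HC0 (theta q)) {i : ℤ} {j k : ℕ}
    (h : i + j = k) (hi : i ≠ 0) : φ (monoS q i j k) = 0 := by
  have h1 := hφ.1 (monoS q i j k)
  rw [theta_monoS h, map_smul, smul_eq_mul] at h1
  by_contra h4
  exact zpow_ne_one (q := q) (i := 2 * i) (by omega) (mul_right_cancel₀ h4 (by rw [one_mul, h1]))

/-- The trace identity for `x = a bᵏ cᵏ⁺¹` and `y = d b`, both in the sphere. In `x y` the factor
`d` passes `bᵏ cᵏ⁺¹` at the cost `q^(2k+1)` and `a d = 1 + q bc`; in `θ(y) x` the automorphism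
contributes `q⁻²`, moving `b` past `a` contributes `q⁻¹`, and `d a = 1 + q⁻¹ bc`. -/
theorem HC0_recurrence {φ : Module.Dual ℂ (podles q)} (hφ : φ ∈ HC0 (theta q)) (k : ℕ) :
    (q : ℂ) ^ (2 * k + 1) * (φ (monoS q 0 (k + 1) (k + 1)) +
      (q : ℂ) * φ (monoS q 0 (k + 2) (k + 2))) =
    ((q : ℂ) ^ 3)⁻¹ * (φ (monoS q 0 (k + 1) (k + 1)) +
      (q : ℂ)⁻¹ * φ (monoS q 0 (k + 2) (k + 2))) := by
  have h0 := Uq.q_ne (q := q)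
  have h1 : monoS q 1 k (k + 1) * monoS q (-1) 1 0 = (q : ℂ) ^ (2 * k + 1) •
      (monoS q 0 (k + 1) (k + 1) + (q : ℂ) • monoS q 0 (k + 2) (k + 2)) := by
    apply Subtype.ext
    change (monoS q 1 k (k + 1) : OSU q) * (monoS q (-1) 1 0 : OSU q) = (q : ℂ) ^ (2 * k + 1) •
      ((monoS q 0 (k + 1) (k + 1) : OSU q) + (q : ℂ) • (monoS q 0 (k + 2) (k + 2) : OSU q))
    rw [monoS_coe (by push_cast; ring), monoS_coe (by simp), monoS_coe (by simp),
      monoS_coe (by simp),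
      show OSU.mono q (-1) 1 0 = OSU.d * OSU.b by simp [OSU.mono, OSU.diagPow], ← mul_assoc,
      OSU.mono_mul_d, smul_mul_assoc, add_mul, smul_mul_assoc, OSU.mono_mul_b, OSU.mono_mul_b,
      if_pos one_pos, sub_self, show k + (k + 1) = 2 * k + 1 by ring]
  have h2 : theta q (monoS q (-1) 1 0) * monoS q 1 k (k + 1) = ((q : ℂ) ^ 3)⁻¹ •
      (monoS q 0 (k + 1) (k + 1) + (q : ℂ)⁻¹ • monoS q 0 (k + 2) (k + 2)) := by
    rw [theta_monoS (by simp)]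
    apply Subtype.ext
    change ((q : ℂ) ^ (2 * (-1 : ℤ)) • (monoS q (-1) 1 0 : OSU q)) * (monoS q 1 k (k + 1) : OSU q) =
      ((q : ℂ) ^ 3)⁻¹ •
      ((monoS q 0 (k + 1) (k + 1) : OSU q) + (q : ℂ)⁻¹ • (monoS q 0 (k + 2) (k + 2) : OSU q))
    have h3 : Haar.coeffD q 1 = (q : ℂ)⁻¹ := by simp [Haar.coeffD]
    have h4 : (q : ℂ) ^ (2 * (-1 : ℤ)) * (q : ℂ) ^ (-1 : ℤ) = ((q : ℂ) ^ 3)⁻¹ := by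
      rw [← zpow_add₀ h0, ← zpow_natCast, ← zpow_neg]; norm_num
    rw [monoS_coe (i := -1) (by simp), monoS_coe (i := 1) (by push_cast; ring), monoS_coe (by simp),
      monoS_coe (by simp),
      show OSU.mono q (-1) 1 0 = OSU.d * OSU.b by simp [OSU.mono, OSU.diagPow],
      smul_mul_assoc, mul_assoc, OSU.b_mul_mono, mul_smul_comm, OSU.d_mul_mono, h3, smul_smul, h4,
      sub_self]
  have h5 := sub_eq_zero.1 (hφ.2 (monoS q 1 k (k + 1)) (monoS q (-1) 1 0))
  rw [h1, h2] at h5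
  simpa only [map_smul, map_add, smul_eq_mul] using h5

/-- A twisted trace on the Podleś sphere is determined by its values at `1` and `b c`. -/
theorem HC0_ext {φ ψ : Module.Dual ℂ (podles q)} (hφ : φ ∈ HC0 (theta q)) (hψ : ψ ∈ HC0 (theta q))
    (h0 : φ (monoS q 0 0 0) = ψ (monoS q 0 0 0)) (h1 : φ (monoS q 0 1 1) = ψ (monoS q 0 1 1)) :
    φ = ψ := by
  have hq0 := Uq.q_ne (q := q)
  have key : ∀ k : ℕ, φ (monoS q 0 (k + 1) (k + 1)) = ψ (monoS q 0 (k + 1) (k + 1)) := by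
    intro k
    induction k with
    | zero => exact h1
    | succ k ih =>
      have h2 := HC0_recurrence hφ k
      have h3 := HC0_recurrence hψ k
      rw [ih] at h2
      -- The coefficient of the unknown value in the recurrence is `q^(2k+2) - q⁻⁴ = q⁻⁴ (q^(2k+6) -
      -- 1)`, which is nonzero, so the next value is determined by the previous one.
      have h4 : (q : ℂ) ^ (2 * k + 6) ≠ 1 := by
        have := zpow_ne_one (q := q) (i := (2 * k + 6 : ℕ)) (by omega)
        rwa [zpow_natCast] at this
      apply mul_left_cancel₀ (sub_ne_zero.2 h4)
      have e : ((q : ℂ) ^ (2 * k + 6) - 1) =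
          (q : ℂ) ^ 4 * ((q : ℂ) ^ (2 * k + 1) * q - ((q : ℂ) ^ 3)⁻¹ * (q : ℂ)⁻¹) := by
        field_simp
        ring
      rw [e]
      linear_combination (q : ℂ) ^ 4 * (h2 - h3)
  apply podles_linearMap_ext
  intro i j k h
  by_cases hi : i = 0
  · subst hi
    obtain rfl : j = k := by simpa using h
    rcases j with _ | j
    · exact h0
    · exact key j
  · rw [HC0_apply_monoS hφ h hi, HC0_apply_monoS hψ h hi]

/-! ### The counit and the Haar state span the twisted traces -/

theorem epsS_monoS_zero : epsS q (monoS q 0 0 0) = 1 := by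
  rw [epsS_apply, monoS_coe (by simp)]; simp [OSU.mono, OSU.diagPow]

theorem epsS_monoS_one : epsS q (monoS q 0 1 1) = 0 := by
  rw [epsS_apply, monoS_coe (by simp)]; simp [OSU.mono, OSU.diagPow, OSU.counit]

theorem haarS_monoS_zero : haarS q (monoS q 0 0 0) = 1 := by
  rw [haarS_apply, monoS_coe (by simp)]
  have := Haar.haar_one (q := q)
  simpa [OSU.mono, OSU.diagPow] using this

theorem haarS_monoS_one : haarS q (monoS q 0 1 1) ≠ 0 := by
  rw [haarS_apply, monoS_coe (by simp), OSU.haar_mono, if_pos ⟨rfl, rfl⟩]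
  exact div_ne_zero (by simp) (OSU.qNum_ne (by omega))

/-- Evaluation at `1` and at `bc` gives a triangular system, because `ε(bc) = 0` and `h(bc) ≠ 0`. -/
theorem linearIndependent_epsS_haarS : LinearIndependent ℂ
    ![(⟨epsS q, epsS_mem⟩ : HC0 (theta q)), ⟨haarS q, haarS_mem⟩] := by
  rw [LinearIndependent.pair_iff]
  intro s t h
  have h' : s • epsS q + t • haarS q = 0 := congrArg Subtype.val h
  have h0 := LinearMap.congr_fun h' (monoS q 0 0 0)
  have h1 := LinearMap.congr_fun h' (monoS q 0 1 1)
  simp only [LinearMap.add_apply, LinearMap.smul_apply, epsS_monoS_zero, epsS_monoS_one,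
    haarS_monoS_zero, smul_eq_mul, mul_zero, mul_one, zero_add, LinearMap.zero_apply] at h0 h1
  have ht : t = 0 := (mul_eq_zero.1 h1).resolve_right haarS_monoS_one
  exact ⟨by rw [ht, add_zero] at h0; exact h0, ht⟩

theorem span_epsS_haarS : Submodule.span ℂ
    {(⟨epsS q, epsS_mem⟩ : HC0 (theta q)), ⟨haarS q, haarS_mem⟩} = ⊤ := by
  rw [eq_top_iff]
  rintro ⟨φ, hφ⟩ -
  have h1 := haarS_monoS_one (q := q)
  rw [Submodule.mem_span_pair]
  -- Only `h` contributes at `bc`, which fixes its coefficient `t`; the coefficient of `ε` is then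
  -- forced by the value at `1`, where both functionals equal `1`.
  set t := φ (monoS q 0 1 1) / haarS q (monoS q 0 1 1) with ht
  refine ⟨φ (monoS q 0 0 0) - t, t, Subtype.ext ?_⟩
  change (φ (monoS q 0 0 0) - t) • epsS q + t • haarS q = φ
  refine HC0_ext ((HC0 (theta q)).add_mem ((HC0 (theta q)).smul_mem _ epsS_mem)
    ((HC0 (theta q)).smul_mem _ haarS_mem)) hφ ?_ ?_
  · simp only [LinearMap.add_apply, LinearMap.smul_apply, epsS_monoS_zero, haarS_monoS_zero,
      smul_eq_mul]
    ring
  · simp only [LinearMap.add_apply, LinearMap.smul_apply, epsS_monoS_one, smul_eq_mul]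
    rw [mul_zero, zero_add, ht, div_mul_cancel₀ _ h1]

end

/-! ### The extremal rows of the matrix elements -/

section
variable {q : ℝ} [hq : Fact (0 < q)]

/-- The pair `(x, y)` is a row of the fundamental matrix of `O(SU_q(2))`, up to the relations that
determine the action of `U_q(su₂)` on the algebra generated by `x`, `y`. -/
structure IsDoublet (x y : OSU q) : Prop where
  comm : x * y = (q : ℂ) • (y * x)
  actE_fst : OSU.actE x = y
  actE_snd : OSU.actE y = 0
  actF_fst : OSU.actF x = 0
  actF_snd : OSU.actF y = x
  actK_fst : OSU.actK x = (sqrtC q)⁻¹ • x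
  actK_snd : OSU.actK y = sqrtC q • y
  unit : x * star x + y * star y = 1

theorem isDoublet_ab : IsDoublet (OSU.a : OSU q) OSU.b where
  comm := OSU.a_mul_b
  actE_fst := OSU.actE_a
  actE_snd := OSU.actE_b
  actF_fst := OSU.actF_a
  actF_snd := OSU.actF_b
  actK_fst := OSU.actK_a
  actK_snd := OSU.actK_b
  unit := by
    rw [OSU.star_a, OSU.star_b, OSU.a_mul_d, mul_smul_comm, neg_smul]; abel

theorem isDoublet_cd : IsDoublet (OSU.c : OSU q) OSU.d where
  comm := OSU.c_mul_d
  actE_fst := OSU.actE_c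
  actE_snd := OSU.actE_d
  actF_fst := OSU.actF_c
  actF_snd := OSU.actF_d
  actK_fst := OSU.actK_c
  actK_snd := OSU.actK_d
  unit := by
    rw [OSU.star_c, OSU.star_d, OSU.d_mul_a, mul_smul_comm, neg_smul, OSU.b_mul_c]; abel

namespace IsDoublet
variable {x y : OSU q} (h : IsDoublet x y)
include h

theorem actKi_fst : OSU.actKi x = sqrtC q • x := by
  have := congrArg OSU.actKi h.actK_fst
  rw [OSU.actKi_actK, map_smul] at this
  nth_rewrite 2 [this]
  rw [smul_smul, mul_inv_cancel₀ sqrtC_ne, one_smul]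

theorem actKi_snd : OSU.actKi y = (sqrtC q)⁻¹ • y := by
  have := congrArg OSU.actKi h.actK_snd
  rw [OSU.actKi_actK, map_smul] at this
  nth_rewrite 2 [this]
  rw [smul_smul, inv_mul_cancel₀ sqrtC_ne, one_smul]

theorem snd_mul_fst_pow (n : ℕ) : y * x ^ n = ((q : ℂ) ^ n)⁻¹ • (x ^ n * y) := by
  rw [qcomm_pow_right (qcomm_symm Uq.q_ne h.comm), inv_pow]

theorem actE_snd_pow (n : ℕ) : OSU.actE (y ^ n) = 0 := by
  induction n with
  | zero => simpa using OSU.actE_algebraMap (q := q) 1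
  | succ n ih => rw [pow_succ, OSU.actE_mul, ih, h.actE_snd, zero_mul, mul_zero, add_zero]

theorem actF_fst_pow (n : ℕ) : OSU.actF (x ^ n) = 0 := by
  induction n with
  | zero => simpa using OSU.actF_algebraMap (q := q) 1
  | succ n ih => rw [pow_succ, OSU.actF_mul, ih, h.actF_fst, zero_mul, mul_zero, add_zero]

variable [hq1 : Fact (q ≠ 1)]

/-- Splitting off one factor `x`, the product rule yields `q [n+1] + q^(-(n+1))` up to a common
factor, and this is `[n+2]`. The second summand collects the weight of `K` and the cost of moving
`y` to the right. -/
theorem actE_fst_pow (n : ℕ) : OSU.actE (x ^ (n + 1)) =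
    ((sqrtC q ^ n)⁻¹ * (qNum q (n + 1) : ℂ)) • (x ^ n * y) := by
  have hs := sqrtC_ne (q := q)
  induction n with
  | zero => simp [h.actE_fst, qNum, q_sub_inv_ne']
  | succ n ih =>
    rw [pow_succ' x (n + 1), OSU.actE_mul, ih, h.actE_fst, h.actKi_fst, map_pow, h.actK_fst,
      smul_pow, mul_smul_comm, h.snd_mul_fst_pow, smul_mul_smul_comm, ← mul_assoc x (x ^ n), ← pow_succ',
      smul_smul, ← add_smul, OSU.qNum_succ' (n + 1), ← sqrtC_sq (q := q), inv_pow]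
    congr 1
    field_simp
    ring

theorem actF_snd_pow (n : ℕ) : OSU.actF (y ^ (n + 1)) =
    ((sqrtC q ^ n)⁻¹ * (qNum q (n + 1) : ℂ)) • (x * y ^ n) := by
  have hs := sqrtC_ne (q := q)
  have h1 := h.snd_mul_fst_pow 1
  rw [pow_one, pow_one] at h1
  induction n with
  | zero => simp [h.actF_snd, qNum, q_sub_inv_ne']
  | succ n ih =>
    rw [pow_succ' y (n + 1), OSU.actF_mul, ih, h.actF_snd, h.actKi_snd, map_pow, h.actK_snd,
      smul_pow, mul_smul_comm, smul_mul_smul_comm, ← mul_assoc y x, h1, smul_mul_assoc, mul_assoc x y,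
      ← pow_succ', smul_smul, ← add_smul, OSU.qNum_succ (n + 1), ← sqrtC_sq (q := q)]
    congr 1
    field_simp
    ring

theorem actE_mul_pow (n k : ℕ) : OSU.actE (x ^ (n + 1) * y ^ k) =
    ((sqrtC q ^ n)⁻¹ * (qNum q (n + 1) : ℂ) * sqrtC q ^ k) • (x ^ n * y ^ (k + 1)) := by
  rw [OSU.actE_mul, h.actE_fst_pow, h.actE_snd_pow, mul_zero, add_zero, map_pow, h.actK_snd,
    smul_pow, smul_mul_smul_comm, mul_assoc (x ^ n), pow_succ']

theorem actF_mul_pow (n k : ℕ) : OSU.actF (x ^ n * y ^ (k + 1)) =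
    (sqrtC q ^ n * ((sqrtC q ^ k)⁻¹ * (qNum q (k + 1) : ℂ))) • (x ^ (n + 1) * y ^ k) := by
  rw [OSU.actF_mul, h.actF_fst_pow, h.actF_snd_pow, zero_mul, zero_add, map_pow, h.actKi_fst,
    smul_pow, smul_mul_smul_comm, ← mul_assoc (x ^ n), pow_succ]

end IsDoublet

/-! #### The coefficients of the extremal rows -/

variable (q) in
/-- The coefficient of `x^{m-k} y^k` in the `k`-th entry of an extremal row. -/
def rowCoeff (m : ℕ) : ℕ → ℂ
  | 0 => 1
  | k + 1 => (alpha q m k : ℂ)⁻¹ * (((sqrtC q ^ (m - k - 1))⁻¹ * (qNum q (m - k) : ℂ) *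
      sqrtC q ^ k) * rowCoeff m k)

variable (q) in
/-- The square of `rowCoeff`, the product of a `q`-binomial coefficient and a power of `q`. -/
def rowWeight (m k : ℕ) : ℂ :=
  (∏ i ∈ Finset.range k, (qNum q (m - i) : ℂ)) / (∏ i ∈ Finset.range k, (qNum q (i + 1) : ℂ)) *
    (q : ℂ) ^ (-((k : ℤ) * (m - k)))

theorem conj_rowCoeff (m k : ℕ) : conj (rowCoeff q m k) = rowCoeff q m k := by
  induction k with
  | zero => simp [rowCoeff]
  | succ k ih => simp [rowCoeff, ih, conj_sqrtC]

variable [hq1 : Fact (q ≠ 1)]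

theorem alpha_ne {m k : ℕ} (h : k < m) : (alpha q m k : ℂ) ≠ 0 := by
  rw [Complex.ofReal_ne_zero]
  exact (Real.sqrt_pos.2 (mul_pos (qNum_pos (by omega)) (qNum_pos (by omega)))).ne'

/-- The ladder of the operators `E` stops at the highest weight since `[0] = 0`. -/
theorem alpha_self (m : ℕ) : alpha q m m = 0 := by simp [alpha, qNum]

theorem rowWeight_succ (m k : ℕ) : rowWeight q m (k + 1) =
    (qNum q (m - k) : ℂ) / (qNum q (k + 1)) * (q : ℂ) ^ (2 * (k : ℤ) + 1 - m) *
      rowWeight q m k := by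
  have h0 := Uq.q_ne (q := q)
  have e : -(((k + 1 : ℕ) : ℤ) * (m - (k + 1 : ℕ))) =
      (2 * (k : ℤ) + 1 - m) + -((k : ℤ) * (m - k)) := by push_cast; ring
  rw [rowWeight, rowWeight, Finset.prod_range_succ, Finset.prod_range_succ, e, zpow_add₀ h0,
    mul_div_mul_comm]
  ring

/-- Squaring removes the square roots: with `m = n + 1 + k` one has `α² = [n+1] [k+1]`, so each step
of the ladder contributes `[n+1] / [k+1]` and a power of `q`, as in the recursion of `rowWeight`. -/
theorem rowCoeff_mul_self {m k : ℕ} (hk : k ≤ m) :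
    rowCoeff q m k * rowCoeff q m k = rowWeight q m k := by
  have hs := sqrtC_ne (q := q)
  induction k with
  | zero => simp [rowCoeff, rowWeight]
  | succ k ih =>
    obtain ⟨n, rfl⟩ : ∃ n, m = n + 1 + k := ⟨m - k - 1, by omega⟩
    have h1 := alpha_ne (q := q) (m := n + 1 + k) (k := k) (by omega)
    have h2 := alpha_sq q (n + 1 + k) k
    rw [Nat.add_sub_cancel] at h2
    have h3 := OSU.qNum_ne (q := q) (n := k + 1) (by omega)
    have h4 := OSU.qNum_ne (q := q) (n := n + 1) (by omega)
    have e : (q : ℂ) ^ (2 * (k : ℤ) + 1 - (n + 1 + k : ℕ)) =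
        (sqrtC q ^ k) ^ 2 * ((sqrtC q ^ n) ^ 2)⁻¹ := by
      rw [Haar.zpow_q, show 2 * (k : ℤ) + 1 - (n + 1 + k : ℕ) = k + -n by push_cast; ring,
        zpow_add₀ hs, zpow_neg, zpow_natCast, zpow_natCast, mul_pow, inv_pow]
    rw [rowWeight_succ, ← ih (by omega), rowCoeff, Nat.add_sub_cancel, Nat.add_sub_cancel, e]
    have h5 : (alpha q (n + 1 + k) k : ℂ)⁻¹ * (alpha q (n + 1 + k) k : ℂ)⁻¹ =
        (qNum q (n + 1) : ℂ)⁻¹ * (qNum q (k + 1) : ℂ)⁻¹ := by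
      rw [← mul_inv, h2, mul_inv]
    calc _ = ((alpha q (n + 1 + k) k : ℂ)⁻¹ * (alpha q (n + 1 + k) k : ℂ)⁻¹) *
          ((sqrtC q ^ n)⁻¹ * qNum q (n + 1) * sqrtC q ^ k * rowCoeff q (n + 1 + k) k) ^ 2 := by ring
      _ = _ := by rw [h5]; field_simp

/-- The addition law of `q`-numbers, which underlies the `q`-Pascal identity. -/
theorem qNum_add (n k : ℕ) : (qNum q (n + k) : ℂ) =
    (q : ℂ) ^ k * qNum q n + ((q : ℂ) ^ n)⁻¹ * qNum q k := by
  have h0 := Uq.q_ne (q := q)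
  induction k with
  | zero => simp [qNum]
  | succ k ih =>
    rw [← add_assoc, OSU.qNum_succ', ih, OSU.qNum_succ' k]
    field_simp
    ring

/-- The `q`-Pascal identity. -/
theorem rowWeight_pascal {m k : ℕ} (hk : k ≤ m) : rowWeight q (m + 1) (k + 1) =
    rowWeight q m (k + 1) + ((q : ℂ) ^ (m - k))⁻¹ * ((q : ℂ) ^ (m - k))⁻¹ * rowWeight q m k := by
  have h0 := Uq.q_ne (q := q)
  obtain ⟨n, rfl⟩ : ∃ n, m = n + k := ⟨m - k, by omega⟩
  have h3 := OSU.qNum_ne (q := q) (n := k + 1) (by omega)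
  have e1 : (q : ℂ) ^ (-(((k + 1 : ℕ) : ℤ) * ((n + k + 1 : ℕ) - (k + 1 : ℕ)))) =
      ((q : ℂ) ^ n)⁻¹ * (q : ℂ) ^ (-((k : ℤ) * ((n + k : ℕ) - k))) := by
    rw [← zpow_natCast, ← zpow_neg, ← zpow_add₀ h0]; congr 1; push_cast; ring
  have e2 : (q : ℂ) ^ (2 * (k : ℤ) + 1 - (n + k : ℕ)) = (q : ℂ) ^ (k + 1) * ((q : ℂ) ^ n)⁻¹ := by
    rw [← zpow_natCast, ← zpow_natCast, ← zpow_neg, ← zpow_add₀ h0]; congr 1; push_cast; ring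
  rw [rowWeight_succ (n + k), Nat.add_sub_cancel, e2, rowWeight, Finset.prod_range_succ', e1,
    Finset.prod_range_succ (fun i => (qNum q (i + 1) : ℂ)), rowWeight]
  simp only [Nat.add_sub_add_right, Nat.sub_zero]
  -- With the common products and powers of `q` removed, the claim is `[n+k+1] = q^(k+1) [n] +
  -- q^(-n) [k+1]`.
  rw [add_assoc n k 1, qNum_add n (k + 1)]
  have h4 : ∏ i ∈ Finset.range k, (qNum q (i + 1) : ℂ) ≠ 0 :=
    Finset.prod_ne_zero_iff.2 fun i _ => OSU.qNum_ne (by omega)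
  field_simp

/-! #### Properties of the extremal rows -/

namespace IsDoublet
variable {x y : OSU q} (h : IsDoublet x y)
include h

/-- If `S` is the sum for `m` and `S = 1`, then `x S x* + y S y* = x x* + y y* = 1`. Moving `y` past
`x^(m-k)`, once on each side of the star, gives the factor `q^(-2(m-k))`, and the `q`-Pascal
identity collects the two contributions to each monomial into the sum for `m + 1`. -/
theorem sum_rowWeight (m : ℕ) : ∑ k ∈ Finset.range (m + 1), rowWeight q m k •
    (x ^ (m - k) * y ^ k * star (x ^ (m - k) * y ^ k)) = 1 := by
  induction m with
  | zero => simp [rowWeight]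
  | succ m ih =>
    set T : ℕ → OSU q := fun k => rowWeight q m k •
      (x ^ (m - k) * y ^ k * star (x ^ (m - k) * y ^ k)) with hT
    have h1 : ∀ k ≤ m, x * (x ^ (m - k) * y ^ k * star (x ^ (m - k) * y ^ k)) * star x =
        x ^ (m + 1 - k) * y ^ k * star (x ^ (m + 1 - k) * y ^ k) := by
      intro k hk
      rw [show m + 1 - k = m - k + 1 by omega, pow_succ' x, mul_assoc x _ (y ^ k), star_mul x]
      simp only [mul_assoc]
    have h2 : ∀ k ≤ m, y * (x ^ (m - k) * y ^ k * star (x ^ (m - k) * y ^ k)) * star y =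
        (((q : ℂ) ^ (m - k))⁻¹ * ((q : ℂ) ^ (m - k))⁻¹) •
        (x ^ (m - k) * y ^ (k + 1) * star (x ^ (m - k) * y ^ (k + 1))) := by
      intro k hk
      have h3 : y * (x ^ (m - k) * y ^ k) =
          ((q : ℂ) ^ (m - k))⁻¹ • (x ^ (m - k) * y ^ (k + 1)) := by
        rw [← mul_assoc, h.snd_mul_fst_pow, smul_mul_assoc, mul_assoc, pow_succ']
      have h4 : star ((q : ℂ) ^ (m - k))⁻¹ = ((q : ℂ) ^ (m - k))⁻¹ := by simp
      rw [← mul_assoc y, mul_assoc, ← star_mul, h3, star_smul, smul_mul_smul_comm, h4]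
    -- The index `m + 1` is out of range and its exponent of `x` is truncated; the weight vanishes
    -- there because it contains the factor `[0]`.
    have h5 : T (m + 1) = 0 := by
      have : rowWeight q m (m + 1) = 0 := by rw [rowWeight_succ]; simp [qNum]
      rw [hT]; simp only [this, zero_smul]
    have h6 : ∀ k ∈ Finset.range (m + 1), rowWeight q (m + 1) (k + 1) •
        (x ^ (m + 1 - (k + 1)) * y ^ (k + 1) * star (x ^ (m + 1 - (k + 1)) * y ^ (k + 1))) =
        x * T (k + 1) * star x + y * T k * star y := by
      intro k hk
      have hk : k ≤ m := by simpa [Nat.lt_succ_iff] using hk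
      simp only [hT]
      rw [rowWeight_pascal hk, add_smul, Nat.add_sub_add_right, mul_smul_comm _ y, smul_mul_assoc,
        h2 k hk, smul_smul, mul_comm (rowWeight q m k)]
      congr 1
      -- `h1` is available only up to index `m`; for `k = m` the term in question has weight zero.
      rcases Nat.lt_or_ge k m with h7 | h7
      · rw [mul_smul_comm, smul_mul_assoc, h1 (k + 1) h7, Nat.add_sub_add_right]
      · obtain rfl : k = m := by omega
        have : rowWeight q k (k + 1) = 0 := by rw [rowWeight_succ]; simp [qNum]
        simp [this]
    rw [Finset.sum_range_succ', Finset.sum_congr rfl h6, Finset.sum_add_distrib]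
    have h8 : rowWeight q (m + 1) 0 • (x ^ (m + 1 - 0) * y ^ 0 * star (x ^ (m + 1 - 0) * y ^ 0)) =
        x * T 0 * star x := by
      have : ∀ m, rowWeight q m 0 = 1 := by intro m; simp [rowWeight]
      simp only [hT, this, one_smul]
      rw [h1 0 (Nat.zero_le _)]
    -- The term at index `0` completes the shifted sum of the `x T x*`, and the surplus term at `m +
    -- 1` is dropped by `h5`. Both sums then reduce to the induction hypothesis.
    rw [h8, add_right_comm, ← Finset.sum_range_succ' (fun k => x * T k * star x),
      Finset.sum_range_succ, h5, mul_zero, zero_mul, add_zero, ← Finset.sum_mul, ← Finset.mul_sum,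
      ← Finset.sum_mul, ← Finset.mul_sum, ih, mul_one, mul_one, h.unit]

variable {m r : ℕ} (h0 : tmat q m r 0 = x ^ m)
include h0

/-- Each application of `E` turns one factor `x` of `x^(m-k) yᵏ` into `y`, so the entries of a row
that starts with `x^m` stay single monomials; `rowCoeff` records the accumulated scalars. -/
theorem tmat_eq {k : ℕ} (hk : k ≤ m) :
    tmat q m r k = rowCoeff q m k • (x ^ (m - k) * y ^ k) := by
  induction k with
  | zero => simp [h0, rowCoeff]
  | succ k ih =>
    obtain ⟨n, rfl⟩ : ∃ n, m = n + 1 + k := ⟨m - k - 1, by omega⟩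
    rw [tmat, ih (by omega), map_smul, OSU.act_E, Nat.add_sub_cancel, h.actE_mul_pow, rowCoeff,
      smul_smul, smul_smul, Nat.add_sub_cancel, Nat.add_sub_cancel,
      show n + 1 + k - (k + 1) = n by omega]
    congr 1
    ring

theorem actE_tmat {k : ℕ} (hk : k ≤ m) :
    OSU.actE (tmat q m r k) = (alpha q m k : ℂ) • tmat q m r (k + 1) := by
  rcases hk.lt_or_eq with hk | rfl
  · rw [tmat, OSU.act_E, smul_smul, mul_inv_cancel₀ (alpha_ne hk), one_smul]
  -- For `k = m` the entry `k + 1` does not exist and `tmat` returns a default value there, but its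
  -- coefficient is `0`, and `E` kills `y^m`.
  · rw [h.tmat_eq h0 le_rfl, alpha_self, map_smul, Nat.sub_self, pow_zero, one_mul,
      h.actE_snd_pow, smul_zero, Complex.ofReal_zero, zero_smul]

theorem actF_tmat_zero : OSU.actF (tmat q m r 0) = 0 := by rw [h0, h.actF_fst_pow]

/-- The coefficient of `F` times that of the last step of the ladder is `α⁻¹ [m-k] [k+1]`, which
equals `α` since `α² = [m-k] [k+1]`. -/
theorem actF_tmat_succ {k : ℕ} (hk : k < m) :
    OSU.actF (tmat q m r (k + 1)) = (alpha q m k : ℂ) • tmat q m r k := by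
  have hs := sqrtC_ne (q := q)
  have h1 := alpha_ne (q := q) hk
  have h2 := alpha_sq q m k
  rw [h.tmat_eq h0 hk, h.tmat_eq h0 hk.le]
  obtain ⟨n, rfl⟩ : ∃ n, m = n + 1 + k := ⟨m - k - 1, by omega⟩
  rw [Nat.add_sub_cancel] at h2
  rw [show n + 1 + k - (k + 1) = n by omega, map_smul, h.actF_mul_pow, Nat.add_sub_cancel,
    smul_smul, smul_smul, rowCoeff, Nat.add_sub_cancel, Nat.add_sub_cancel]
  congr 1
  field_simp
  linear_combination -rowCoeff q (n + 1 + k) k * h2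

theorem actK_tmat {k : ℕ} (hk : k ≤ m) :
    OSU.actK (tmat q m r k) = sqrtC q ^ (2 * (k : ℤ) - m) • tmat q m r k := by
  have hs := sqrtC_ne (q := q)
  rw [h.tmat_eq h0 hk, map_smul, map_mul, map_pow, map_pow, h.actK_fst, h.actK_snd, smul_pow,
    smul_pow, smul_mul_smul_comm, smul_comm]
  congr 1
  obtain ⟨n, rfl⟩ : ∃ n, m = n + k := ⟨m - k, by omega⟩
  rw [Nat.add_sub_cancel, inv_pow, ← zpow_natCast, ← zpow_natCast, ← zpow_neg, ← zpow_add₀ hs]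
  congr 1
  push_cast
  ring

/-- An extremal row of a unitary corepresentation has norm one. -/
theorem sum_tmat_mul_star : ∑ k : Fin (m + 1), tmat q m r k * star (tmat q m r k) = 1 := by
  rw [Fin.sum_univ_eq_sum_range (fun k => tmat q m r k * star (tmat q m r k)), ← h.sum_rowWeight m]
  refine Finset.sum_congr rfl fun k hk => ?_
  have hk : k ≤ m := by simpa [Nat.lt_succ_iff] using hk
  rw [h.tmat_eq h0 hk, star_smul, smul_mul_smul_comm, RCLike.star_def, conj_rowCoeff,
    rowCoeff_mul_self hk]

end IsDoublet

theorem qFact_ne (n : ℕ) : qFact q n ≠ 0 :=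
  Finset.prod_ne_zero_iff.2 fun _ _ => (qNum_pos (by omega)).ne'

/-- In the rows `0` and `m` the exponent `r (m - r)` vanishes and the `q`-binomial coefficient is
`1`, so the normalization disappears. -/
theorem tmat_zero_zero (m : ℕ) : tmat q m 0 0 = OSU.a ^ m := by
  have h1 := qFact_ne (q := q) m
  simp [tmat, h1, show qFact q 0 = 1 from rfl]

theorem tmat_self_zero (m : ℕ) : tmat q m m 0 = OSU.c ^ m := by
  have h1 := qFact_ne (q := q) m
  simp [tmat, h1, show qFact q 0 = 1 from rfl]

/-- The rows that occur in the projections `P_N` are given by powers of a row of the fundamental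
matrix. -/
theorem exists_isDoublet (N : ℤ) :
    ∃ x y : OSU q, IsDoublet x y ∧ tmat q N.natAbs (rowIdx N) 0 = x ^ N.natAbs := by
  unfold rowIdx
  split_ifs
  · exact ⟨_, _, isDoublet_cd, tmat_self_zero _⟩
  · exact ⟨_, _, isDoublet_ab, tmat_zero_zero _⟩

end

/-! ### The adjoint action -/

section General

variable {U B : Type} [Ring U] [HopfAlgebra ℂ U] [StarRing U] [StarModule ℂ U]
  [Ring B] [Algebra ℂ B] [StarRing B]

theorem invAntipode_mul (f g : U) : invAntipode (f * g) = invAntipode g * invAntipode f := by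
  simp [invAntipode, HopfAlgebra.antipode_mul_antidistrib]

theorem invAntipode_one : invAntipode (1 : U) = 1 := by
  simp [invAntipode]

theorem scalarMat_mul {l m n : ℕ} (X : Matrix (Fin l) (Fin m) ℂ) (Y : Matrix (Fin m) (Fin n) ℂ) :
    scalarMat B (X * Y) = scalarMat B X * scalarMat B Y :=
  Matrix.map_mul (f := algebraMap ℂ B)

theorem scalarMat_one {n : ℕ} : scalarMat B (1 : Matrix (Fin n) (Fin n) ℂ) = 1 :=
  Matrix.map_one (algebraMap ℂ B) (map_zero _) (map_one _)

theorem scalarMat_apply {m n : ℕ} (X : Matrix (Fin m) (Fin n) ℂ) (i : Fin m) (j : Fin n) :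
    scalarMat B X i j = algebraMap ℂ B (X i j) := rfl

theorem scalarMat_mul_apply {l m n : ℕ} (X : Matrix (Fin l) (Fin m) ℂ)
    (Y : Matrix (Fin m) (Fin n) B) (i : Fin l) (j : Fin n) :
    (scalarMat B X * Y) i j = ∑ k, X i k • Y k j := by
  simp [Matrix.mul_apply, scalarMat_apply, Algebra.smul_def]

theorem mul_scalarMat_apply {l m n : ℕ} (X : Matrix (Fin l) (Fin m) B)
    (Y : Matrix (Fin m) (Fin n) ℂ) (i : Fin l) (j : Fin n) :
    (X * scalarMat B Y) i j = ∑ k, Y k j • X i k := by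
  simp [Matrix.mul_apply, scalarMat_apply, Algebra.smul_def, Algebra.commutes]

theorem map_scalarMat_mul {l m n : ℕ} (T : Module.End ℂ B) (X : Matrix (Fin l) (Fin m) ℂ)
    (Y : Matrix (Fin m) (Fin n) B) : (scalarMat B X * Y).map T = scalarMat B X * Y.map T := by
  ext i j
  simp [scalarMat_mul_apply]

theorem map_mul_scalarMat {l m n : ℕ} (T : Module.End ℂ B) (X : Matrix (Fin l) (Fin m) B)
    (Y : Matrix (Fin m) (Fin n) ℂ) : (X * scalarMat B Y).map T = X.map T * scalarMat B Y := by
  ext i j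
  simp [mul_scalarMat_apply]

variable {n : ℕ} (act : U →ₐ[ℂ] Module.End ℂ B) (ρ : U →ₐ[ℂ] (Matrix (Fin n) (Fin n) ℂ)ᵐᵒᵖ)

theorem repLin_mul (f g : U) : repLin ρ (f * g) = repLin ρ g * repLin ρ f := by
  simp [repLin]

theorem repLin_one : repLin ρ (1 : U) = 1 := by simp [repLin]

/-- Left multiplication by `ρ(S⁻¹(f))`. -/
def adLeft : U →ₐ[ℂ] Module.End ℂ (Matrix (Fin n) (Fin n) B) :=
  AlgHom.ofLinearMap
    (LinearMap.mul ℂ (Matrix (Fin n) (Fin n) B) ∘ₗ scalarMat B ∘ₗ repLin ρ ∘ₗ invAntipode)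
    (by ext1 X; simp [invAntipode_one, repLin_one, scalarMat_one])
    (by
      -- Both `S⁻¹` and `ρ` reverse products, so their composite preserves them.
      intro f g; ext1 X
      simp only [LinearMap.comp_apply, LinearMap.mul_apply', Module.End.mul_apply,
        invAntipode_mul, repLin_mul, scalarMat_mul, mul_assoc])

/-- The entrywise action of `S⁻²(f)`. -/
def adMid : U →ₐ[ℂ] Module.End ℂ (Matrix (Fin n) (Fin n) B) :=
  AlgHom.ofLinearMap
    { toFun := fun f => (act (invAntipode (invAntipode f))).mapMatrix
      map_add' := fun f g => by ext; simp
      map_smul' := fun c f => by ext; simp }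
    (by ext; simp [invAntipode_one])
    (by intro f g; ext; simp [invAntipode_mul])

/-- Right multiplication by `ρ(f)`. -/
def adRight : U →ₐ[ℂ] Module.End ℂ (Matrix (Fin n) (Fin n) B) :=
  AlgHom.ofLinearMap
    ((LinearMap.mul ℂ (Matrix (Fin n) (Fin n) B)).flip ∘ₗ scalarMat B ∘ₗ repLin ρ)
    (by ext1 X; simp [repLin_one, scalarMat_one])
    (by
      -- The reversal by `ρ` is undone by the reversal in right multiplication.
      intro f g; ext1 X
      simp only [LinearMap.comp_apply, LinearMap.flip_apply, LinearMap.mul_apply',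
        Module.End.mul_apply, repLin_mul, scalarMat_mul, mul_assoc])

theorem adLeft_apply (f : U) (X : Matrix (Fin n) (Fin n) B) :
    adLeft ρ f X = scalarMat B (repLin ρ (invAntipode f)) * X := rfl

theorem adMid_apply (f : U) (X : Matrix (Fin n) (Fin n) B) :
    adMid act f X = X.map (act (invAntipode (invAntipode f))) := rfl

theorem adRight_apply (f : U) (X : Matrix (Fin n) (Fin n) B) :
    adRight ρ f X = X * scalarMat B (repLin ρ f) := rfl

/-- The map `f ⊗ g ↦ (X ↦ (S⁻²(f) ▷ X) ρ(g))`. -/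
def adMidRight : U ⊗[ℂ] U →ₐ[ℂ] Module.End ℂ (Matrix (Fin n) (Fin n) B) :=
  Algebra.TensorProduct.lift (adMid act) (adRight ρ) fun f g => by
    refine LinearMap.ext fun X => ?_
    simp only [Module.End.mul_apply, adMid_apply, adRight_apply, map_mul_scalarMat]

theorem adMidRight_tmul (u v : U) :
    adMidRight act ρ (u ⊗ₜ v) = adMid act u * adRight ρ v :=
  Algebra.TensorProduct.lift_tmul _ _ _ _ _

/-- Multiplication by scalar matrices from the left commutes with the entrywise action, which is
linear, and with multiplication from the right. The commutation allows the three factors to be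
assembled into an algebra map on the tensor product. -/
theorem adLeft_comm (f : U) (w : U ⊗[ℂ] U) :
    Commute (adLeft (B := B) ρ f) (adMidRight act ρ w) := by
  induction w using TensorProduct.induction_on with
  | zero => rw [map_zero]; exact Commute.zero_right _
  | add u v h1 h2 => rw [map_add]; exact h1.add_right h2
  | tmul u v =>
    refine LinearMap.ext fun X => ?_
    simp only [adMidRight_tmul, Module.End.mul_apply, adMid_apply,
      adRight_apply, adLeft_apply, map_mul_scalarMat, map_scalarMat_mul, mul_assoc]

/-- The map `f ⊗ g ↦ (X ↦ ρ(S⁻¹(f)) (S⁻²(g₍₁₎) ▷ X) ρ(g₍₂₎))`. -/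
def adTensor : U ⊗[ℂ] U →ₐ[ℂ] Module.End ℂ (Matrix (Fin n) (Fin n) B) :=
  Algebra.TensorProduct.lift (adLeft ρ) ((adMidRight act ρ).comp (Bialgebra.comulAlgHom ℂ U))
    fun f _ => adLeft_comm act ρ f _

theorem adTensor_tmul (u v : U) :
    adTensor act ρ (u ⊗ₜ v) = adLeft ρ u * adMidRight act ρ (Coalgebra.comul v) :=
  Algebra.TensorProduct.lift_tmul _ _ _ _ _

/-- The adjoint action as an algebra map. -/
def adHom : U →ₐ[ℂ] Module.End ℂ (Matrix (Fin n) (Fin n) B) :=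
  (adTensor act ρ).comp (Bialgebra.comulAlgHom ℂ U)

/-- This identifies the adjoint action with a composite of algebra maps. Hence invariance of a
matrix passes from two elements of `U` to their product, and it suffices to check it on generators.
-/
theorem adHom_apply (f : U) (X : Matrix (Fin n) (Fin n) B) :
    adHom act ρ f X = adR act ρ X f := by
  have h1 : ∀ w, adMidRight act ρ w X = LinearMap.mul' ℂ _ (TensorProduct.map
      (actMat act X ∘ₗ invAntipode ∘ₗ invAntipode) (scalarMat B ∘ₗ repLin ρ) w) := by
    intro w
    induction w using TensorProduct.induction_on with
    | zero => simp
    | add u v h1 h2 => simp only [map_add, LinearMap.add_apply, h1, h2]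
    | tmul u v =>
      simp only [adMidRight_tmul, Module.End.mul_apply, adMid_apply,
        adRight_apply, map_mul_scalarMat]
      rfl
  have h2 : ∀ w, adTensor act ρ w X = LinearMap.mul' ℂ _ (TensorProduct.map
      (scalarMat B ∘ₗ repLin ρ ∘ₗ invAntipode)
      (conv (actMat act X ∘ₗ invAntipode ∘ₗ invAntipode) (scalarMat B ∘ₗ repLin ρ)) w) := by
    intro w
    induction w using TensorProduct.induction_on with
    | zero => simp
    | add u v h1 h2 => simp only [map_add, LinearMap.add_apply, h1, h2]
    | tmul u v =>
      rw [adTensor_tmul, Module.End.mul_apply, h1, adLeft_apply]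
      rfl
  exact h2 _

end General

/-! ### Invariance of the projections -/

section
variable {q : ℝ} [hq : Fact (0 < q)]

section conv
variable {A : Type} [Ring A] [Algebra ℂ A] (L M : Uq q →ₗ[ℂ] A)

theorem conv_E : conv L M Uq.E = L Uq.E * M Uq.K + L Uq.Ki * M Uq.E := by
  simp [conv, Uq.comul_eq, Uq.comulHom]
theorem conv_F : conv L M Uq.F = L Uq.F * M Uq.K + L Uq.Ki * M Uq.F := by
  simp [conv, Uq.comul_eq, Uq.comulHom]
theorem conv_K : conv L M Uq.K = L Uq.K * M Uq.K := by
  simp [conv, Uq.comul_eq, Uq.comulHom]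
theorem conv_Ki : conv L M Uq.Ki = L Uq.Ki * M Uq.Ki := by
  simp [conv, Uq.comul_eq, Uq.comulHom]

end conv

theorem invAntipode_E : invAntipode (Uq.E : Uq q) = -(q : ℂ)⁻¹ • Uq.E := by
  simp [invAntipode, Uq.antipode_eq, star_smul, -Complex.coe_smul]
theorem invAntipode_F : invAntipode (Uq.F : Uq q) = -(q : ℂ) • Uq.F := by
  simp [invAntipode, Uq.antipode_eq, star_smul, -Complex.coe_smul]
theorem invAntipode_K : invAntipode (Uq.K : Uq q) = Uq.Ki := by
  simp [invAntipode, Uq.antipode_eq]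
theorem invAntipode_Ki : invAntipode (Uq.Ki : Uq q) = Uq.K := by
  simp [invAntipode, Uq.antipode_eq]

variable [hq1 : Fact (q ≠ 1)]

section rho
variable (m : ℕ)

/-- The conjugation by `K` in the definition of `ρ` cancels the factor `q` of the antipode. `E` and
`F` then carry the same sign and no power of `q`, which is why `ρ` is compatible with the
involutions. -/
theorem repLin_rho_E : repLin (rho q m) Uq.E = -sigma q m Uq.E := by
  have h : (Uq.E * Uq.K : Uq q) = (q : ℂ)⁻¹ • (Uq.K * Uq.E) := qcomm_symm Uq.q_ne Uq.K_mul_E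
  rw [repLin_rho, Uq.antipode_eq, Uq.antipodeLin_E, mul_smul_comm, smul_mul_assoc, mul_assoc, h,
    mul_smul_comm, ← mul_assoc, Uq.Ki_mul_K, one_mul, smul_smul, neg_mul,
    mul_inv_cancel₀ Uq.q_ne, neg_one_smul, map_neg]

theorem repLin_rho_F : repLin (rho q m) Uq.F = -sigma q m Uq.F := by
  rw [repLin_rho, Uq.antipode_eq, Uq.antipodeLin_F, mul_smul_comm, smul_mul_assoc, mul_assoc,
    Uq.F_mul_K, mul_smul_comm, ← mul_assoc, Uq.Ki_mul_K, one_mul, smul_smul, neg_mul,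
    inv_mul_cancel₀ Uq.q_ne, neg_one_smul, map_neg]

theorem repLin_rho_K : repLin (rho q m) Uq.K = sigma q m Uq.Ki := by
  rw [repLin_rho, Uq.antipode_eq, Uq.antipodeLin_K, mul_assoc, Uq.Ki_mul_K, mul_one]

theorem repLin_rho_Ki : repLin (rho q m) Uq.Ki = sigma q m Uq.K := by
  rw [repLin_rho, Uq.antipode_eq, Uq.antipodeLin_Ki, Uq.Ki_mul_K, one_mul]

theorem sigma_E : sigma q m Uq.E = sigmaE q m := by simp [sigma]
theorem sigma_F : sigma q m Uq.F = sigmaF q m := by simp [sigma]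
theorem sigma_K : sigma q m Uq.K = sigmaK q m := by simp [sigma]
theorem sigma_Ki : sigma q m Uq.Ki = sigmaKi q m := by simp [sigma]

theorem sigmaE_conjTranspose : (sigmaE q m).conjTranspose = sigmaF q m := by
  ext i k
  simp only [Matrix.conjTranspose_apply, sigmaE, sigmaF]
  by_cases h : (k : ℕ) = i + 1
  · rw [if_pos h, if_pos h.symm]; simp
  · rw [if_neg h, if_neg (Ne.symm h)]; simp

theorem sigmaF_conjTranspose : (sigmaF q m).conjTranspose = sigmaE q m := by
  rw [← sigmaE_conjTranspose, Matrix.conjTranspose_conjTranspose]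

theorem sigmaK_conjTranspose : (sigmaK q m).conjTranspose = sigmaK q m := by
  rw [sigmaK, Matrix.diagonal_conjTranspose]
  congr 1; funext k
  simp [conj_sqrtC]

theorem sigmaKi_conjTranspose : (sigmaKi q m).conjTranspose = sigmaKi q m := by
  rw [sigmaKi, Matrix.diagonal_conjTranspose]
  congr 1; funext k
  simp [conj_sqrtC]

theorem repLin_rho_star (f : Uq q) :
    repLin (rho q m) (star f) = (repLin (rho q m) f).conjTranspose := by
  induction f using Uq.induction with
  | hc z =>
    rw [← algebraMap_star_comm, Algebra.algebraMap_eq_smul_one, Algebra.algebraMap_eq_smul_one,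
      map_smul, map_smul, repLin_one, Matrix.conjTranspose_smul, Matrix.conjTranspose_one]
  | hE =>
    rw [Uq.star_E, repLin_rho_F, repLin_rho_E, Matrix.conjTranspose_neg, sigma_E, sigma_F,
      sigmaE_conjTranspose]
  | hF =>
    rw [Uq.star_F, repLin_rho_F, repLin_rho_E, Matrix.conjTranspose_neg, sigma_E, sigma_F,
      sigmaF_conjTranspose]
  | hK => rw [Uq.star_K, repLin_rho_K, sigma_Ki, sigmaKi_conjTranspose]
  | hKi => rw [Uq.star_Ki, repLin_rho_Ki, sigma_K, sigmaK_conjTranspose]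
  | ha f g h1 h2 => rw [star_add, map_add, map_add, h1, h2, Matrix.conjTranspose_add]
  | hm f g h1 h2 => rw [star_mul, repLin_mul, repLin_mul, h1, h2, Matrix.conjTranspose_mul]

end rho

variable (q) in
/-- The spin representation as an algebra map to matrices over the Podleś sphere. -/
def sigmaS (m : ℕ) : Uq q →ₐ[ℂ] Matrix (Fin (m + 1)) (Fin (m + 1)) (podles q) :=
  (Algebra.ofId ℂ (podles q)).mapMatrix.comp (sigma q m)

theorem scalarMat_sigma (m : ℕ) (f : Uq q) :
    scalarMat (podles q) (sigma q m f) = sigmaS q m f := rfl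

/-- If the entrywise action of the generators on `Y` is implemented by the spin representation
as on the matrix `t* t`, then `σ(K) Y σ(K⁻¹)` is invariant. -/
theorem adR_eq_counit_smul {m : ℕ} {Y : Matrix (Fin (m + 1)) (Fin (m + 1)) (podles q)}
    (hE : Y.map (actS q Uq.E) = -(q : ℂ) • (sigmaS q m Uq.E * Y * sigmaS q m Uq.K) +
      sigmaS q m Uq.K * Y * sigmaS q m Uq.E)
    (hF : Y.map (actS q Uq.F) = -(q : ℂ)⁻¹ • (sigmaS q m Uq.F * Y * sigmaS q m Uq.K) +
      sigmaS q m Uq.K * Y * sigmaS q m Uq.F)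
    (hK : Y.map (actS q Uq.K) = sigmaS q m Uq.Ki * Y * sigmaS q m Uq.K)
    (hKi : Y.map (actS q Uq.Ki) = sigmaS q m Uq.K * Y * sigmaS q m Uq.Ki) (f : Uq q) :
    adR (actS q) (rho q m) (sigmaS q m Uq.K * Y * sigmaS q m Uq.Ki) f =
      Coalgebra.counit (R := ℂ) f • (sigmaS q m Uq.K * Y * sigmaS q m Uq.Ki) := by
  have h0 := Uq.q_ne (q := q)
  have k1 : ∀ X : Matrix (Fin (m + 1)) (Fin (m + 1)) (podles q),
      sigmaS q m Uq.K * (sigmaS q m Uq.Ki * X) = X := by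
    intro X; rw [← mul_assoc, ← map_mul, Uq.K_mul_Ki, map_one, one_mul]
  have k2 : ∀ X : Matrix (Fin (m + 1)) (Fin (m + 1)) (podles q),
      sigmaS q m Uq.Ki * (sigmaS q m Uq.K * X) = X := by
    intro X; rw [← mul_assoc, ← map_mul, Uq.Ki_mul_K, map_one, one_mul]
  have k3 : sigmaS q m Uq.K * sigmaS q m Uq.Ki = 1 := by rw [← map_mul, Uq.K_mul_Ki, map_one]
  have k4 : sigmaS q m Uq.Ki * sigmaS q m Uq.K = 1 := by rw [← map_mul, Uq.Ki_mul_K, map_one]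
  have e1 : sigmaS q m Uq.E * sigmaS q m Uq.Ki =
      (q : ℂ) • (sigmaS q m Uq.Ki * sigmaS q m Uq.E) := by
    rw [← map_mul, ← map_mul, Uq.E_mul_Ki, map_smul]
  have e2 : ∀ X : Matrix (Fin (m + 1)) (Fin (m + 1)) (podles q),
      sigmaS q m Uq.E * (sigmaS q m Uq.Ki * X) =
      (q : ℂ) • (sigmaS q m Uq.Ki * (sigmaS q m Uq.E * X)) := by
    intro X; rw [← mul_assoc, e1, smul_mul_assoc, mul_assoc]
  have f1 : sigmaS q m Uq.Ki * sigmaS q m Uq.F =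
      (q : ℂ) • (sigmaS q m Uq.F * sigmaS q m Uq.Ki) := by
    rw [← map_mul, ← map_mul, Uq.Ki_mul_F, map_smul]
  have f2 : ∀ X : Matrix (Fin (m + 1)) (Fin (m + 1)) (podles q),
      sigmaS q m Uq.Ki * (sigmaS q m Uq.F * X) =
      (q : ℂ) • (sigmaS q m Uq.F * (sigmaS q m Uq.Ki * X)) := by
    intro X; rw [← mul_assoc, f1, smul_mul_assoc, mul_assoc]
  have hmap : ∀ g : Uq q, (sigmaS q m Uq.K * Y * sigmaS q m Uq.Ki).map (actS q g) =
      sigmaS q m Uq.K * Y.map (actS q g) * sigmaS q m Uq.Ki := by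
    intro g
    rw [← scalarMat_sigma, ← scalarMat_sigma, map_mul_scalarMat, map_scalarMat_mul]
  obtain ⟨P, hP⟩ : ∃ P, P = sigmaS q m Uq.K * Y * sigmaS q m Uq.Ki := ⟨_, rfl⟩
  rw [← hP] at hmap ⊢
  have hact : ∀ g : Uq q, actMat (actS q) P g =
      sigmaS q m Uq.K * Y.map (actS q g) * sigmaS q m Uq.Ki := hmap
  rw [Uq.counit_eq]
  induction f using Uq.induction with
  | hc z =>
    rw [← adHom_apply, AlgHom.commutes, AlgHom.commutes, Module.algebraMap_end_apply]
    rfl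
  | hE =>
    -- The iterated coproduct of `E` has three terms, with `E` in the first, second or third factor.
    -- By `hE` the second term splits into one with `σ(E)` to the left of `Y` and one with `σ(E)` to
    -- the right; these cancel the first and the third. The computation for `F` is the same.
    simp only [adR, conv_E, conv_K, LinearMap.comp_apply, invAntipode_E, invAntipode_K,
      invAntipode_Ki, map_smul, map_neg, repLin_rho_E, repLin_rho_K, repLin_rho_Ki,
      scalarMat_sigma, Uq.counitHom, Uq.lift_E, zero_smul]
    simp only [hact, hE, hK, hKi]
    simp only [mul_assoc, smul_mul_assoc, mul_smul_comm, mul_add, add_mul, k1, k2, k3, k4, e1, e2,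
      neg_mul, mul_neg, smul_neg, smul_add, smul_smul, mul_one, neg_smul]
    match_scalars <;> field_simp <;> ring
  | hF =>
    simp only [adR, conv_F, conv_K, LinearMap.comp_apply, invAntipode_F, invAntipode_K,
      invAntipode_Ki, map_smul, map_neg, repLin_rho_F, repLin_rho_K, repLin_rho_Ki,
      scalarMat_sigma, Uq.counitHom, Uq.lift_F, zero_smul]
    simp only [hact, hF, hK, hKi]
    simp only [mul_assoc, smul_mul_assoc, mul_smul_comm, mul_add, add_mul, k1, k2, k3, k4, f1, f2,
      neg_mul, mul_neg, smul_neg, smul_add, smul_smul, mul_one, neg_smul]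
    match_scalars <;> field_simp <;> ring
  | hK =>
    simp only [adR, conv_K, LinearMap.comp_apply, invAntipode_K, invAntipode_Ki, repLin_rho_K,
      repLin_rho_Ki, hact, hK, scalarMat_sigma, Uq.counitHom, Uq.lift_K, one_smul]
    simp only [mul_assoc, k1, k2, k3, k4, mul_one, hP]
  | hKi =>
    simp only [adR, conv_Ki, LinearMap.comp_apply, invAntipode_K, invAntipode_Ki, repLin_rho_K,
      repLin_rho_Ki, hact, hKi, scalarMat_sigma, Uq.counitHom, Uq.lift_Ki, one_smul]
    simp only [mul_assoc, k1, k2, k3, k4, mul_one, hP]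
  | ha f g h1 h2 => rw [map_add, map_add, h1, h2, add_smul]
  | hm f g h1 h2 =>
    -- Multiplicativity of the adjoint action is visible only for `adHom`.
    rw [← adHom_apply] at h1 h2 ⊢
    rw [map_mul, Module.End.mul_apply, h2, map_smul, h1, map_mul, smul_smul, mul_comm]

end

/-! ### The projections and their pairings -/

section
variable {q : ℝ} [hq : Fact (0 < q)] [hq1 : Fact (q ≠ 1)]

namespace IsDoublet
variable {x y : OSU q} (h : IsDoublet x y) {m r : ℕ} (h0 : tmat q m r 0 = x ^ m)
include h h0

/-- The entries of an extremal row transform like the basis of the spin representation. In this form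
the action on entries can be traded for multiplication by scalar matrices. -/
theorem actE_tmat_eq_sum (j : Fin (m + 1)) :
    OSU.actE (tmat q m r j) = ∑ k, sigmaE q m k j • tmat q m r k := by
  rw [h.actE_tmat h0 (by omega)]
  simp only [sigmaE]
  rcases (show (j : ℕ) = m ∨ (j : ℕ) < m by omega) with hj | hj
  · rw [hj, alpha_self, Complex.ofReal_zero, zero_smul]
    exact (Finset.sum_eq_zero fun k _ => by rw [if_neg (by omega), zero_smul]).symm
  · rw [Finset.sum_eq_single (⟨j + 1, by omega⟩ : Fin (m + 1)), if_pos rfl]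
    · intro k _ hk
      rw [if_neg fun hk' => hk (Fin.ext hk'), zero_smul]
    · simp

theorem actF_tmat_eq_sum (j : Fin (m + 1)) :
    OSU.actF (tmat q m r j) = ∑ k, sigmaF q m k j • tmat q m r k := by
  simp only [sigmaF]
  obtain ⟨j, hj⟩ := j
  rcases j with _ | j
  · rw [h.actF_tmat_zero h0]
    exact (Finset.sum_eq_zero fun k _ => by rw [if_neg (by simp), zero_smul]).symm
  · rw [h.actF_tmat_succ h0 (by omega), Finset.sum_eq_single (⟨j, by omega⟩ : Fin (m + 1)),
      if_pos rfl]
    · intro k _ hk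
      rw [if_neg fun hk' => hk (Fin.ext (Nat.succ.inj hk')), zero_smul]
    · simp

theorem actK_tmat_eq_sum (j : Fin (m + 1)) :
    OSU.actK (tmat q m r j) = ∑ k, sigmaK q m k j • tmat q m r k := by
  rw [h.actK_tmat h0 (by omega), Finset.sum_eq_single j]
  · rw [sigmaK, Matrix.diagonal_apply_eq]
  · intro k _ hk
    rw [sigmaK, Matrix.diagonal_apply_ne _ hk, zero_smul]
  · simp

theorem actKi_tmat {k : ℕ} (hk : k ≤ m) :
    OSU.actKi (tmat q m r k) = sqrtC q ^ (-(2 * (k : ℤ) - m)) • tmat q m r k := by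
  have hs := sqrtC_ne (q := q)
  have := congrArg OSU.actKi (h.actK_tmat h0 hk)
  rw [OSU.actKi_actK, map_smul] at this
  nth_rewrite 2 [this]
  rw [smul_smul, ← zpow_add₀ hs, neg_add_cancel, zpow_zero, one_smul]

theorem actKi_tmat_eq_sum (j : Fin (m + 1)) :
    OSU.actKi (tmat q m r j) = ∑ k, sigmaKi q m k j • tmat q m r k := by
  rw [h.actKi_tmat h0 (by omega), Finset.sum_eq_single j]
  · rw [sigmaKi, Matrix.diagonal_apply_eq]
  · intro k _ hk
    rw [sigmaKi, Matrix.diagonal_apply_ne _ hk, zero_smul]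
  · simp

end IsDoublet

theorem OSU.actE_star (x : OSU q) : actE (star x) = -(q : ℂ) • star (actF x) := by
  rw [star_actF, smul_smul, neg_mul_neg, mul_inv_cancel₀ Uq.q_ne, one_smul]

theorem OSU.actF_star (x : OSU q) : actF (star x) = -(q : ℂ)⁻¹ • star (actE x) := by
  rw [star_actE, smul_smul, neg_mul_neg, inv_mul_cancel₀ Uq.q_ne, one_smul]

theorem star_sum_smul {m : ℕ} (M : Matrix (Fin (m + 1)) (Fin (m + 1)) ℂ) (t : Fin (m + 1) → OSU q)
    (i : Fin (m + 1)) :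
    star (∑ k, M k i • t k) = ∑ k, M.conjTranspose i k • star (t k) := by
  rw [star_sum]
  exact Finset.sum_congr rfl fun k _ => by rw [star_smul, Matrix.conjTranspose_apply]

theorem OSU.counit_star (x : OSU q) : counit (star x) = conj (counit x) := by
  induction x using OSU.induction with
  | hc z => rw [← algebraMap_star_comm, AlgHom.commutes, AlgHom.commutes]; rfl
  | ha x y h1 h2 => rw [star_add, map_add, map_add, map_add, h1, h2]
  | hm x y h1 h2 => rw [star_mul, map_mul, map_mul, map_mul, h1, h2, mul_comm]
  | h1 => simp [counit]
  | h2 => simp [counit, -Complex.coe_smul]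
  | h3 => simp [counit, -Complex.coe_smul]
  | h4 => simp [counit]

/-- The matrix `t* t`, where `t` is the row vector of the matrix elements. -/
abbrev tMat (q : ℝ) [Fact (0 < q)] [Fact (q ≠ 1)] (N : ℤ) :
    Matrix (Fin (N.natAbs + 1)) (Fin (N.natAbs + 1)) (podles q) := Matrix.of (tEntry q N)

theorem tMat_coe (N : ℤ) (i j : Fin (N.natAbs + 1)) : (tMat q N i j : OSU q) =
    star (tmat q N.natAbs (rowIdx N) i) * tmat q N.natAbs (rowIdx N) j := rfl

/-- The matrix `t* t` has rank one, so `X (t* t) Y` is the column `X t*` times the row `t Y`. -/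
theorem coe_mul_tMat_mul (N : ℤ) (X Y : Matrix (Fin (N.natAbs + 1)) (Fin (N.natAbs + 1)) ℂ)
    (i j : Fin (N.natAbs + 1)) :
    ((scalarMat (podles q) X * tMat q N * scalarMat (podles q) Y) i j : OSU q) =
      (∑ k, X i k • star (tmat q N.natAbs (rowIdx N) k)) *
        ∑ l, Y l j • tmat q N.natAbs (rowIdx N) l := by
  change (podles q).toSubalgebra.val.toLinearMap _ = _
  simp only [mul_scalarMat_apply, scalarMat_mul_apply, map_sum, map_smul, Finset.smul_sum,
    Finset.sum_mul_sum]
  rw [Finset.sum_comm]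
  refine Finset.sum_congr rfl fun k _ => Finset.sum_congr rfl fun l _ => ?_
  change Y l j • X i k • (tMat q N k l : OSU q) = _
  rw [tMat_coe, smul_mul_smul_comm, smul_smul, mul_comm]

theorem projN_eq (N : ℤ) : projN q N =
    sigmaS q N.natAbs Uq.K * tMat q N * sigmaS q N.natAbs Uq.Ki := by
  rw [projN, repLin_rho_Ki, repLin_rho_K, scalarMat_sigma, scalarMat_sigma]

section action
variable (N : ℤ)

/-- The product rule gives `(E ▷ t*) (K ▷ t) + (K⁻¹ ▷ t*) (E ▷ t)`. Here `E ▷ t* = -q (F ▷ t)*` and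
`K⁻¹ ▷ t* = (K ▷ t)*`, and taking adjoints turns `σ(F)` into `σ(E)` and preserves `σ(K)`. -/
theorem tMat_map_E : (tMat q N).map (actS q Uq.E) =
    -(q : ℂ) • (sigmaS q N.natAbs Uq.E * tMat q N * sigmaS q N.natAbs Uq.K) +
      sigmaS q N.natAbs Uq.K * tMat q N * sigmaS q N.natAbs Uq.E := by
  obtain ⟨x, y, h, h0⟩ := exists_isDoublet (q := q) N
  simp only [← scalarMat_sigma]
  ext i j
  change (actS q Uq.E (tMat q N i j) : OSU q) = -(q : ℂ) • (((_ : Matrix _ _ (podles q)) i j :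
    podles q) : OSU q) + (((_ : Matrix _ _ (podles q)) i j : podles q) : OSU q)
  rw [coe_mul_tMat_mul, coe_mul_tMat_mul, actS_coe, OSU.act_E, tMat_coe, OSU.actE_mul,
    OSU.actE_star, ← OSU.star_actK, h.actE_tmat_eq_sum h0, h.actF_tmat_eq_sum h0,
    h.actK_tmat_eq_sum h0, h.actK_tmat_eq_sum h0, star_sum_smul, star_sum_smul,
    sigmaF_conjTranspose, sigmaK_conjTranspose, sigma_E, sigma_K, smul_mul_assoc]

theorem tMat_map_F : (tMat q N).map (actS q Uq.F) =
    -(q : ℂ)⁻¹ • (sigmaS q N.natAbs Uq.F * tMat q N * sigmaS q N.natAbs Uq.K) +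
      sigmaS q N.natAbs Uq.K * tMat q N * sigmaS q N.natAbs Uq.F := by
  obtain ⟨x, y, h, h0⟩ := exists_isDoublet (q := q) N
  simp only [← scalarMat_sigma]
  ext i j
  change (actS q Uq.F (tMat q N i j) : OSU q) = -(q : ℂ)⁻¹ • (((_ : Matrix _ _ (podles q)) i j :
    podles q) : OSU q) + (((_ : Matrix _ _ (podles q)) i j : podles q) : OSU q)
  rw [coe_mul_tMat_mul, coe_mul_tMat_mul, actS_coe, OSU.act_F, tMat_coe, OSU.actF_mul,
    OSU.actF_star, ← OSU.star_actK, h.actE_tmat_eq_sum h0, h.actF_tmat_eq_sum h0,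
    h.actK_tmat_eq_sum h0, h.actK_tmat_eq_sum h0, star_sum_smul, star_sum_smul,
    sigmaE_conjTranspose, sigmaK_conjTranspose, sigma_F, sigma_K, smul_mul_assoc]

theorem tMat_map_K : (tMat q N).map (actS q Uq.K) =
    sigmaS q N.natAbs Uq.Ki * tMat q N * sigmaS q N.natAbs Uq.K := by
  obtain ⟨x, y, h, h0⟩ := exists_isDoublet (q := q) N
  simp only [← scalarMat_sigma]
  ext i j
  rw [coe_mul_tMat_mul, Matrix.map_apply, actS_coe, OSU.act_K, tMat_coe, map_mul,
    ← OSU.star_actKi, h.actKi_tmat_eq_sum h0, h.actK_tmat_eq_sum h0, star_sum_smul,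
    sigmaKi_conjTranspose, sigma_Ki, sigma_K]

theorem tMat_map_Ki : (tMat q N).map (actS q Uq.Ki) =
    sigmaS q N.natAbs Uq.K * tMat q N * sigmaS q N.natAbs Uq.Ki := by
  obtain ⟨x, y, h, h0⟩ := exists_isDoublet (q := q) N
  simp only [← scalarMat_sigma]
  ext i j
  rw [coe_mul_tMat_mul, Matrix.map_apply, actS_coe, OSU.act_Ki, tMat_coe, map_mul,
    ← OSU.star_actK, h.actKi_tmat_eq_sum h0, h.actK_tmat_eq_sum h0, star_sum_smul,
    sigmaK_conjTranspose, sigma_Ki, sigma_K]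

/-- Associativity brings `t t* = 1` into the middle of `t* t t* t`. -/
theorem tMat_mul_self : tMat q N * tMat q N = tMat q N := by
  obtain ⟨x, y, h, h0⟩ := exists_isDoublet (q := q) N
  ext i j
  rw [Matrix.mul_apply]
  change (podles q).toSubalgebra.val.toLinearMap _ = _
  rw [map_sum]
  change ∑ k, (tMat q N i k : OSU q) * (tMat q N k j : OSU q) = _
  have e : ∀ k : Fin (N.natAbs + 1), (tMat q N i k : OSU q) * (tMat q N k j : OSU q) =
      star (tmat q N.natAbs (rowIdx N) i) * (tmat q N.natAbs (rowIdx N) k *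
        star (tmat q N.natAbs (rowIdx N) k)) * tmat q N.natAbs (rowIdx N) j := by
    intro k; rw [tMat_coe, tMat_coe]; simp only [mul_assoc]
  rw [Finset.sum_congr rfl fun k _ => e k, ← Finset.sum_mul, ← Finset.mul_sum,
    h.sum_tmat_mul_star h0, mul_one, tMat_coe]

theorem projN_coe (i j : Fin (N.natAbs + 1)) : (projN q N i j : OSU q) =
    (sqrtC q ^ (2 * (i : ℤ) - N.natAbs) * sqrtC q ^ (-(2 * (j : ℤ) - N.natAbs))) •
      (star (tmat q N.natAbs (rowIdx N) i) * tmat q N.natAbs (rowIdx N) j) := by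
  rw [projN_eq, ← scalarMat_sigma, ← scalarMat_sigma, coe_mul_tMat_mul, sigma_K, sigma_Ki,
    Finset.sum_eq_single i, Finset.sum_eq_single j, sigmaK, sigmaKi, Matrix.diagonal_apply_eq,
    Matrix.diagonal_apply_eq, smul_mul_smul_comm]
  · intro k _ hk; rw [sigmaKi, Matrix.diagonal_apply_ne _ hk, zero_smul]
  · simp
  · intro k _ hk; rw [sigmaK, Matrix.diagonal_apply_ne _ (Ne.symm hk), zero_smul]
  · simp

theorem projN_isInvProj : IsInvProj (actS q) (thetaInv q) (rho q N.natAbs) (projN q N) where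
  rep_star := repLin_rho_star _
  idem := by
    have k : ∀ X, sigmaS q N.natAbs Uq.Ki * (sigmaS q N.natAbs Uq.K * X) = X := by
      intro X; rw [← mul_assoc, ← map_mul, Uq.Ki_mul_K, map_one, one_mul]
    have t : ∀ X, tMat q N * (tMat q N * X) = tMat q N * X := by
      intro X; rw [← mul_assoc, tMat_mul_self]
    rw [projN_eq]
    simp only [mul_assoc, k, t]
  selfAdjoint := by
    obtain ⟨x, y, h, h0⟩ := exists_isDoublet (q := q) N
    have hs := sqrtC_ne (q := q)
    have hc : ∀ i : ℤ, star (sqrtC q ^ i) = sqrtC q ^ i := by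
      intro i; rw [star_zpow₀, RCLike.star_def, conj_sqrtC]
    ext i j
    -- The `(j, i)` entry of `P_N` is `q^(j-i) tⱼ* tᵢ`, and `θ⁻¹` scales `tⱼ* tᵢ` by `q^(2(i-j))`.
    -- The result `q^(i-j)` is the factor in the `(i, j)` entry; this is the purpose of the
    -- conjugation by `K` in `P_N`.
    change star (actS q (Uq.K * Uq.K) (projN q N j i) : OSU q) = _
    have hst : ∀ k : Fin (N.natAbs + 1), OSU.actKi (star (tmat q N.natAbs (rowIdx N) k)) =
        sqrtC q ^ (2 * (k : ℤ) - N.natAbs) • star (tmat q N.natAbs (rowIdx N) k) := by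
      intro k; rw [← OSU.star_actK, h.actK_tmat h0 (by omega), star_smul, hc]
    rw [actS_coe, projN_coe, projN_coe, map_mul, Module.End.mul_apply, OSU.act_K, OSU.act_K,
      OSU.star_actK, OSU.star_actK, star_smul, star_mul (star _), star_star, star_mul', hc, hc,
      map_smul, map_smul, map_mul, map_mul, hst, h.actKi_tmat h0 (by omega), map_smul, map_smul,
      hst, h.actKi_tmat h0 (by omega)]
    simp only [smul_mul_assoc, mul_smul_comm, smul_smul, ← zpow_add₀ hs]
    congr 2
    ring
  invariant f := by
    rw [projN_eq]
    exact adR_eq_counit_smul (tMat_map_E N) (tMat_map_F N) (tMat_map_K N) (tMat_map_Ki N) f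

/-- The matrix `ρ(K⁻²) = σ(K²)` is diagonal with entries `q^(2i-|N|)`, and on the diagonal of `P_N`
the conjugation by `K` has no effect. -/
theorem qTrace_projN_coe :
    ((qTrace (Uq.Ki * Uq.Ki) (rho q N.natAbs) (projN q N) : podles q) : OSU q) =
    ∑ i : Fin (N.natAbs + 1), (q : ℂ) ^ (2 * (i : ℤ) - N.natAbs) •
      (star (tmat q N.natAbs (rowIdx N) i) * tmat q N.natAbs (rowIdx N) i) := by
  have hs := sqrtC_ne (q := q)
  change (podles q).toSubalgebra.val.toLinearMap _ = _
  simp only [qTrace, map_sum, map_smul]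
  refine Finset.sum_congr rfl fun i _ => ?_
  rw [Finset.sum_eq_single i]
  · change _ • (projN q N i i : OSU q) = _
    rw [projN_coe, repLin_mul, repLin_rho_Ki, sigma_K, sigmaK, Matrix.diagonal_mul_diagonal,
      Matrix.diagonal_apply_eq, smul_smul, ← zpow_add₀ hs, ← zpow_add₀ hs, add_neg_cancel,
      zpow_zero, mul_one, ← sqrtC_sq (q := q), mul_zpow, ← zpow_add₀ hs]
  · intro j _ hj
    rw [repLin_mul, repLin_rho_Ki, sigma_K, sigmaK, Matrix.diagonal_mul_diagonal,
      Matrix.diagonal_apply_ne _ hj, zero_smul]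
  · simp

end action

/-! ### The values of the pairings -/

theorem pairingS_of (φ : HC0 (theta q)) (P : InvProj (actS q) (thetaInv q)) :
    pairingS q φ (K0.of _ _ P) = φ.1 (qTrace (Uq.Ki * Uq.Ki) P.rep P.proj) :=
  pairing_of _ _ _ _ _ _

/-- The products in numerator and denominator agree after reversal of the order, and the exponent of
`q` is zero. -/
theorem rowWeight_self (m : ℕ) : rowWeight q m m = 1 := by
  have h1 : ∏ i ∈ Finset.range m, (qNum q (i + 1) : ℂ) ≠ 0 :=
    Finset.prod_ne_zero_iff.2 fun i _ => OSU.qNum_ne (by omega)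
  have h2 : ∏ i ∈ Finset.range m, (qNum q (m - i) : ℂ) =
      ∏ i ∈ Finset.range m, (qNum q (i + 1) : ℂ) := by
    rw [← Finset.prod_range_reflect]
    refine Finset.prod_congr rfl fun i hi => ?_
    have := Finset.mem_range.1 hi
    congr 2
    omega
  rw [rowWeight, h2, div_self h1, sub_self, mul_zero, neg_zero, zpow_zero, one_mul]

/-- The counit is a character that kills `b` and `c`. For `N ≥ 0` the row is built from `(c, d)` and
only the last entry survives, with weight `q^|N|`; for `N < 0` it is built from `(a, b)` and only
the first survives, with weight `q^(-|N|)`. Both weights are `q^N`. -/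
theorem epsS_qTrace_projN (N : ℤ) :
    epsS q (qTrace (Uq.Ki * Uq.Ki) (rho q N.natAbs) (projN q N)) = (q : ℂ) ^ N := by
  rw [epsS_apply, qTrace_projN_coe, map_sum]
  simp only [map_smul, map_mul, OSU.counit_star, smul_eq_mul]
  rcases le_or_gt 0 N with hN | hN
  · have hr : rowIdx N = N.natAbs := by rw [rowIdx, if_pos hN]
    -- The convention `0 ^ 0 = 1` singles out the entry without a factor `c`.
    have e : ∀ k ≤ N.natAbs, OSU.counit (tmat q N.natAbs (rowIdx N) k) =
        rowCoeff q N.natAbs k * 0 ^ (N.natAbs - k) := by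
      intro k hk
      rw [hr, isDoublet_cd.tmat_eq (tmat_self_zero _) hk]
      simp [OSU.counit]
    rw [Finset.sum_eq_single (Fin.last _)]
    · rw [e _ (by simp), Fin.val_last, Nat.sub_self, pow_zero, mul_one, conj_rowCoeff,
        rowCoeff_mul_self le_rfl, rowWeight_self, mul_one]
      congr 1
      omega
    · intro k _ hk
      have hk' : (k : ℕ) ≠ N.natAbs := fun hk' => hk (Fin.ext hk')
      rw [e _ (by omega), zero_pow (by omega), mul_zero, mul_zero, mul_zero]
    · simp
  · have hr : rowIdx N = 0 := by rw [rowIdx, if_neg (by omega)]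
    have e : ∀ k ≤ N.natAbs, OSU.counit (tmat q N.natAbs (rowIdx N) k) =
        rowCoeff q N.natAbs k * 0 ^ k := by
      intro k hk
      rw [hr, isDoublet_ab.tmat_eq (tmat_zero_zero _) hk]
      simp [OSU.counit]
    rw [Finset.sum_eq_single 0]
    · rw [e _ (by simp), Fin.val_zero, pow_zero, mul_one, rowCoeff, map_one, mul_one, mul_one]
      congr 1
      omega
    · intro k _ hk
      have hk' : (k : ℕ) ≠ 0 := fun hk' => hk (Fin.ext hk')
      rw [e _ (by omega), zero_pow hk', mul_zero, mul_zero, mul_zero]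
    · simp

/-- By the modular property `h(tᵢ* tᵢ)` is `h(tᵢ tᵢ*)` times `q^(-N)` from `∂_{K²}` and `q^(|N|-2i)`
from `K⁻²`. The latter cancels the weight in the quantum trace, and `∑ tᵢ tᵢ* = 1` is left under
`h`. -/
theorem haarS_qTrace_projN (N : ℤ) :
    haarS q (qTrace (Uq.Ki * Uq.Ki) (rho q N.natAbs) (projN q N)) = (q : ℂ) ^ (-N) := by
  obtain ⟨x, y, h, h0⟩ := exists_isDoublet (q := q) N
  have hq0 := Uq.q_ne (q := q)
  have hs := sqrtC_ne (q := q)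
  have hr : rowIdx N ≤ N.natAbs := by unfold rowIdx; split_ifs <;> omega
  -- The weight of the row under `∂_{K²}` is `q^(-2j)` with `j = N/2`.
  have hN : (N.natAbs : ℤ) - 2 * rowIdx N = -N := by unfold rowIdx; split_ifs <;> omega
  have e : ∀ i : Fin (N.natAbs + 1), haar q ((q : ℂ) ^ (2 * (i : ℤ) - N.natAbs) •
      (star (tmat q N.natAbs (rowIdx N) i) * tmat q N.natAbs (rowIdx N) i)) =
      (q : ℂ) ^ (-N) * haar q (tmat q N.natAbs (rowIdx N) i *
        star (tmat q N.natAbs (rowIdx N) i)) := by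
    intro i
    rw [map_smul, OSU.haar_mul, OSU.modular_apply, dK2_tmat q hr, hN, map_smul, map_smul,
      h.actKi_tmat h0 (by omega), map_smul, h.actKi_tmat h0 (by omega), smul_smul, smul_smul,
      smul_mul_assoc, map_smul, smul_eq_mul, smul_eq_mul, ← mul_assoc]
    congr 1
    rw [← sqrtC_sq (q := q), mul_zpow, mul_zpow]
    simp only [← zpow_add₀ hs]
    congr 1
    ring
  rw [haarS_apply, qTrace_projN_coe, map_sum, Finset.sum_congr rfl fun i _ => e i,
    ← Finset.mul_sum, ← map_sum, h.sum_tmat_mul_star h0, Haar.haar_one, mul_one]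

end

end QSphere

end

/-! ### The proposition -/

theorem mainTheorem10 (q : ℝ) [Fact (0 < q)] [Fact (q ≠ 1)] :
    ∃ (hε : QSphere.epsS q ∈ QSphere.HC0 (QSphere.theta q))
      (hh : QSphere.haarS q ∈ QSphere.HC0 (QSphere.theta q)),
      LinearIndependent ℂ
        ![(⟨QSphere.epsS q, hε⟩ : QSphere.HC0 (QSphere.theta q)), ⟨QSphere.haarS q, hh⟩] ∧
      Submodule.span ℂ
        {(⟨QSphere.epsS q, hε⟩ : QSphere.HC0 (QSphere.theta q)), ⟨QSphere.haarS q, hh⟩} = ⊤ ∧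
      ∀ N : ℤ, ∃ hP : QSphere.IsInvProj (QSphere.actS q) (QSphere.thetaInv q)
          (QSphere.rho q N.natAbs) (QSphere.projN q N),
        QSphere.pairingS q ⟨QSphere.epsS q, hε⟩ (QSphere.K0.of _ _ ⟨_, _, _, hP⟩) =
          (q : ℂ) ^ N ∧
        QSphere.pairingS q ⟨QSphere.haarS q, hh⟩ (QSphere.K0.of _ _ ⟨_, _, _, hP⟩) =
          (q : ℂ) ^ (-N) := by
  refine ⟨QSphere.epsS_mem, QSphere.haarS_mem, QSphere.linearIndependent_epsS_haarS,
    QSphere.span_epsS_haarS, fun N => ⟨QSphere.projN_isInvProj N, ?_, ?_⟩⟩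
  · rw [QSphere.pairingS_of]
    exact QSphere.epsS_qTrace_projN N
  · rw [QSphere.pairingS_of]
    exact QSphere.haarS_qTrace_projN N
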